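/- **Setting.** Let $T>0$, let $d,k$ be natural numbers, and let $|\cdot|$ be the Euclidean norm. For $N\in\mathbb N$ let $\mathcal D^N$ be the space of càdlàg functions $[0,T]\to\mathbb R^N$ with the $\sigma$-algebra generated by the coordinate maps, and let $\mathcal D^k_\uparrow\subseteq\mathcal D^k$ be the set of componentwise nondecreasing $A$ with $A_0\ge 0$ componentwise. For $A\in\mathcal D^k_\uparrow$ put $$\int_{[0,T]} x(t)\,dA_t=\sum_{i=1}^k\Big(x^i(0)A^i_0+\int_{(0,T]}x^i(t)\,dA^i_t\Big),$$ that is, $A_{0-}=0$. For a process $X$ let $\mathcal F^X_t=\sigma(X_s: s\le t)$ be its raw filtration, and let $\mathcal F^X_{t+}=\bigcap_{s>t}\mathcal F^X_s$ for $t<T$ and $\mathcal F^X_{T+}=\mathcal F^X_T$. Fix a probability measure $\mathbb P_0$ on $\mathcal D^d$. A probability measure $\mathbb P$ on $\mathcal D^d\times\mathcal D^k_\uparrow$, with coordinate process $(L,A)$, is *admissible*, written $\mathbb P\in\mathcal A$, if its $L$-marginal is $\mathbb P_0$ and if for each $t\in[0,T]$ the $\sigma$-algebras $\mathcal F^A_t$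 and $\mathcal F^L_T$ are $\mathbb P$-conditionally independent given $\mathcal F^L_{t+}$. Let $f:[0,T]\to[0,\infty)^k$ be continuous and let $g,h:\mathbb R^d\times[0,\infty)^k\to[0,\infty)$ be Borel measurable, such that $g(l,\cdot)$ and $h(l,\cdot)$ are convex and continuously differentiable on $[0,\infty)^k$ for each $l\in\mathbb R^d$. Write $\nabla g$ and $\nabla h$ for the gradients in the second variable. Put $$C(L,A)=\int_{[0,T]}f(t)\,dA_t+\int_0^T h(L_t,A_t)\,dt+g(L_T,A_T),\qquad V=\inf_{\mathbb P\in\mathcal A}\mathbb E^{\mathbb P}[C(L,A)].$$ **Corollary (existence for the Pontryagin FBSDE).** Suppose that 1. (linear coercivity) there are constants $\kappa,K>0$ such that $\mathbb E^{\mathbb P}[C(L,A)]\ge\kappa\,\mathbb E^{\mathbb P}[|A_T|]$ for all $\mathbb P\in\mathcal A$ with $\mathbb E^{\mathbb P}[|A_T|]\ge K$; 2. (gradient growth) there are Borel functions $\Phi_g,\Phi_h:\mathbb R^d\to[0,\infty)$ and a constant $M\ge 0$ such that $\mathbb E^{\mathbb P_0}\big[\int_0^T\Phi_h(L_t)\,dt+\Phi_g(L_T)\big]<\infty$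 and, for $\varphi\in\{g,h\}$, $$|\nabla\varphi(l,a)|\le\Phi_\varphi(l)+M\varphi(l,a)\quad\text{for all }(l,a)\in\mathbb R^d\times[0,\infty)^k;$$ 3. $V<\infty$. Then the Pontryagin FBSDE has a weak solution. That is, there is a probability measure $\tilde{\mathbb P}$ on $\mathcal D^{d}\times\mathcal D^k\times\mathcal D^k$, with coordinate process $(L,A,Y)$, such that * the law of $(L,A)$ under $\tilde{\mathbb P}$ is admissible (in particular $A\in\mathcal D^k_\uparrow$ a.s.); * $\tilde{\mathbb P}$-a.s., $Y_t\ge 0$ componentwise for all $t\in[0,T]$, and $\int_{[0,T]}Y_t\,dA_t=0$; * $\tilde{\mathbb P}$-a.s., $\int_0^T|\nabla h(L_t,A_t)|\,dt<\infty$; the $\mathbb R^k$-valued process $Y_t+\int_0^t\nabla h(L_s,A_s)\,ds-f(t)$, $t\in[0,T]$, is a $\tilde{\mathbb P}$-martingale with respect to the raw filtration $\mathcal F^{L,A,Y}$; and $Y_T=f(T)+\nabla g(L_T,A_T)$, $\tilde{\mathbb P}$-a.s. -/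

import Mathlib

open MeasureTheory ProbabilityTheory
open scoped ENNReal NNReal Topology

namespace MonotoneFollower

noncomputable section

/-- Euclidean space `ℝᴺ`, with the Euclidean norm. -/
abbrev E (N : ℕ) : Type := EuclideanSpace ℝ (Fin N)

/-- The closed orthant `[0,∞)ᵏ`. -/
def orthant (k : ℕ) : Set (E k) := {a | ∀ i, 0 ≤ a i}

/-- The time interval `[0,T]`. -/
abbrev Time (T : ℝ) : Type := Set.Icc (0 : ℝ) T

instance factNonneg (T : ℝ) [h : Fact (0 < T)] : Fact ((0 : ℝ) ≤ T) := ⟨h.out.le⟩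

/-- Lebesgue measure on `[0,T]`. -/
def leb (T : ℝ) : Measure (Time T) := (volume : Measure ℝ).comap Subtype.val

/-- Right-continuous with left limits. At the time `T` right-continuity is void, and at the time
`0` the existence of a left limit is void (the filters are trivial there). -/
def IsCadlag {T : ℝ} {N : ℕ} (x : Time T → E N) : Prop :=
  ∀ t, ContinuousWithinAt x (Set.Ici t) t ∧ ∃ l, Filter.Tendsto x (𝓝[<] t) (𝓝 l)

/-- The space of càdlàg paths `[0,T] → ℝᴺ`. -/
def Skorokhod (T : ℝ) (N : ℕ) : Type := {x : Time T → E N // IsCadlag x}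

/-- The space of càdlàg paths which are componentwise nondecreasing and nonnegative at `0`. -/
def IncSkorokhod (T : ℝ) [Fact (0 < T)] (k : ℕ) : Type :=
  {x : Time T → E k // IsCadlag x ∧ (∀ i, Monotone fun t => x t i) ∧ ∀ i, 0 ≤ x ⊥ i}

instance (T : ℝ) (N : ℕ) : CoeFun (Skorokhod T N) fun _ => Time T → E N := ⟨Subtype.val⟩

/-- The σ-algebra generated by the coordinate maps (the product σ-algebra, traced). -/
instance (T : ℝ) (N : ℕ) : MeasurableSpace (Skorokhod T N) :=
  MeasurableSpace.comap Subtype.val MeasurableSpace.pi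

theorem Skorokhod.measurable_eval {T : ℝ} {N : ℕ} (t : Time T) :
    Measurable fun x : Skorokhod T N => x t :=
  (measurable_pi_apply t).comp (comap_measurable Subtype.val)

section

variable {T : ℝ} [Fact (0 < T)]

instance (k : ℕ) : CoeFun (IncSkorokhod T k) fun _ => Time T → E k := ⟨Subtype.val⟩

/-- The σ-algebra generated by the coordinate maps. -/
instance (k : ℕ) : MeasurableSpace (IncSkorokhod T k) :=
  MeasurableSpace.comap Subtype.val MeasurableSpace.pi

theorem IncSkorokhod.measurable_eval {k : ℕ} (t : Time T) :
    Measurable fun x : IncSkorokhod T k => x t :=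
  (measurable_pi_apply t).comp (comap_measurable Subtype.val)

/-! ### Stieltjes integration against nondecreasing paths -/

/-- A component of a nondecreasing càdlàg path, as a Stieltjes function on `[0,T]`. -/
def IncSkorokhod.stieltjes {k : ℕ} (A : IncSkorokhod T k) (i : Fin k) :
    StieltjesFunction (Time T) where
  toFun t := A t i
  mono' := A.2.2.1 i
  right_continuous' t :=
    ((by fun_prop : Continuous fun a : E k => a i).continuousAt).comp_continuousWithinAt (A.2.1 t).1

/-- The measure `dAⁱ` on `[0,T]`: the Lebesgue-Stieltjes measure on `(0,T]` (Mathlib's measure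
gives no mass to the least point `0`), together with an atom of mass `Aⁱ₀` at `0`, corresponding
to the convention `Aⁱ₀₋ = 0`. -/
def IncSkorokhod.dMeasure {k : ℕ} (A : IncSkorokhod T k) (i : Fin k) : Measure (Time T) :=
  ENNReal.ofReal (A ⊥ i) • Measure.dirac ⊥ + (A.stieltjes i).measure

/-! ### The control problem -/

/-- The data `f, g, h` of a cost functional. The functions `g` and `h` matter only on
`ℝᵈ × [0,∞)ᵏ`. -/
structure CostData (T : ℝ) (d k : ℕ) where
  f : Time T → E k
  g : E d → E k → ℝ
  h : E d → E k → ℝ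
  f_continuous : Continuous f
  f_mem : ∀ t, f t ∈ orthant k
  g_measurable : Measurable fun p : E d × orthant k => g p.1 p.2
  h_measurable : Measurable fun p : E d × orthant k => h p.1 p.2
  g_nonneg : ∀ l, ∀ a ∈ orthant k, 0 ≤ g l a
  h_nonneg : ∀ l, ∀ a ∈ orthant k, 0 ≤ h l a
  g_convex : ∀ l, ConvexOn ℝ (orthant k) (g l)
  h_convex : ∀ l, ConvexOn ℝ (orthant k) (h l)

/-- The cost `C(L,A) = ∫_{[0,T]} f dA + ∫₀ᵀ h(L_t,A_t) dt + g(L_T,A_T)`, in `[0,∞]`. -/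
def CostData.cost {d k : ℕ} (c : CostData T d k) (L : Skorokhod T d) (A : IncSkorokhod T k) :
    ℝ≥0∞ :=
  (∑ i, ∫⁻ t, ENNReal.ofReal (c.f t i) ∂(A.dMeasure i))
    + (∫⁻ t, ENNReal.ofReal (c.h (L t) (A t)) ∂leb T)
    + ENNReal.ofReal (c.g (L ⊤) (A ⊤))

/-- The expected cost `J(P)`. -/
def CostData.expCost {d k : ℕ} (c : CostData T d k)
    (P : Measure (Skorokhod T d × IncSkorokhod T k)) : ℝ≥0∞ :=
  ∫⁻ ω, c.cost ω.1 ω.2 ∂P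

/-- The raw filtration generated by `L` on the space of pairs `(L,A)`. -/
def filtL (T : ℝ) [Fact (0 < T)] (d k : ℕ) :
    Filtration (Time T)
      (inferInstance : MeasurableSpace (Skorokhod T d × IncSkorokhod T k)) :=
  Filtration.natural (fun t ω => ω.1 t)
    fun t => ((Skorokhod.measurable_eval t).comp measurable_fst).stronglyMeasurable

/-- The raw filtration generated by `A` on the space of pairs `(L,A)`. -/
def filtA (T : ℝ) [Fact (0 < T)] (d k : ℕ) :
    Filtration (Time T)
      (inferInstance : MeasurableSpace (Skorokhod T d × IncSkorokhod T k)) :=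
  Filtration.natural (fun t ω => ω.2 t)
    fun t => ((IncSkorokhod.measurable_eval t).comp measurable_snd).stronglyMeasurable

/-- Conditionally on `m`, the σ-algebras `m₁` and `m₂` are `μ`-independent:
`μ(s ∩ t | m) = μ(s | m) μ(t | m)` a.s., for all `s ∈ m₁` and `t ∈ m₂`. -/
def CondIndependent {Ω : Type*} (m m₁ m₂ : MeasurableSpace Ω) {mΩ : MeasurableSpace Ω}
    (μ : Measure Ω) : Prop :=
  ∀ s t, MeasurableSet[m₁] s → MeasurableSet[m₂] t →
    μ⟦s ∩ t | m⟧ =ᵐ[μ] μ⟦s | m⟧ * μ⟦t | m⟧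

/-- `P` is an admissible control for the target law `P₀`. `Filtration.rightCont` is the
right-continuous enlargement `𝓕_{t+} = ⋂_{s>t} 𝓕_s`, with `𝓕_{T+} = 𝓕_T`. -/
structure Admissible {d k : ℕ} (P₀ : Measure (Skorokhod T d))
    (P : Measure (Skorokhod T d × IncSkorokhod T k)) : Prop where
  isProbabilityMeasure : IsProbabilityMeasure P
  marginal : P.map Prod.fst = P₀
  condIndep : ∀ t : Time T,
    CondIndependent ((filtL T d k).rightCont t) (filtA T d k t) (filtL T d k ⊤) P

/-- The value of the monotone-follower problem. -/
def CostData.value {d k : ℕ} (c : CostData T d k) (P₀ : Measure (Skorokhod T d)) : ℝ≥0∞ :=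
  ⨅ P : Measure (Skorokhod T d × IncSkorokhod T k), ⨅ _ : Admissible P₀ P, c.expCost P

/-- Linear coercivity of the cost functional. -/
def CostData.LinearlyCoercive {d k : ℕ} (c : CostData T d k) (P₀ : Measure (Skorokhod T d)) :
    Prop :=
  ∃ κ K : ℝ, 0 < κ ∧ 0 < K ∧
    ∀ P : Measure (Skorokhod T d × IncSkorokhod T k), Admissible P₀ P →
      ENNReal.ofReal K ≤ ∫⁻ ω, ‖ω.2 ⊤‖ₑ ∂P →
        ENNReal.ofReal κ * ∫⁻ ω, ‖ω.2 ⊤‖ₑ ∂P ≤ c.expCost P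

/-! ### The Pontryagin FBSDE -/

/-- `a ↦ φ(l,a)` is continuously differentiable on `[0,∞)ᵏ`, for each `l`. -/
def IsC1InControl {d k : ℕ} (φ : E d → E k → ℝ) : Prop :=
  ∀ l, ContDiffOn ℝ 1 (φ l) (orthant k)

/-- The gradient in the second variable, relative to `[0,∞)ᵏ`. -/
def grad {d k : ℕ} (φ : E d → E k → ℝ) (l : E d) (a : E k) : E k :=
  gradientWithin (φ l) (orthant k) a

/-- The growth condition on the gradients of `g` and `h`. -/
def CostData.GradientGrowth {d k : ℕ} (c : CostData T d k) (P₀ : Measure (Skorokhod T d)) :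
    Prop :=
  ∃ (Φg Φh : E d → ℝ≥0) (M : ℝ≥0), Measurable Φg ∧ Measurable Φh ∧
    (∫⁻ L, ((∫⁻ t, Φh (L t) ∂leb T) + Φg (L ⊤)) ∂P₀ < ∞) ∧
    (∀ l, ∀ a ∈ orthant k, ‖grad c.g l a‖ ≤ Φg l + M * c.g l a) ∧
    (∀ l, ∀ a ∈ orthant k, ‖grad c.h l a‖ ≤ Φh l + M * c.h l a)

/-- The space of triples `(L,A,Y)`. -/
abbrev Triple (T : ℝ) [Fact (0 < T)] (d k : ℕ) : Type :=
  Skorokhod T d × IncSkorokhod T k × Skorokhod T k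

/-- The raw filtration generated by `(L,A,Y)`. -/
def filtLAY (T : ℝ) [Fact (0 < T)] (d k : ℕ) :
    Filtration (Time T) (inferInstance : MeasurableSpace (Triple T d k)) :=
  Filtration.natural (fun t ω => (ω.1 t, ω.2.1 t, ω.2.2 t)) fun t =>
    (((Skorokhod.measurable_eval t).comp measurable_fst).prodMk
      (((IncSkorokhod.measurable_eval t).comp (measurable_fst.comp measurable_snd)).prodMk
        ((Skorokhod.measurable_eval t).comp
          (measurable_snd.comp measurable_snd)))).stronglyMeasurable

/-- `Q` is a weak solution of the Pontryagin FBSDE with data `c` and target law `P₀`. Since the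
`(L,A)`-marginal of a solution is carried by the paths with `A` nondecreasing and `A₀ ≥ 0`, the
measure `Q` is taken on the space of triples with such `A`. -/
structure IsPontryaginSolution {d k : ℕ} (c : CostData T d k) (P₀ : Measure (Skorokhod T d))
    (Q : Measure (Triple T d k)) : Prop where
  isProbabilityMeasure : IsProbabilityMeasure Q
  admissible : Admissible P₀ (Q.map fun ω => (ω.1, ω.2.1))
  nonneg : ∀ᵐ ω ∂Q, ∀ t i, 0 ≤ ω.2.2 t i
  reflection : ∀ᵐ ω ∂Q, ∑ i, ∫ t, ω.2.2 t i ∂(ω.2.1.dMeasure i) = 0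
  integrable_grad : ∀ᵐ ω ∂Q, Integrable (fun t => grad c.h (ω.1 t) (ω.2.1 t)) (leb T)
  martingale : Martingale
    (fun t ω => ω.2.2 t + (∫ s in Set.Iic t, grad c.h (ω.1 s) (ω.2.1 s) ∂leb T) - c.f t)
    (filtLAY T d k) Q
  terminal : ∀ᵐ ω ∂Q, ω.2.2 ⊤ = c.f ⊤ + grad c.g (ω.1 ⊤) (ω.2.1 ⊤)

end

end

end MonotoneFollower

set_option linter.unusedSectionVars false

namespace MonotoneFollower

noncomputable section

open Filter Set


/-! ### Paths, their Stieltjes measures, dyadic grids and Riemann sums. -/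

section Paths

variable {T : ℝ} [hT : Fact (0 < T)] {k N : ℕ}

/-! Admissibility says that the control reveals no more about the future of L than the information
at `t+` does. This survives a change of control: if P is admissible and a is any nondecreasing
process adapted to the usual augmentation of the filtration of (L,A) under P, then the law of (L,a)
is admissible (`IsControl.admissible_map`). So no optimisation over measures is needed. One
admissible P of finite cost is fixed, and the cost is minimised over the controls living on that
single space. The minimiser need not attain the infimum over all admissible laws, but the FBSDE only
uses optimality against adapted perturbations.

Existence of the minimiser (`exists_optimal_control`). Coercivity, applied to the laws of (L,a),
bounds E|a_T| for controls of bounded cost. Since the cost is convex, the Komlós-type selection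
`exists_seq_ae_tendsto` produces nearly optimal controls converging almost everywhere on coordinates
× times × scenarios. Monotone paths converging on a dense set of times converge, off a countable
set, to the right-continuous regularisation of the limit. Weak convergence of the measures dA
together with Fatou's lemma gives lower semicontinuity of the cost.

First-order conditions (`CostData.FiniteCost.first_order`). Convexity and the gradient growth
dominate the difference quotients (`abs_slope_le`), so the cost is differentiable in bounded
directions b. By Fubini the derivative is the expectation of ∫ Γ db, where Γ_t = f(t) + ∇g(L_T,A_T)
+ ∫_t^T ∇h(L_s,A_s) ds. An extra unit push at time t on an event G known at t gives E[Γ_t; G] ≥ 0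
componentwise. Removing a fraction of the truncated path min(A,n) gives E ∫ Γ d min(A,n) ≤ 0.

The dual process (`exists_dual_process`). Y is a càdlàg version of E[Γ_t | F_t], obtained by
regularising a closed martingale with Doob's inequalities (`exists_cadlag_condExp`). The first
inequality yields Y ≥ 0. In Riemann sums Y may replace Γ under the expectation, so the second
inequality and Fatou's lemma yield ∫ Y d min(A,n) = 0, and every path A equals one of its
truncations. Finally Y + ∫∇h ds − f is the martingale closed by ∇g(L_T,A_T) + ∫_0^T ∇h ds. It stays
a martingale in the smaller raw filtration of (L,A,Y), and the law of this triple is the solution.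
-/

instance : IsFiniteMeasure (leb T) := by
  refine ⟨?_⟩
  rw [leb, Measure.comap_apply _ Subtype.val_injective
    (fun s hs => measurableSet_Icc.subtype_image hs) _ MeasurableSet.univ, image_univ,
    Subtype.range_coe, Real.volume_Icc]
  exact ENNReal.ofReal_lt_top

instance : NullSingletonClass (leb T) := by
  refine ⟨fun x => ?_⟩
  rw [leb, Measure.comap_apply _ Subtype.val_injective
    (fun s hs => measurableSet_Icc.subtype_image hs) _ (measurableSet_singleton x)]
  simp

/-- Makes sets of full measure dense, which is how countable dense sets of good times are found. The
interior `Ioo 0 T` is dense in `[0,T]`, so even a relatively open set around an endpoint contains a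
genuine interval. -/
instance : (leb T).IsOpenPosMeasure := by
  refine ⟨fun U hU hne h0 => ?_⟩
  rw [leb, Measure.comap_apply _ Subtype.val_injective
    (fun s hs => measurableSet_Icc.subtype_image hs) _ hU.measurableSet] at h0
  obtain ⟨V, hV, rfl⟩ := isOpen_induced_iff.1 hU
  rw [Subtype.image_preimage_coe] at h0
  obtain ⟨x, hx⟩ := hne
  have hx' : (x : ℝ) ∈ closure (Ioo 0 T) := by
    rw [closure_Ioo hT.out.ne]; exact x.2
  obtain ⟨y, hyV, hy⟩ := mem_closure_iff.1 hx' V hV hx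
  have hpos : 0 < volume (V ∩ Ioo 0 T) :=
    (hV.inter isOpen_Ioo).measure_pos volume ⟨y, hyV, hy⟩
  refine hpos.ne' (measure_mono_null ?_ h0)
  rw [inter_comm]
  exact inter_subset_inter Ioo_subset_Icc_self subset_rfl

instance : Nontrivial (Time T) :=
  ⟨⟨⊥, ⊤, fun h => hT.out.ne (congrArg Subtype.val h)⟩⟩

theorem nhdsGT_neBot_of_lt_top {t : Time T} (ht : t < ⊤) : (𝓝[>] t).NeBot :=
  nhdsGT_neBot_of_exists_gt ⟨⊤, ht⟩

/-- The measure `dAⁱ` has distribution function `Aⁱ`. -/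
theorem IncSkorokhod.dMeasure_Iic (A : IncSkorokhod T k) (i : Fin k) (t : Time T) :
    A.dMeasure i (Iic t) = ENNReal.ofReal (A t i) := by
  have hsplit : Iic t = {⊥} ∪ Ioc ⊥ t := by
    ext s
    simp only [mem_Iic, mem_union, mem_singleton_iff, mem_Ioc]
    constructor
    · intro h
      rcases eq_or_ne s ⊥ with h' | h'
      · exact Or.inl h'
      · exact Or.inr ⟨bot_lt_iff_ne_bot.2 h', h⟩
    · rintro (rfl | h)
      · exact bot_le
      · exact h.2
  have hbot : (A.stieltjes i).measure {⊥} = 0 := by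
    rw [← botSet_eq_singleton_of_isBot isBot_bot]
    exact (A.stieltjes i).measure_botSet
  have h1 : (A.stieltjes i).measure (Iic t) = ENNReal.ofReal (A t i - A ⊥ i) := by
    rw [hsplit, measure_union (by simp) measurableSet_Ioc, hbot, zero_add,
      StieltjesFunction.measure_Ioc]
    rfl
  rw [dMeasure, Measure.add_apply, Measure.smul_apply, h1, Measure.dirac_apply' _ measurableSet_Iic]
  simp only [mem_Iic, bot_le, indicator_of_mem, Pi.one_apply, smul_eq_mul, mul_one]
  rw [← ENNReal.ofReal_add (A.2.2.2 i) (sub_nonneg.2 (A.2.2.1 i bot_le))]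
  congr 1
  ring

theorem IncSkorokhod.nonneg (A : IncSkorokhod T k) (t : Time T) (i : Fin k) : 0 ≤ A t i :=
  (A.2.2.2 i).trans (A.2.2.1 i bot_le)

theorem IncSkorokhod.le_top (A : IncSkorokhod T k) (t : Time T) (i : Fin k) : A t i ≤ A ⊤ i :=
  A.2.2.1 i _root_.le_top

theorem IncSkorokhod.mem_orthant (A : IncSkorokhod T k) (t : Time T) : A t ∈ orthant k :=
  fun i => A.nonneg t i

theorem IncSkorokhod.dMeasure_univ (A : IncSkorokhod T k) (i : Fin k) :
    A.dMeasure i univ = ENNReal.ofReal (A ⊤ i) := by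
  rw [← A.dMeasure_Iic, Iic_top]

instance (A : IncSkorokhod T k) (i : Fin k) : IsFiniteMeasure (A.dMeasure i) :=
  ⟨by rw [A.dMeasure_univ]; exact ENNReal.ofReal_lt_top⟩

theorem IncSkorokhod.dMeasure_real_Iic (A : IncSkorokhod T k) (i : Fin k) (t : Time T) :
    (A.dMeasure i).real (Iic t) = A t i := by
  rw [measureReal_def, A.dMeasure_Iic, ENNReal.toReal_ofReal (A.nonneg t i)]

theorem IncSkorokhod.dMeasure_real_univ (A : IncSkorokhod T k) (i : Fin k) :
    (A.dMeasure i).real univ = A ⊤ i := by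
  rw [← A.dMeasure_real_Iic, Iic_top]

/-- Finite measures on `[0,T]` are determined by their distribution functions, which are linear in
the path. The coefficients are nonnegative because these are measures; differences of paths are
treated by moving terms to the other side. -/
theorem IncSkorokhod.dMeasure_eq_of_linear {A B C : IncSkorokhod T k} {i : Fin k} {α β : ℝ}
    (hα : 0 ≤ α) (hβ : 0 ≤ β) (h : ∀ t, C t i = α * A t i + β * B t i) :
    C.dMeasure i = ENNReal.ofReal α • A.dMeasure i + ENNReal.ofReal β • B.dMeasure i := by
  have : IsFiniteMeasure (ENNReal.ofReal α • A.dMeasure i + ENNReal.ofReal β • B.dMeasure i) :=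
    ⟨by simp [ENNReal.mul_lt_top_iff]⟩
  refine Measure.ext_of_Iic _ _ fun t => ?_
  rw [Measure.add_apply, Measure.smul_apply, Measure.smul_apply, dMeasure_Iic, dMeasure_Iic,
    dMeasure_Iic, h, smul_eq_mul, smul_eq_mul, ENNReal.ofReal_add
      (mul_nonneg hα (A.nonneg t i)) (mul_nonneg hβ (B.nonneg t i)), ENNReal.ofReal_mul hα,
    ENNReal.ofReal_mul hβ]

theorem IncSkorokhod.measurable_iff {Ω : Type*} [MeasurableSpace Ω] {a : Ω → IncSkorokhod T k} :
    Measurable a ↔ ∀ t, Measurable fun ω => a ω t := by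
  refine ⟨fun h t => (IncSkorokhod.measurable_eval t).comp h, fun h => ?_⟩
  exact measurable_comap_iff.2 (measurable_pi_iff.2 h)

theorem Skorokhod.measurable_iff {Ω : Type*} [MeasurableSpace Ω] {a : Ω → Skorokhod T k} :
    Measurable a ↔ ∀ t, Measurable fun ω => a ω t := by
  refine ⟨fun h t => (Skorokhod.measurable_eval t).comp h, fun h => ?_⟩
  exact measurable_comap_iff.2 (measurable_pi_iff.2 h)

/-- Near each time the left limit bounds the path on the left and right-continuity bounds it on the
right; compactness of `[0,T]` glues the local bounds. -/
theorem IsCadlag.exists_norm_le {x : Time T → E N} (hx : IsCadlag x) : ∃ R, ∀ t, ‖x t‖ ≤ R := by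
  suffices h : ∃ R, ∀ t ∈ (univ : Set (Time T)), ‖x t‖ ≤ R by simpa using h
  refine isCompact_univ.induction_on (p := fun s => ∃ R, ∀ t ∈ s, ‖x t‖ ≤ R) ⟨0, by simp⟩ ?_ ?_ ?_
  · rintro s t hst ⟨R, hR⟩
    exact ⟨R, fun u hu => hR u (hst hu)⟩
  · rintro s t ⟨R, hR⟩ ⟨R', hR'⟩
    exact ⟨max R R', fun u hu => hu.elim (fun h => (hR u h).trans (le_max_left _ _))
      (fun h => (hR' u h).trans (le_max_right _ _))⟩
  · intro t _
    obtain ⟨hr, l, hl⟩ := hx t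
    have h1 : ∀ᶠ s in 𝓝[≥] t, ‖x s‖ < ‖x t‖ + 1 :=
      hr.norm.eventually (gt_mem_nhds (lt_add_one _))
    have h2 : ∀ᶠ s in 𝓝[<] t, ‖x s‖ < ‖l‖ + 1 :=
      hl.norm.eventually (gt_mem_nhds (lt_add_one _))
    refine ⟨{s | ‖x s‖ ≤ max (‖x t‖ + 1) (‖l‖ + 1)}, ?_, _, fun s hs => hs⟩
    rw [nhdsWithin_univ, ← nhdsLT_sup_nhdsGE]
    exact ⟨h2.mono fun s hs => hs.le.trans (le_max_right _ _),
      h1.mono fun s hs => hs.le.trans (le_max_left _ _)⟩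

/-! ### Dyadic grids -/

/-- The dyadic points `jT/2ⁿ` of `[0,T]`. -/
def gridPt (T : ℝ) [Fact (0 < T)] (n j : ℕ) : Time T :=
  projIcc 0 T (factNonneg T).out (T * j / 2 ^ n)

/-- The index of the least dyadic point of level `n` above `t`. -/
def gridIdx (n : ℕ) (t : Time T) : ℕ := ⌈(t : ℝ) * 2 ^ n / T⌉₊

/-- The least dyadic point of level `n` above `t`. -/
def gridUp (n : ℕ) (t : Time T) : Time T := gridPt T n (gridIdx n t)

/-- A Galois connection: the level sets of `gridIdx n` are the cell `{0}` and the half-open dyadic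
intervals, closed on the right. It also holds for `j` beyond `2ⁿ`, where `gridPt` is clamped to T.
-/
theorem gridIdx_le_iff {n j : ℕ} {t : Time T} : gridIdx n t ≤ j ↔ t ≤ gridPt T n j := by
  have hT' := hT.out
  rw [gridIdx, Nat.ceil_le, div_le_iff₀ hT', gridPt, ← Subtype.coe_le_coe, coe_projIcc,
    le_max_iff, le_min_iff, le_div_iff₀ (by positivity)]
  constructor
  · intro h
    exact Or.inr ⟨t.2.2, by linarith⟩
  · rintro (h | h)
    · have : (t : ℝ) = 0 := le_antisymm h t.2.1
      rw [this, zero_mul]; positivity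
    · linarith [h.2]

theorem le_gridUp (n : ℕ) (t : Time T) : t ≤ gridUp n t := gridIdx_le_iff.1 le_rfl

theorem gridIdx_le (n : ℕ) (t : Time T) : gridIdx n t ≤ 2 ^ n := by
  rw [gridIdx, Nat.ceil_le, div_le_iff₀ hT.out]
  push_cast
  have := t.2.2
  nlinarith [pow_pos (show (0 : ℝ) < 2 by norm_num) n]

theorem gridPt_mono (n : ℕ) : Monotone (gridPt T n) := by
  intro i j hij
  refine monotone_projIcc _ ?_
  have := hT.out
  gcongr

theorem gridPt_zero (n : ℕ) : gridPt T n 0 = ⊥ := by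
  apply Subtype.ext
  simp [gridPt]

theorem gridPt_pow (n : ℕ) : gridPt T n (2 ^ n) = ⊤ := by
  apply Subtype.ext
  simp [gridPt]

theorem gridPt_eq_of_le {m n : ℕ} (h : m ≤ n) (j : ℕ) :
    gridPt T m j = gridPt T n (j * 2 ^ (n - m)) := by
  rw [gridPt, gridPt]
  congr 1
  obtain ⟨r, rfl⟩ := Nat.exists_eq_add_of_le h
  rw [Nat.add_sub_cancel_left, pow_add]
  push_cast
  field_simp

theorem gridUp_coe_le (n : ℕ) (t : Time T) : (gridUp n t : ℝ) ≤ t + T / 2 ^ n := by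
  have hT' := hT.out
  have h0 : 0 ≤ (t : ℝ) * 2 ^ n / T := div_nonneg (mul_nonneg t.2.1 (by positivity)) hT'.le
  have h := (Nat.ceil_lt_add_one h0).le
  rw [gridUp, gridPt, coe_projIcc]
  refine max_le (add_nonneg t.2.1 (by positivity)) ((min_le_right _ _).trans ?_)
  rw [div_le_iff₀ (by positivity), gridIdx]
  calc T * (⌈(t : ℝ) * 2 ^ n / T⌉₊ : ℝ) ≤ T * ((t : ℝ) * 2 ^ n / T + 1) := by gcongr
    _ = (t + T / 2 ^ n) * 2 ^ n := by field_simp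

theorem tendsto_gridUp (t : Time T) : Tendsto (fun n => gridUp n t) atTop (𝓝[≥] t) := by
  refine tendsto_nhdsWithin_iff.2 ⟨?_, Eventually.of_forall fun n => le_gridUp n t⟩
  rw [tendsto_subtype_rng]
  refine tendsto_of_tendsto_of_tendsto_of_le_of_le tendsto_const_nhds (h := fun n : ℕ =>
    (t : ℝ) + T / 2 ^ n) ?_ (fun n => le_gridUp n t) (fun n => gridUp_coe_le n t)
  have : Tendsto (fun n : ℕ => T / 2 ^ n) atTop (𝓝 0) :=
    tendsto_const_nhds.div_atTop (tendsto_pow_atTop_atTop_of_one_lt (by norm_num))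
  simpa using this.const_add (t : ℝ)

theorem measurable_gridIdx (n : ℕ) : Measurable (gridIdx (T := T) n) := by
  unfold gridIdx
  exact Nat.measurable_ceil.comp (by fun_prop)

theorem measurable_gridUp (n : ℕ) : Measurable (gridUp (T := T) n) :=
  (measurable_from_nat (f := gridPt T n)).comp (measurable_gridIdx n)

theorem IsCadlag.tendsto_gridUp {x : Time T → E N} (hx : IsCadlag x) (t : Time T) :
    Tendsto (fun n => x (gridUp n t)) atTop (𝓝 (x t)) :=
  (hx t).1.tendsto.comp (MonotoneFollower.tendsto_gridUp t)

/-- A right-continuous process, stopped at a deterministic time, is jointly measurable with respect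
to the information available at that time. -/
theorem measurable_uncurry_min_of_isCadlag {Ω : Type*} [MeasurableSpace Ω]
    {X : Ω → Time T → E N} (hX : ∀ ω, IsCadlag (X ω)) {t₀ : Time T}
    (hm : ∀ s ≤ t₀, Measurable fun ω => X ω s) :
    Measurable fun p : Ω × Time T => X p.1 (min p.2 t₀) := by
  -- Times are rounded up to the grid, so that right-continuity gives convergence, and then cut off
  -- at `t₀`, so that no later value is consulted. Each approximation involves countably many times
  -- only.
  refine measurable_of_tendsto_metrizable (f := fun n (p : Ω × Time T) =>
    X p.1 (min (gridUp n (min p.2 t₀)) t₀)) (fun n => ?_) (tendsto_pi_nhds.2 fun p => ?_)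
  · have h1 : Measurable fun q : Ω × ℕ => X q.1 (min (gridPt T n q.2) t₀) :=
      measurable_from_prod_countable_left fun j => hm (min (gridPt T n j) t₀) (min_le_right _ _)
    have h2 : Measurable fun p : Ω × Time T => (p.1, gridIdx n (min p.2 t₀)) :=
      measurable_fst.prodMk ((measurable_gridIdx n).comp
        ((measurable_snd).min measurable_const))
    exact h1.comp h2
  · have h1 : Tendsto (fun n => min (gridUp n (min p.2 t₀)) t₀) atTop (𝓝[≥] (min p.2 t₀)) := by
      have h2 := MonotoneFollower.tendsto_gridUp (min p.2 t₀)
      refine tendsto_nhdsWithin_iff.2 ⟨?_, Eventually.of_forall fun n =>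
        le_min (le_gridUp n _) (min_le_right _ _)⟩
      have h3 := ((tendsto_nhdsWithin_iff.1 h2).1).min (tendsto_const_nhds (x := t₀))
      simpa using h3
    exact (hX p.1 _).1.tendsto.comp h1

theorem measurable_uncurry_of_isCadlag {Ω : Type*} [MeasurableSpace Ω]
    {X : Ω → Time T → E N} (hX : ∀ ω, IsCadlag (X ω)) (hm : ∀ s, Measurable fun ω => X ω s) :
    Measurable fun p : Ω × Time T => X p.1 p.2 := by
  simpa using measurable_uncurry_min_of_isCadlag hX (t₀ := ⊤) fun s _ => hm s

theorem IsCadlag.measurable {x : Time T → E N} (hx : IsCadlag x) : Measurable x :=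
  (measurable_uncurry_of_isCadlag (Ω := Unit) (X := fun _ => x) (fun _ => hx)
    fun _ => measurable_const).comp (measurable_const (a := ()) |>.prodMk measurable_id)

theorem IsCadlag.integrable_coord {x : Time T → E N} (hx : IsCadlag x) (i : Fin N)
    (μ : Measure (Time T)) [IsFiniteMeasure μ] : Integrable (fun t => x t i) μ := by
  obtain ⟨R, hR⟩ := hx.exists_norm_le
  refine Integrable.of_bound (C := R) ?_ (Eventually.of_forall fun t => ?_)
  · have := hx.measurable
    exact (by fun_prop : Measurable fun t => x t i).aestronglyMeasurable
  · exact (PiLp.norm_apply_le (x t) i).trans (hR t)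

/-! ### Riemann sums for Stieltjes integrals -/

/-- The increment of a path over the `j`-th dyadic interval of level `n`; the `0`-th of them is
`{0}`. -/
def gridIncr (n : ℕ) (b : Time T → ℝ) : ℕ → ℝ
  | 0 => b (gridPt T n 0)
  | j + 1 => b (gridPt T n (j + 1)) - b (gridPt T n j)

theorem gridIncr_nonneg (n : ℕ) {b : Time T → ℝ} (hb : Monotone b) (h0 : 0 ≤ b ⊥) (j : ℕ) :
    0 ≤ gridIncr n b j := by
  cases j with
  | zero => exact h0.trans (hb bot_le)
  | succ j => exact sub_nonneg.2 (hb (gridPt_mono n j.le_succ))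

theorem sum_gridIncr (n m : ℕ) (b : Time T → ℝ) :
    ∑ j ∈ Finset.range (m + 1), gridIncr n b j = b (gridPt T n m) := by
  induction m with
  | zero => simp [gridIncr]
  | succ m ih => rw [Finset.sum_range_succ, ih]; simp [gridIncr]

theorem IncSkorokhod.dMeasure_real_gridIdx_eq (A : IncSkorokhod T k) (i : Fin k) (n j : ℕ) :
    (A.dMeasure i).real {t | gridIdx n t = j} = gridIncr n (fun t => A t i) j := by
  cases j with
  | zero =>
    have : {t : Time T | gridIdx n t = 0} = Iic (gridPt T n 0) := by
      ext t
      simp [← gridIdx_le_iff]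
    rw [this, A.dMeasure_real_Iic]; rfl
  | succ j =>
    have : {t : Time T | gridIdx n t = j + 1} = Iic (gridPt T n (j + 1)) \ Iic (gridPt T n j) := by
      ext t
      simp only [mem_ofPred_eq, Set.mem_sdiff, mem_Iic, ← gridIdx_le_iff]
      omega
    rw [this, measureReal_sdiff (Iic_subset_Iic.2 (gridPt_mono n j.le_succ)) measurableSet_Iic,
      A.dMeasure_real_Iic, A.dMeasure_real_Iic]; rfl

/-- The Riemann sum of level `n` for `∫ y dAⁱ`. -/
def riemannSum (n : ℕ) (y b : Time T → ℝ) : ℝ :=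
  ∑ j ∈ Finset.range (2 ^ n + 1), gridIncr n b j * y (gridPt T n j)

/-- Rounding up makes the integrand constant on the cells of the grid. Evaluation is at right
endpoints, and the cell `{0}` carries the atom of mass A₀. -/
theorem IncSkorokhod.integral_gridUp (A : IncSkorokhod T k) (i : Fin k) (n : ℕ) (y : Time T → ℝ) :
    ∫ t, y (gridUp n t) ∂(A.dMeasure i) = riemannSum n y fun t => A t i := by
  have h1 : ∀ t, y (gridUp n t) = ∑ j ∈ Finset.range (2 ^ n + 1),
      ({s : Time T | gridIdx n s = j}).indicator (fun _ => y (gridPt T n j)) t := by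
    intro t
    rw [Finset.sum_eq_single (gridIdx n t)]
    · simp [gridUp]
    · intro j _ hj
      simp [hj.symm]
    · intro h
      exact absurd (Finset.mem_range.2 (Nat.lt_succ_of_le (gridIdx_le n t))) h
  have hms : ∀ j, MeasurableSet {s : Time T | gridIdx n s = j} := fun j =>
    measurable_gridIdx n (measurableSet_singleton j)
  simp_rw [h1]
  rw [integral_finsetSum _ fun j _ => (integrable_const _).indicator (hms j)]
  refine Finset.sum_congr rfl fun j _ => ?_
  rw [integral_indicator (hms j), setIntegral_const, A.dMeasure_real_gridIdx_eq, smul_eq_mul]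

/-- Right-continuity gives pointwise convergence of `y (gridUp n t)`, and càdlàg paths are bounded.
Right endpoints matter later as well: the increment over a cell is known at its right endpoint, so
conditioning there is possible. -/
theorem IncSkorokhod.tendsto_riemannSum (A : IncSkorokhod T k) (i : Fin k) {y : Time T → E N}
    (hy : IsCadlag y) (l : Fin N) :
    Tendsto (fun n => riemannSum n (fun t => y t l) fun t => A t i) atTop
      (𝓝 (∫ t, y t l ∂(A.dMeasure i))) := by
  obtain ⟨R, hR⟩ := hy.exists_norm_le
  have hm := hy.measurable
  simp_rw [← A.integral_gridUp]
  refine tendsto_integral_of_dominated_convergence (fun _ => R) (fun n => ?_)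
    (integrable_const _) (fun n => ?_) (Eventually.of_forall fun t => ?_)
  · have := measurable_gridUp (T := T) n
    exact (by fun_prop : Measurable fun t => y (gridUp n t) l).aestronglyMeasurable
  · exact Eventually.of_forall fun t => (PiLp.norm_apply_le _ _).trans (hR _)
  · exact ((by fun_prop : Continuous fun a : E N => a l).tendsto _).comp (hy.tendsto_gridUp t)

theorem riemannSum_nonneg (n : ℕ) {y b : Time T → ℝ} (hy : ∀ t, 0 ≤ y t) (hb : Monotone b)
    (h0 : 0 ≤ b ⊥) : 0 ≤ riemannSum n y b :=
  Finset.sum_nonneg fun j _ => mul_nonneg (gridIncr_nonneg n hb h0 j) (hy _)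

theorem abs_riemannSum_le (n : ℕ) {y b : Time T → ℝ} {R : ℝ} (hy : ∀ t, |y t| ≤ R)
    (hb : Monotone b) (h0 : 0 ≤ b ⊥) : |riemannSum n y b| ≤ R * b ⊤ := by
  calc |riemannSum n y b| ≤ ∑ j ∈ Finset.range (2 ^ n + 1), |gridIncr n b j * y (gridPt T n j)| :=
        Finset.abs_sum_le_sum_abs _ _
    _ ≤ ∑ j ∈ Finset.range (2 ^ n + 1), gridIncr n b j * R := by
        refine Finset.sum_le_sum fun j _ => ?_
        rw [abs_mul, abs_of_nonneg (gridIncr_nonneg n hb h0 j)]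
        exact mul_le_mul_of_nonneg_left (hy _) (gridIncr_nonneg n hb h0 j)
    _ = R * b ⊤ := by rw [← Finset.sum_mul, sum_gridIncr, gridPt_pow, mul_comm]

/-- Integration by parts: `∫_{[0,T]} (∫_t^T ψ ds) dAⁱ_t = ∫₀ᵀ ψ(s) Aⁱ_s ds`. -/
theorem IncSkorokhod.integral_integral_Ici (A : IncSkorokhod T k) (i : Fin k) {ψ : Time T → ℝ}
    (hψ : Integrable ψ (leb T)) :
    ∫ t, (∫ s in Ici t, ψ s ∂leb T) ∂(A.dMeasure i) = ∫ s, ψ s * A s i ∂leb T := by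
  -- Fubini on the triangle `t ≤ s`: for fixed `s`, the inner integral is the mass of `[0,s]`, which
  -- includes the atom at 0.
  have hset : MeasurableSet {p : Time T × Time T | p.1 ≤ p.2} := measurableSet_le'
  have hint : Integrable (fun p : Time T × Time T =>
      {p : Time T × Time T | p.1 ≤ p.2}.indicator (fun p => ψ p.2) p)
      ((A.dMeasure i).prod (leb T)) := (hψ.comp_snd _).indicator hset
  calc ∫ t, (∫ s in Ici t, ψ s ∂leb T) ∂(A.dMeasure i)
      = ∫ t, ∫ s, {p : Time T × Time T | p.1 ≤ p.2}.indicator (fun p => ψ p.2) (t, s) ∂leb T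
          ∂(A.dMeasure i) := by
        refine integral_congr_ae (Eventually.of_forall fun t => ?_)
        simp only
        rw [← integral_indicator measurableSet_Ici]
        rfl
    _ = ∫ s, ∫ t, {p : Time T × Time T | p.1 ≤ p.2}.indicator (fun p => ψ p.2) (t, s)
          ∂(A.dMeasure i) ∂leb T := integral_integral_swap hint
    _ = _ := by
        refine integral_congr_ae (Eventually.of_forall fun s => ?_)
        simp only
        have : (fun t => {p : Time T × Time T | p.1 ≤ p.2}.indicator (fun p => ψ p.2) (t, s)) =
            (Iic s).indicator fun _ => ψ s := by
          ext t; rfl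
        rw [this, integral_indicator measurableSet_Iic, setIntegral_const, A.dMeasure_real_Iic,
          smul_eq_mul, mul_comm]

end Paths


/-! ### Right-continuous regularisation of functions given on a dense set. -/

section Regularization

variable {T : ℝ} [hT : Fact (0 < T)] {k N : ℕ}

theorem tendsto_euclidean_iff {ι : Type*} {x : ι → E N} {l : Filter ι} {a : E N} :
    Tendsto x l (𝓝 a) ↔ ∀ i, Tendsto (fun n => x n i) l (𝓝 (a i)) := by
  refine ⟨fun h i => ((by fun_prop : Continuous fun a : E N => a i).tendsto a).comp h, fun h => ?_⟩
  have h1 := tendsto_pi_nhds.2 h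
  exact ((PiLp.continuous_toLp 2 _).tendsto _).comp h1

theorem measurable_euclidean_iff {Ω : Type*} [MeasurableSpace Ω] {x : Ω → E N} :
    Measurable x ↔ ∀ i, Measurable fun ω => x ω i :=
  ⟨fun h i => (by fun_prop : Measurable fun a : E N => a i).comp h, fun h =>
    (PiLp.continuous_toLp 2 _).measurable.comp (measurable_pi_iff.2 h)⟩

theorem integrable_euclidean_iff {Ω : Type*} [MeasurableSpace Ω] {μ : Measure Ω} {x : Ω → E N} :
    Integrable x μ ↔ ∀ i, Integrable (fun ω => x ω i) μ :=
  ⟨fun h i => (EuclideanSpace.proj (𝕜 := ℝ) i).integrable_comp h, fun h =>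
    ((PiLp.continuousLinearEquiv 2 ℝ fun _ : Fin N => ℝ).symm.toContinuousLinearMap).integrable_comp
      (Integrable.of_eval h)⟩

/-- `u` has one-sided limits along `D` at every time. -/
def HasSideLimits (D : Set (Time T)) (u : Time T → E N) : Prop :=
  ∀ t, (∃ l, Tendsto u (𝓝[D ∩ Ioi t] t) (𝓝 l)) ∧ ∃ l, Tendsto u (𝓝[D ∩ Iio t] t) (𝓝 l)

open scoped Classical in
/-- The right-continuous regularization of a function given on `D`. -/
def regularize (D : Set (Time T)) (u : Time T → E N) (t : Time T) : E N :=
  if t = ⊤ then u ⊤ else limUnder (𝓝[D ∩ Ioi t] t) u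

theorem nhdsWithin_inter_Ioi_neBot {D : Set (Time T)} (hD : Dense D) {t : Time T} (ht : t < ⊤) :
    (𝓝[D ∩ Ioi t] t).NeBot := by
  rw [← mem_closure_iff_nhdsWithin_neBot, inter_comm]
  exact closure_minimal (hD.open_subset_closure_inter isOpen_Ioi) isClosed_closure
    (mem_closure_iff_nhdsWithin_neBot.2 (nhdsGT_neBot_of_lt_top ht))

theorem regularize_top (D : Set (Time T)) (u : Time T → E N) : regularize D u ⊤ = u ⊤ := if_pos rfl

theorem tendsto_regularize {D : Set (Time T)} {u : Time T → E N}
    (hu : HasSideLimits D u) {t : Time T} (ht : t < ⊤) :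
    Tendsto u (𝓝[D ∩ Ioi t] t) (𝓝 (regularize D u t)) := by
  rw [regularize, if_neg ht.ne]
  exact tendsto_nhds_limUnder (hu t).1

theorem dist_regularize_le {D : Set (Time T)} (hD : Dense D) {u : Time T → E N}
    (hu : HasSideLimits D u) {O : Set (Time T)} (hO : IsOpen O) {l : E N} {ε : ℝ}
    (h : ∀ s ∈ D ∩ O, dist (u s) l ≤ ε) {t : Time T} (ht : t < ⊤) (htO : t ∈ O) :
    dist (regularize D u t) l ≤ ε := by
  have := nhdsWithin_inter_Ioi_neBot hD ht
  refine le_of_tendsto ((tendsto_regularize hu ht).dist tendsto_const_nhds) ?_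
  filter_upwards [self_mem_nhdsWithin, nhdsWithin_le_nhds (hO.mem_nhds htO)] with s hs hs'
  exact h s ⟨hs.1, hs'⟩

/-- Values of the regularisation are limits of nearby values of `u`, so a limit along `D ∩ I` is
inherited. The time T must be kept out of `I`, since the value there is `u ⊤` itself and not a right
limit. -/
theorem tendsto_regularize_of_tendsto {D : Set (Time T)} (hD : Dense D) {u : Time T → E N}
    (hu : HasSideLimits D u) {t : Time T} {I : Set (Time T)} (hI : IsOpen I) (htop : ⊤ ∉ I)
    {l : E N} (h : Tendsto u (𝓝[D ∩ I] t) (𝓝 l)) :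
    Tendsto (regularize D u) (𝓝[I] t) (𝓝 l) := by
  rw [Metric.tendsto_nhds]
  intro ε hε
  have h1 := Metric.tendsto_nhds.1 h (ε / 2) (half_pos hε)
  obtain ⟨O, hO, htO, hsub⟩ := mem_nhdsWithin.1 h1
  filter_upwards [self_mem_nhdsWithin, nhdsWithin_le_nhds (hO.mem_nhds htO)] with s hsI hsO
  refine (dist_regularize_le hD hu (hO.inter hI) (ε := ε / 2) (fun r hr => ?_)
    (lt_top_iff_ne_top.2 fun h => htop (h ▸ hsI)) ⟨hsO, hsI⟩).trans_lt (half_lt_self hε)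
  exact le_of_lt (hsub ⟨hr.2.1, hr.1, hr.2.2⟩)

theorem isCadlag_regularize {D : Set (Time T)} (hD : Dense D) {u : Time T → E N}
    (hu : HasSideLimits D u) : IsCadlag (regularize D u) := by
  intro t
  constructor
  · rcases eq_or_lt_of_le (le_top (a := t)) with rfl | ht
    · rw [Ici_top]
      exact continuousWithinAt_singleton
    · rw [← Ioi_insert, continuousWithinAt_insert_self]
      have h1 := tendsto_regularize hu ht
      have hev : Ioo t ⊤ ∈ 𝓝[>] t := Ioo_mem_nhdsGT ht
      have h2 : 𝓝[>] t = 𝓝[Ioo t ⊤] t := (nhdsWithin_Ioo_eq_nhdsGT ht).symm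
      rw [ContinuousWithinAt, h2]
      refine tendsto_regularize_of_tendsto hD hu isOpen_Ioo (by simp) (h1.mono_left ?_)
      exact nhdsWithin_mono _ (inter_subset_inter_right _ Ioo_subset_Ioi_self)
  · obtain ⟨l, hl⟩ := (hu t).2
    exact ⟨l, tendsto_regularize_of_tendsto hD hu isOpen_Iio (by simp) hl⟩

theorem exists_seq_between {D : Set (Time T)} (hD : Dense D) {t s : Time T} (hts : t < s) :
    ∃ q : ℕ → Time T, (∀ n, q n ∈ D ∧ t < q n ∧ q n < s) ∧ Tendsto q atTop (𝓝[D ∩ Ioi t] t) := by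
  have := nhdsWithin_inter_Ioi_neBot hD (hts.trans_le le_top)
  obtain ⟨q, hq⟩ := (𝓝[D ∩ Ioi t] t).exists_seq_tendsto
  have h1 : ∀ᶠ n in atTop, q n ∈ D ∧ t < q n ∧ q n < s := by
    filter_upwards [hq.eventually self_mem_nhdsWithin,
      hq.eventually (nhdsWithin_le_nhds (Iio_mem_nhds hts))] with n h1 h2
    exact ⟨h1.1, h1.2, h2⟩
  obtain ⟨m, hm⟩ := eventually_atTop.1 h1
  exact ⟨fun n => q (n + m), fun n => hm _ (Nat.le_add_left _ _),
    hq.comp (tendsto_add_atTop_nat m)⟩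

/-- Right-continuity of the filtration turns "known at every later time" into "known now"; this is
what makes right limits of adapted processes adapted. -/
theorem measurable_of_forall_gt {Ω β : Type*} [MeasurableSpace β] {mΩ : MeasurableSpace Ω}
    {f : Filtration (Time T) mΩ} [f.IsRightContinuous] {t : Time T} (ht : t < ⊤) {g : Ω → β}
    (h : ∀ s, t < s → Measurable[f s] g) : Measurable[f t] g := by
  have := nhdsGT_neBot_of_lt_top ht
  rw [← Filtration.IsRightContinuous.eq (𝓕 := f), Filtration.rightCont_eq_of_neBot_nhdsGT]
  intro B hB
  simp only [MeasurableSpace.measurableSet_iInf]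
  exact fun s hs => h s hs hB

theorem measurable_regularize {Ω : Type*} {mΩ : MeasurableSpace Ω}
    {f : Filtration (Time T) mΩ} [f.IsRightContinuous] {D : Set (Time T)} (hD : Dense D)
    (htop : ⊤ ∈ D) {u : Ω → Time T → E N} (hu : ∀ ω, HasSideLimits D (u ω))
    (hm : ∀ q ∈ D, Measurable[f q] fun ω => u ω q) (t : Time T) :
    Measurable[f t] fun ω => regularize D (u ω) t := by
  rcases eq_or_lt_of_le (le_top (a := t)) with rfl | ht
  · simp_rw [regularize_top]
    exact hm _ htop
  · refine measurable_of_forall_gt ht fun s hs => ?_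
    obtain ⟨q, hq, hlim⟩ := exists_seq_between hD hs
    refine @measurable_of_tendsto_metrizable _ _ (f s) _ _ _ _ (fun n ω => u ω (q n)) _
      (fun n => (hm _ (hq n).1).mono (f.mono (hq n).2.2.le) le_rfl) ?_
    exact tendsto_pi_nhds.2 fun ω => (tendsto_regularize (hu ω) ht).comp hlim

/-! ### Monotone functions -/

/-- Each coordinate is bounded on `D`, between 0 and its value at T, so it extends to a monotone
function on all of `[0,T]`, and monotone functions have one-sided limits. -/
theorem hasSideLimits_of_monotoneOn {D : Set (Time T)} {u : Time T → E N}
    (htop : ⊤ ∈ D) (hmono : ∀ i, MonotoneOn (fun t => u t i) D) (h0 : ∀ t ∈ D, ∀ i, 0 ≤ u t i) :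
    HasSideLimits D u := by
  have hext : ∀ i, ∃ g : Time T → ℝ, Monotone g ∧ EqOn (fun t => u t i) g D := fun i =>
    (hmono i).exists_monotone_extension ⟨0, by rintro _ ⟨t, ht, rfl⟩; exact h0 t ht i⟩
      ⟨u ⊤ i, by rintro _ ⟨t, ht, rfl⟩; exact hmono i ht htop le_top⟩
  choose g hg hgu using hext
  have key : ∀ (t : Time T) (I : Set (Time T)) (l : Fin N → ℝ),
      (∀ i, Tendsto (g i) (𝓝[I] t) (𝓝 (l i))) →
        Tendsto u (𝓝[D ∩ I] t) (𝓝 (WithLp.toLp 2 l)) := by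
    intro t I l h
    refine tendsto_euclidean_iff.2 fun i => ?_
    refine ((h i).mono_left (nhdsWithin_mono _ inter_subset_right)).congr' ?_
    filter_upwards [self_mem_nhdsWithin] with s hs
    exact (hgu i hs.1).symm
  intro t
  exact ⟨⟨_, key t (Ioi t) _ fun i => (hg i).tendsto_nhdsGT t⟩,
    ⟨_, key t (Iio t) _ fun i => (hg i).tendsto_nhdsLT t⟩⟩

section Monotone

variable {D : Set (Time T)} (hD : Dense D) {u : Time T → E N} (htop : ⊤ ∈ D)
  (hmono : ∀ i, MonotoneOn (fun t => u t i) D) (h0 : ∀ t ∈ D, ∀ i, 0 ≤ u t i)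

include hD htop hmono h0

theorem regularize_le_of_lt {t q : Time T} (hq : q ∈ D) (htq : t < q) (i : Fin N) :
    regularize D u t i ≤ u q i := by
  have ht := htq.trans_le le_top
  have := nhdsWithin_inter_Ioi_neBot hD ht
  have h1 := tendsto_euclidean_iff.1
    (tendsto_regularize (hasSideLimits_of_monotoneOn htop hmono h0) ht) i
  refine le_of_tendsto h1 ?_
  filter_upwards [self_mem_nhdsWithin, nhdsWithin_le_nhds (Iio_mem_nhds htq)] with s hs hs'
  exact hmono i hs.1 hq (le_of_lt hs')

theorem le_regularize_of_le {t q : Time T} (hq : q ∈ D) (htq : q ≤ t) (i : Fin N) :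
    u q i ≤ regularize D u t i := by
  rcases eq_or_lt_of_le (le_top (a := t)) with rfl | ht
  · rw [regularize_top]
    exact hmono i hq htop htq
  · have := nhdsWithin_inter_Ioi_neBot hD ht
    have h1 := tendsto_euclidean_iff.1
      (tendsto_regularize (hasSideLimits_of_monotoneOn htop hmono h0) ht) i
    refine ge_of_tendsto h1 ?_
    filter_upwards [self_mem_nhdsWithin] with s hs
    exact hmono i hq hs.1 (htq.trans (le_of_lt hs.2))

theorem regularize_nonneg (t : Time T) (i : Fin N) : 0 ≤ regularize D u t i := by
  rcases eq_or_lt_of_le (le_top (a := t)) with rfl | ht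
  · rw [regularize_top]
    exact h0 _ htop i
  · have := nhdsWithin_inter_Ioi_neBot hD ht
    have h1 := tendsto_euclidean_iff.1
      (tendsto_regularize (hasSideLimits_of_monotoneOn htop hmono h0) ht) i
    refine ge_of_tendsto h1 ?_
    filter_upwards [self_mem_nhdsWithin] with s hs
    exact h0 s hs.1 i

theorem monotone_regularize (i : Fin N) : Monotone fun t => regularize D u t i := by
  intro t t' htt'
  rcases eq_or_lt_of_le htt' with rfl | h
  · exact le_rfl
  · obtain ⟨q, hq, h1, h2⟩ := hD.exists_between h
    exact (regularize_le_of_lt hD htop hmono h0 hq h1 i).trans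
      (le_regularize_of_le hD htop hmono h0 hq h2.le i)

/-- The regularization of a monotone function, as a path. -/
def incRegularize : IncSkorokhod T N :=
  ⟨regularize D u, isCadlag_regularize hD (hasSideLimits_of_monotoneOn htop hmono h0),
    monotone_regularize hD htop hmono h0, fun i => regularize_nonneg hD htop hmono h0 ⊥ i⟩

end Monotone

/-- Monotone paths which converge on a dense set converge at the continuity points of the limit. -/
theorem tendsto_of_tendsto_dense {D : Set (Time T)} (hD : Dense D) {v : ℕ → Time T → ℝ}
    {u : Time T → ℝ} {A : Time T → ℝ} (hv : ∀ n, Monotone (v n))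
    (hlim : ∀ q ∈ D, Tendsto (fun n => v n q) atTop (𝓝 (u q)))
    (h1 : ∀ t, ∀ q ∈ D, q ≤ t → u q ≤ A t) (h2 : ∀ t, ∀ q ∈ D, t < q → A t ≤ u q)
    {t : Time T} (ht : ⊥ < t) (ht' : t < ⊤) (hA : ContinuousAt A t) :
    Tendsto (fun n => v n t) atTop (𝓝 (A t)) := by
  rw [tendsto_order]
  constructor
  · intro y hy
    obtain ⟨r, hrt, hr⟩ := exists_Ioc_subset_of_mem_nhds (hA.eventually (lt_mem_nhds hy)) ⟨⊥, ht⟩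
    obtain ⟨r', hr1, hr2⟩ := exists_between hrt
    obtain ⟨q, hq, hq1, hq2⟩ := hD.exists_between hr2
    have : y < u q := (hr ⟨hr1, hr2.le⟩).trans_le (h2 _ _ hq hq1)
    filter_upwards [(hlim q hq).eventually (lt_mem_nhds this)] with n hn
    exact hn.trans_le (hv n hq2.le)
  · intro y hy
    obtain ⟨r, hrt, hr⟩ := exists_Ico_subset_of_mem_nhds (hA.eventually (gt_mem_nhds hy)) ⟨⊤, ht'⟩
    obtain ⟨q, hq, hq1, hq2⟩ := hD.exists_between hrt
    have : u q < y := (h1 _ _ hq le_rfl).trans_lt (hr ⟨hq1.le, hq2⟩)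
    filter_upwards [(hlim q hq).eventually (gt_mem_nhds this)] with n hn
    exact (hv n hq1.le).trans_lt hn

end Regularization


/-! ### Càdlàg versions of closed martingales, by Doob's inequalities on dyadic grids. -/

section CadlagMartingale

variable {T : ℝ} [hT : Fact (0 < T)] {N : ℕ}

/-- The dyadic points of `[0,T]`. -/
def dyadics (T : ℝ) [Fact (0 < T)] : Set (Time T) := {t | ∃ n j, j ≤ 2 ^ n ∧ t = gridPt T n j}

theorem gridUp_mem_dyadics (n : ℕ) (t : Time T) : gridUp n t ∈ dyadics T :=
  ⟨n, gridIdx n t, gridIdx_le n t, rfl⟩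

theorem dense_dyadics : Dense (dyadics T) := fun t =>
  mem_closure_of_tendsto ((tendsto_gridUp t).mono_right nhdsWithin_le_nhds)
    (Eventually.of_forall fun n => gridUp_mem_dyadics n t)

theorem top_mem_dyadics : ⊤ ∈ dyadics T := ⟨0, 2 ^ 0, le_rfl, (gridPt_pow 0).symm⟩

theorem countable_dyadics : (dyadics T).Countable := by
  refine (countable_range fun p : ℕ × ℕ => gridPt T p.1 p.2).mono ?_
  rintro t ⟨n, j, -, rfl⟩
  exact ⟨(n, j), rfl⟩

theorem exists_gridPt_eq {q : Time T} (hq : q ∈ dyadics T) :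
    ∃ n₀, ∀ n ≥ n₀, ∃ j ≤ 2 ^ n, gridPt T n j = q := by
  obtain ⟨m, j, hj, rfl⟩ := hq
  refine ⟨m, fun n hn => ⟨j * 2 ^ (n - m), ?_, (gridPt_eq_of_le hn j).symm⟩⟩
  calc j * 2 ^ (n - m) ≤ 2 ^ m * 2 ^ (n - m) := Nat.mul_le_mul_right _ hj
    _ = 2 ^ n := by rw [← pow_add, Nat.add_sub_cancel' hn]

/-- After time `x`, the function `u` has `K` successive upcrossings of `[a,b]` along dyadic
times. -/
def HasUpcrossings (u : Time T → ℝ) (a b : ℝ) : ℕ → Time T → Prop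
  | 0, _ => True
  | K + 1, x => ∃ p ∈ dyadics T, ∃ q ∈ dyadics T,
      x < p ∧ p < q ∧ u p < a ∧ b < u q ∧ HasUpcrossings u a b K q

theorem HasUpcrossings.anti {u : Time T → ℝ} {a b : ℝ} {K : ℕ} {x y : Time T} (hxy : x ≤ y)
    (h : HasUpcrossings u a b K y) : HasUpcrossings u a b K x := by
  cases K with
  | zero => trivial
  | succ K =>
    obtain ⟨p, hp, q, hq, h1, h⟩ := h
    exact ⟨p, hp, q, hq, hxy.trans_lt h1, h⟩

theorem frequently_nhdsWithin_inter {u : Time T → ℝ} {I : Set (Time T)} {t : Time T}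
    {p : ℝ → Prop} (h : ∃ᶠ s in 𝓝[dyadics T ∩ I] t, p (u s)) {O : Set (Time T)} (hO : IsOpen O)
    (ht : t ∈ O) : ∃ s ∈ dyadics T, s ∈ I ∧ s ∈ O ∧ p (u s) := by
  obtain ⟨s, hs, h1, h2⟩ := (h.and_eventually
    (eventually_mem_nhdsWithin.and (nhdsWithin_le_nhds (hO.mem_nhds ht)))).exists
  exact ⟨s, h1.1, h1.2, h2, hs⟩

/-- Oscillation to the left of `t` persists after any `x < t`, so upcrossings can be chosen forward
in time. -/
theorem hasUpcrossings_of_frequently_left {u : Time T → ℝ} {a b : ℝ} {t : Time T}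
    (ha : ∃ᶠ s in 𝓝[dyadics T ∩ Iio t] t, u s < a) (hb : ∃ᶠ s in 𝓝[dyadics T ∩ Iio t] t, b < u s)
    (K : ℕ) : ∀ x < t, HasUpcrossings u a b K x := by
  induction K with
  | zero => exact fun _ _ => trivial
  | succ K ih =>
    intro x hx
    obtain ⟨p, hp, hpt, hxp, hpa⟩ := frequently_nhdsWithin_inter (p := (· < a)) ha isOpen_Ioi hx
    obtain ⟨q, hq, hqt, hpq, hqb⟩ := frequently_nhdsWithin_inter (p := (b < ·)) hb isOpen_Ioi hpt
    exact ⟨p, hp, q, hq, hxp, hpq, hpa, hqb, ih q hqt⟩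

/-- To the right of `t` the construction runs backward in time: each new upcrossing is placed
between `t` and those already found. Hence the starting point `x` depends on `K`. -/
theorem hasUpcrossings_of_frequently_right {u : Time T → ℝ} {a b : ℝ} {t : Time T} (ht : t < ⊤)
    (ha : ∃ᶠ s in 𝓝[dyadics T ∩ Ioi t] t, u s < a) (hb : ∃ᶠ s in 𝓝[dyadics T ∩ Ioi t] t, b < u s)
    (K : ℕ) : ∃ x, t < x ∧ HasUpcrossings u a b K x := by
  induction K with
  | zero => exact ⟨⊤, ht, trivial⟩
  | succ K ih =>
    obtain ⟨y, hty, hy⟩ := ih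
    obtain ⟨q, hq, htq, hqy, hqb⟩ := frequently_nhdsWithin_inter (p := (b < ·)) hb isOpen_Iio hty
    obtain ⟨p, hp, htp, hpq, hpa⟩ := frequently_nhdsWithin_inter (p := (· < a)) ha isOpen_Iio htq
    obtain ⟨x, htx, hxp⟩ := exists_between (mem_Ioi.1 htp)
    exact ⟨x, htx, p, hp, q, hq, hxp, hpq, hpa, hqb, hy.anti (le_of_lt hqy)⟩

/-- Finitely many dyadic times all lie on every sufficiently fine grid, and each upcrossing through
them raises the discrete count by at least one. -/
theorem HasUpcrossings.le_upcrossingsBefore {Ω : Type*} {X : Time T → Ω → ℝ} {ω : Ω} {a b : ℝ}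
    (hab : a < b) {K : ℕ} {x : Time T} (h : HasUpcrossings (fun t => X t ω) a b K x) :
    ∃ n₀, ∀ n ≥ n₀, ∀ j ≤ 2 ^ n, gridPt T n j ≤ x →
      upcrossingsBefore a b (fun j => X (gridPt T n j)) (j + 1) ω + K ≤
        upcrossingsBefore a b (fun j => X (gridPt T n j)) (2 ^ n + 1) ω := by
  induction K generalizing x with
  | zero => exact ⟨0, fun n _ j hj _ => upcrossingsBefore_mono hab (Nat.succ_le_succ hj) ω⟩
  | succ K ih =>
    obtain ⟨p, hp, q, hq, hxp, hpq, hpa, hqb, h⟩ := h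
    obtain ⟨n₁, h₁⟩ := ih h
    obtain ⟨n₂, h₂⟩ := exists_gridPt_eq hp
    obtain ⟨n₃, h₃⟩ := exists_gridPt_eq hq
    refine ⟨max n₁ (max n₂ n₃), fun n hn j _ hjx => ?_⟩
    obtain ⟨jp, -, hjp'⟩ := h₂ n (((le_max_left _ _).trans (le_max_right _ _)).trans hn)
    obtain ⟨jq, hjq, hjq'⟩ := h₃ n (((le_max_right _ _).trans (le_max_right _ _)).trans hn)
    have h4 := h₁ n ((le_max_left _ _).trans hn) jq hjq hjq'.le
    have hj1 : j < jp := (gridPt_mono n).reflect_lt (hjx.trans_lt (hxp.trans_le hjp'.ge))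
    have hj2 : jp < jq := (gridPt_mono n).reflect_lt (by rw [hjp', hjq']; exact hpq)
    have h5 := upcrossingsBefore_lt_of_exists_upcrossing
      (f := fun j => X (gridPt T n j)) (ω := ω) hab (N := j + 1) (N₁ := jp) (N₂ := jq) hj1
      (by simpa [hjp'] using hpa) hj2.le (by simpa [hjq'] using hqb)
    omega

section

variable {Ω : Type*} {mΩ : MeasurableSpace Ω} {P : Measure Ω} [IsProbabilityMeasure P]

/-- A filtration sampled along the dyadic points of level `n`. -/
def gridFiltration (f : Filtration (Time T) mΩ) (n : ℕ) : Filtration ℕ mΩ where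
  seq j := f (gridPt T n j)
  mono' _ _ h := f.mono (gridPt_mono n h)
  le' _ := f.le _

theorem martingale_grid (f : Filtration (Time T) mΩ) (Z : Ω → ℝ) (n : ℕ) :
    Martingale (fun j => P[Z | f (gridPt T n j)]) (gridFiltration f n) P :=
  martingale_condExp Z (gridFiltration f n) P

/-- The maximal inequality for the absolute value of the martingale on each grid has the bound E|Z|,
independent of the level, and the grids are nested. -/
theorem ae_bounded_condExp_dyadics (f : Filtration (Time T) mΩ) (Z : Ω → ℝ) :
    ∀ᵐ ω ∂P, ∃ R : ℝ, ∀ t ∈ dyadics T, |P[Z | f t] ω| ≤ R := by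
  let S : ℕ → ℕ → Set Ω := fun m n => {ω | ∃ j ≤ 2 ^ n, (m : ℝ) ≤ |P[Z | f (gridPt T n j)] ω|}
  have hmono : ∀ m, Monotone (S m) := by
    rintro m n n' hnn' ω ⟨j, hj, hω⟩
    refine ⟨j * 2 ^ (n' - n), ?_, by rwa [← gridPt_eq_of_le hnn']⟩
    calc j * 2 ^ (n' - n) ≤ 2 ^ n * 2 ^ (n' - n) := Nat.mul_le_mul_right _ hj
      _ = 2 ^ n' := by rw [← pow_add, Nat.add_sub_cancel' hnn']
  set C : ℝ≥0∞ := ENNReal.ofReal (∫ ω, |Z ω| ∂P)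
  have hS : ∀ m n : ℕ, (m : ℝ≥0∞) * P (S m n) ≤ C := by
    intro m n
    have hM := martingale_grid (P := P) f Z n
    have hsub : Submartingale ((fun j => P[Z | f (gridPt T n j)]) ⊔
        -(fun j => P[Z | f (gridPt T n j)])) (gridFiltration f n) P :=
      hM.submartingale.sup hM.neg.submartingale
    have h0 : 0 ≤ ((fun j => P[Z | f (gridPt T n j)]) ⊔ -(fun j => P[Z | f (gridPt T n j)])) :=
      fun j ω => abs_nonneg (P[Z | f (gridPt T n j)] ω)
    have h := maximal_ineq hsub h0 (ε := (m : ℝ≥0)) (2 ^ n)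
    have hset : S m n ⊆ {ω | ((m : ℝ≥0) : ℝ) ≤ (Finset.range (2 ^ n + 1)).sup'
        Finset.nonempty_range_add_one fun k => ((fun j => P[Z | f (gridPt T n j)]) ⊔
          -(fun j => P[Z | f (gridPt T n j)])) k ω} := by
      rintro ω ⟨j, hj, hω⟩
      rw [mem_ofPred_eq, Finset.le_sup'_iff]
      exact ⟨j, Finset.mem_range.2 (Nat.lt_succ_of_le hj), hω⟩
    have h2 : ∫ ω, |P[Z | f (gridPt T n (2 ^ n))] ω| ∂P ≤ ∫ ω, |Z ω| ∂P :=
      integral_abs_condExp_le Z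
    calc (m : ℝ≥0∞) * P (S m n) ≤ _ := by
          refine le_trans ?_ h
          refine mul_le_mul' (by simp) (measure_mono hset)
      _ ≤ C := by
          refine ENNReal.ofReal_le_ofReal (le_trans (setIntegral_le_integral ?_ ?_) h2)
          · exact integrable_condExp.abs
          · exact Eventually.of_forall fun ω => abs_nonneg _
  have hU : ∀ m : ℕ, (m : ℝ≥0∞) * P (⋃ n, S m n) ≤ C := by
    intro m
    rw [(hmono m).measure_iUnion, ENNReal.mul_iSup]
    exact iSup_le (hS m)
  -- This intersection is the event of unboundedness. A positive probability times m could not stay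
  -- below `C` for every m.
  have hnull : P (⋂ m, ⋃ n, S m n) = 0 := by
    by_contra hne
    have h1 : ∀ m : ℕ, (m : ℝ≥0∞) * P (⋂ m, ⋃ n, S m n) ≤ C := fun m =>
      (mul_le_mul_right (measure_mono (iInter_subset _ m)) _).trans (hU m)
    obtain ⟨m, hm⟩ := ENNReal.exists_nat_mul_gt hne (ENNReal.ofReal_ne_top (r := ∫ ω, |Z ω| ∂P))
    exact (h1 m).not_gt hm
  filter_upwards [measure_eq_zero_iff_ae_notMem.1 hnull] with ω hω
  simp only [mem_iInter, mem_iUnion, not_forall, not_exists] at hω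
  obtain ⟨m, hm⟩ := hω
  refine ⟨m, ?_⟩
  rintro t ⟨n, j, hj, rfl⟩
  by_contra! h
  exact hm n ⟨j, hj, h.le⟩

/-- Doob's upcrossing inequality bounds the expected number of upcrossings uniformly in the grid,
and Fatou's lemma carries the bound to the limit, which is therefore finite almost surely. -/
theorem ae_not_forall_hasUpcrossings (f : Filtration (Time T) mΩ) (Z : Ω → ℝ)
    {a b : ℝ} (hab : a < b) :
    ∀ᵐ ω ∂P, ∃ K, ∀ x, ¬ HasUpcrossings (fun t => P[Z | f t] ω) a b K x := by
  -- The horizon is `2 ^ n + 1` because only upcrossings completed strictly before it are counted,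
  -- and the grid point `2 ^ n`, which is T, must be included. The next grid point is again T, by
  -- clamping.
  let U : ℕ → Ω → ℕ := fun n ω =>
    upcrossingsBefore a b (fun j => P[Z | f (gridPt T n j)]) (2 ^ n + 1) ω
  have hUm : ∀ n, Measurable (U n) := fun n =>
    (martingale_grid (P := P) f Z n).stronglyAdapted.measurable_upcrossingsBefore hab
  have hUi : ∀ n, Integrable (fun ω => (U n ω : ℝ)) P := fun n =>
    (martingale_grid (P := P) f Z n).stronglyAdapted.integrable_upcrossingsBefore hab
  set C : ℝ := (∫ ω, |Z ω| ∂P) + |a|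
  have hbound : ∀ n, ∫⁻ ω, (U n ω : ℝ≥0∞) ∂P ≤ ENNReal.ofReal (C / (b - a)) := by
    intro n
    have h1 := (martingale_grid (P := P) f Z n).submartingale.mul_integral_upcrossingsBefore_le_integral_pos_part
      a b (2 ^ n + 1)
    have h2 : ∫ ω, (P[Z | f (gridPt T n (2 ^ n + 1))] ω - a)⁺ ∂P ≤ C := by
      calc ∫ ω, (P[Z | f (gridPt T n (2 ^ n + 1))] ω - a)⁺ ∂P
          ≤ ∫ ω, (|P[Z | f (gridPt T n (2 ^ n + 1))] ω| + |a|) ∂P := by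
            refine integral_mono ?_ ?_ fun ω => ?_
            · exact (integrable_condExp.sub (integrable_const a)).pos_part
            · exact integrable_condExp.abs.add (integrable_const _)
            · refine max_le ?_ (by positivity)
              exact (le_abs_self _).trans (abs_sub _ _)
        _ ≤ C := by
            rw [integral_add integrable_condExp.abs (integrable_const _)]
            simp only [integral_const, probReal_univ, one_smul, C]
            exact add_le_add_left (integral_abs_condExp_le Z) _
    have h3 : ∫ ω, (U n ω : ℝ) ∂P ≤ C / (b - a) := by
      rw [le_div_iff₀' (sub_pos.2 hab)]
      exact h1.trans h2
    calc ∫⁻ ω, (U n ω : ℝ≥0∞) ∂P = ∫⁻ ω, ENNReal.ofReal (U n ω : ℝ) ∂P := by simp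
      _ = ENNReal.ofReal (∫ ω, (U n ω : ℝ) ∂P) :=
          (ofReal_integral_eq_lintegral_ofReal (hUi n)
            (Eventually.of_forall fun ω => Nat.cast_nonneg _)).symm
      _ ≤ _ := ENNReal.ofReal_le_ofReal h3
  have hlim : ∫⁻ ω, liminf (fun n => (U n ω : ℝ≥0∞)) atTop ∂P ≠ ∞ := by
    refine ((lintegral_liminf_le fun n =>
      (measurable_from_nat (f := fun m : ℕ => (m : ℝ≥0∞))).comp (hUm n)).trans
        ((liminf_le_liminf (Eventually.of_forall hbound)).trans ?_)).trans_lt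
          (ENNReal.ofReal_lt_top (r := C / (b - a))) |>.ne
    simp
  have hlm : Measurable fun ω => liminf (fun n => (U n ω : ℝ≥0∞)) atTop :=
    Measurable.liminf fun n => (measurable_from_nat (f := fun m : ℕ => (m : ℝ≥0∞))).comp (hUm n)
  filter_upwards [ae_lt_top hlm hlim] with ω hω
  by_contra! hcon
  refine hω.ne (ENNReal.eq_top_of_forall_nnreal_le fun r => ?_)
  obtain ⟨K, hK⟩ := exists_nat_ge r
  obtain ⟨x, hx⟩ := hcon K
  obtain ⟨n₀, hn₀⟩ := HasUpcrossings.le_upcrossingsBefore (X := fun t => P[Z | f t]) hab hx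
  refine le_liminf_of_le (by isBoundedDefault) ?_
  filter_upwards [eventually_ge_atTop n₀] with n hn
  have h1 := hn₀ n hn 0 (Nat.zero_le _) (by rw [gridPt_zero]; exact bot_le)
  have h2 : K ≤ U n ω := (Nat.le_add_left _ _).trans h1
  calc (r : ℝ≥0∞) ≤ ((K : ℝ≥0) : ℝ≥0∞) := by exact_mod_cast hK
    _ ≤ U n ω := by exact_mod_cast h2

/-- A bounded function without arbitrarily many upcrossings of any rational interval has one-sided
limits. Outside `[0,T]` there is nothing to approach from, so at the endpoints the corresponding
filter is trivial. -/
theorem ae_exists_tendsto_condExp (f : Filtration (Time T) mΩ) (Z : Ω → ℝ) :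
    ∀ᵐ ω ∂P, ∀ t,
      (∃ l, Tendsto (fun s => P[Z | f s] ω) (𝓝[dyadics T ∩ Ioi t] t) (𝓝 l)) ∧
      ∃ l, Tendsto (fun s => P[Z | f s] ω) (𝓝[dyadics T ∩ Iio t] t) (𝓝 l) := by
  have h1 : ∀ᵐ ω ∂P, ∀ a b : ℚ, (a : ℝ) < b →
      ∃ K, ∀ x, ¬ HasUpcrossings (fun t => P[Z | f t] ω) a b K x := by
    rw [ae_all_iff]; intro a
    rw [ae_all_iff]; intro b
    by_cases hab : (a : ℝ) < b
    · filter_upwards [ae_not_forall_hasUpcrossings (P := P) f Z hab] with ω hω _ using hω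
    · exact Eventually.of_forall fun ω h => absurd h hab
  filter_upwards [h1, ae_bounded_condExp_dyadics (P := P) f Z] with ω hup ⟨R, hR⟩ t
  have hbd : ∀ I : Set (Time T),
      IsBoundedUnder (· ≤ ·) (𝓝[dyadics T ∩ I] t) (fun s => P[Z | f s] ω) ∧
      IsBoundedUnder (· ≥ ·) (𝓝[dyadics T ∩ I] t) (fun s => P[Z | f s] ω) := by
    intro I
    constructor
    · refine isBoundedUnder_of_eventually_le (a := R) ?_
      filter_upwards [self_mem_nhdsWithin] with s hs using (abs_le.1 (hR s hs.1)).2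
    · refine isBoundedUnder_of_eventually_ge (a := -R) ?_
      filter_upwards [self_mem_nhdsWithin] with s hs using (abs_le.1 (hR s hs.1)).1
  constructor
  · rcases eq_or_lt_of_le (le_top (a := t)) with rfl | ht
    · exact ⟨0, by simp⟩
    · refine tendsto_of_no_upcrossings Rat.denseRange_cast ?_ (hbd _).1 (hbd _).2
      rintro _ ⟨a, rfl⟩ _ ⟨b, rfl⟩ hab ⟨ha, hb⟩
      obtain ⟨K, hK⟩ := hup a b hab
      obtain ⟨x, -, hx⟩ := hasUpcrossings_of_frequently_right ht ha hb K
      exact hK x hx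
  · rcases eq_or_lt_of_le (bot_le (a := t)) with rfl | ht
    · exact ⟨0, by simp⟩
    · refine tendsto_of_no_upcrossings Rat.denseRange_cast ?_ (hbd _).1 (hbd _).2
      rintro _ ⟨a, rfl⟩ _ ⟨b, rfl⟩ hab ⟨ha, hb⟩
      obtain ⟨K, hK⟩ := hup a b hab
      exact hK ⊥ (hasUpcrossings_of_frequently_left ha hb K ⊥ ht)

/-- The limit of conditional expectations along decreasing times is a conditional expectation. -/
theorem ae_eq_condExp_of_tendsto {Ω : Type*} {m mΩ : MeasurableSpace Ω} {P : Measure Ω}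
    [IsProbabilityMeasure P] (hm : m ≤ mΩ) {Z : Ω → ℝ}
    (hZ : Integrable Z P) {ms : ℕ → MeasurableSpace Ω} (hms : ∀ n, ms n ≤ mΩ)
    (hmm : ∀ n, m ≤ ms n) {M : Ω → ℝ} (hM : Measurable[m] M)
    (hlim : ∀ᵐ ω ∂P, Tendsto (fun n => P[Z | ms n] ω) atTop (𝓝 (M ω))) :
    M =ᵐ[P] P[Z | m] := by
  have hMs : AEStronglyMeasurable[mΩ] M P := (hM.mono hm le_rfl).aestronglyMeasurable
  -- Conditional expectations of one integrable variable are uniformly integrable. This upgrades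
  -- almost sure convergence to convergence in L¹, so integrals over sets of `m` pass to the limit;
  -- no monotonicity of `ms` is needed.
  have hui : UnifIntegrable (fun n => P[Z | ms n]) 1 P :=
    (hZ.uniformIntegrable_condExp hms).2.1
  have hMi : Integrable M P := by
    refine ⟨hMs, ?_⟩
    rw [hasFiniteIntegral_iff_enorm]
    calc ∫⁻ ω, ‖M ω‖ₑ ∂P ≤ ∫⁻ ω, liminf (fun n => ‖P[Z | ms n] ω‖ₑ) atTop ∂P := by
          refine lintegral_mono_ae ?_
          filter_upwards [hlim] with ω hω
          exact hω.enorm.liminf_eq.ge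
      _ ≤ liminf (fun n => ∫⁻ ω, ‖P[Z | ms n] ω‖ₑ ∂P) atTop := by
          refine lintegral_liminf_le fun n => ?_
          exact ((stronglyMeasurable_condExp.mono (hms n)).measurable).enorm
      _ ≤ liminf (fun _ : ℕ => ∫⁻ ω, ‖Z ω‖ₑ ∂P) atTop := by
          refine liminf_le_liminf (Eventually.of_forall fun n => ?_)
          simp_rw [← eLpNorm_one_eq_lintegral_enorm]
          exact eLpNorm_condExp_le_eLpNorm Z le_rfl
      _ < ∞ := by
          simpa using hasFiniteIntegral_iff_enorm.1 hZ.2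
  have hL1 : Tendsto (fun n => eLpNorm (P[Z | ms n] - M) 1 P) atTop (𝓝 0) :=
    tendsto_Lp_finite_of_tendsto_ae le_rfl ENNReal.one_ne_top
      (fun n => (stronglyMeasurable_condExp.mono (hms n)).aestronglyMeasurable)
      (memLp_one_iff_integrable.2 hMi) hui hlim
  refine ae_eq_condExp_of_forall_setIntegral_eq hm hZ (fun s _ _ => hMi.integrableOn)
    (fun s hs _ => ?_) hM.stronglyMeasurable.aestronglyMeasurable
  have h1 : Tendsto (fun n => ∫ ω in s, P[Z | ms n] ω ∂P) atTop (𝓝 (∫ ω in s, M ω ∂P)) :=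
    tendsto_setIntegral_of_L1' M hMs (Eventually.of_forall fun n => integrable_condExp) hL1 s
  have h2 : ∀ n, ∫ ω in s, P[Z | ms n] ω ∂P = ∫ ω in s, Z ω ∂P := fun n =>
    setIntegral_condExp (hms n) hZ (hmm n s hs)
  simp_rw [h2] at h1
  exact tendsto_nhds_unique h1 tendsto_const_nhds

/-- An integrable random vector closes a càdlàg martingale, for a right-continuous complete
filtration. -/
theorem exists_cadlag_condExp (f : Filtration (Time T) mΩ) [f.IsRightContinuous]
    (hnull : ∀ t S, MeasurableSet S → P S = 0 → MeasurableSet[f t] S) {Z : Ω → E N}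
    (hZ : Integrable Z P) :
    ∃ M : Ω → Time T → E N, (∀ ω, IsCadlag (M ω)) ∧ (∀ t, Measurable[f t] fun ω => M ω t) ∧
      ∀ t i, (fun ω => M ω t i) =ᵐ[P] P[fun ω => Z ω i | f t] := by
  have hZi := integrable_euclidean_iff.1 hZ
  have hae : ∀ᵐ ω ∂P, HasSideLimits (dyadics T)
      fun t => (WithLp.toLp 2 fun i => P[fun ω => Z ω i | f t] ω : E N) := by
    filter_upwards [ae_all_iff.2 fun i => ae_exists_tendsto_condExp (P := P) f fun ω => Z ω i]
      with ω hω t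
    choose l hl using fun i => (hω i t).1
    choose l' hl' using fun i => (hω i t).2
    exact ⟨⟨WithLp.toLp 2 l, tendsto_euclidean_iff.2 hl⟩,
      ⟨WithLp.toLp 2 l', tendsto_euclidean_iff.2 hl'⟩⟩
  -- By `hnull` this measurable null set belongs to every `f t`, so setting the process to 0 on it
  -- keeps it adapted and makes every path regularisable.
  obtain ⟨G, hGsub, hGm, hG0⟩ := exists_measurable_superset_of_null hae
  have hG : ∀ ω ∉ G, HasSideLimits (dyadics T)
      fun t => (WithLp.toLp 2 fun i => P[fun ω => Z ω i | f t] ω : E N) := by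
    intro ω hω
    by_contra h
    exact hω (hGsub h)
  classical
  let u : Ω → Time T → E N := fun ω t =>
    if ω ∈ G then 0 else WithLp.toLp 2 fun i => P[fun ω => Z ω i | f t] ω
  have hu : ∀ ω, HasSideLimits (dyadics T) (u ω) := by
    intro ω
    by_cases hω : ω ∈ G
    · have : u ω = fun _ => 0 := by ext1 t; simp [u, hω]
      rw [this]
      exact fun t => ⟨⟨0, tendsto_const_nhds⟩, ⟨0, tendsto_const_nhds⟩⟩
    · have : u ω = fun t => (WithLp.toLp 2 fun i => P[fun ω => Z ω i | f t] ω : E N) := by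
        ext1 t; simp [u, hω]
      rw [this]
      exact hG ω hω
  have hum : ∀ t, Measurable[f t] fun ω => u ω t := by
    intro t
    refine Measurable.ite (hnull t G hGm hG0) measurable_const ?_
    refine (@measurable_euclidean_iff _ _ (f t) _).2 fun i => ?_
    exact stronglyMeasurable_condExp.measurable
  have hMm := measurable_regularize dense_dyadics top_mem_dyadics hu fun q _ => hum q
  have hae' : ∀ᵐ ω ∂P, ∀ t i, u ω t i = P[fun ω => Z ω i | f t] ω := by
    filter_upwards [measure_eq_zero_iff_ae_notMem.1 hG0] with ω hω t i
    simp [u, hω]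
  refine ⟨fun ω => regularize (dyadics T) (u ω), fun ω => isCadlag_regularize dense_dyadics (hu ω),
    hMm, fun t i => ?_⟩
  rcases eq_or_lt_of_le (le_top (a := t)) with rfl | ht
  · simp_rw [regularize_top]
    filter_upwards [hae'] with ω hω using hω ⊤ i
  · obtain ⟨q, hq, hlim⟩ := exists_seq_between (dense_dyadics (T := T)) ht
    refine ae_eq_condExp_of_tendsto (f.le t) (hZi i) (ms := fun n => f (q n)) (fun n => f.le _)
      (fun n => f.mono (hq n).2.1.le) ((@measurable_euclidean_iff _ _ (f t) _).1 (hMm t) i) ?_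
    filter_upwards [hae'] with ω hω
    simp_rw [← fun n => hω (q n) i]
    exact (tendsto_euclidean_iff.1 (tendsto_regularize (hu ω) ht) i).comp hlim

end

end CadlagMartingale


/-! ### Convex functions on the orthant: slopes, gradients and differentiation under the integral.
-/

section Convex

variable {d k : ℕ}

theorem convex_orthant : Convex ℝ (orthant k) := by
  intro a ha b hb r s hr hs _ i
  have := add_nonneg (mul_nonneg hr (ha i)) (mul_nonneg hs (hb i))
  simpa using this

/-- The projection onto the orthant. -/
def toOrthant (a : E k) : E k := WithLp.toLp 2 fun i => max (a i) 0

theorem toOrthant_mem (a : E k) : toOrthant a ∈ orthant k := fun _ => le_max_right _ _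

theorem toOrthant_eq {a : E k} (ha : a ∈ orthant k) : toOrthant a = a := by
  ext i
  exact max_eq_left (ha i)

theorem measurable_toOrthant : Measurable (toOrthant (k := k)) :=
  measurable_euclidean_iff.2 fun i =>
    ((by fun_prop : Measurable fun a : E k => a i).max measurable_const)

variable {φ : E d → E k → ℝ}

theorem hasFDerivWithinAt_grad (hφ : IsC1InControl φ) (l : E d) {a : E k} (ha : a ∈ orthant k) :
    HasFDerivWithinAt (φ l) (InnerProductSpace.toDual ℝ (E k) (grad φ l a)) (orthant k) a :=
  ((((hφ l).differentiableOn one_ne_zero) a ha).hasGradientWithinAt).hasFDerivWithinAt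

/-- Convexity keeps the segment from `a` to `a + y` in the orthant, so the derivative within the
orthant suffices. This covers boundary points, where only one-sided slopes make sense. -/
theorem tendsto_slope_grad (hφ : IsC1InControl φ) (l : E d) {a y : E k} (ha : a ∈ orthant k)
    (hy : a + y ∈ orthant k) :
    Tendsto (fun r : ℝ => (φ l (a + r • y) - φ l a) / r) (𝓝[>] 0)
      (𝓝 (inner ℝ (grad φ l a) y)) := by
  have h1 : HasDerivWithinAt (fun r : ℝ => a + r • y) y (Icc 0 1) 0 := by
    simpa using (((hasDerivAt_id (0 : ℝ)).smul_const y).const_add a).hasDerivWithinAt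
  have hmaps : MapsTo (fun r : ℝ => a + r • y) (Icc 0 1) (orthant k) := by
    intro r hr
    have := convex_orthant ha hy (sub_nonneg.2 hr.2) hr.1 (by ring)
    convert! this using 1
    module
  have h2 : HasFDerivWithinAt (φ l) (InnerProductSpace.toDual ℝ (E k) (grad φ l a)) (orthant k)
      (a + (0 : ℝ) • y) := by
    simpa using hasFDerivWithinAt_grad hφ l ha
  have h3 := h2.comp_hasDerivWithinAt (0 : ℝ) h1 hmaps
  have h4 := (hasDerivWithinAt_iff_tendsto_slope.1 h3)
  have h5 : 𝓝[>] (0 : ℝ) ≤ 𝓝[Icc 0 1 \ {0}] (0 : ℝ) := by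
    have hev : Ioo (0 : ℝ) 1 ∈ 𝓝[>] (0 : ℝ) := Ioo_mem_nhdsGT one_pos
    refine nhdsWithin_le_iff.2 (mem_of_superset hev fun r hr => ⟨⟨hr.1.le, hr.2.le⟩, hr.1.ne'⟩)
  refine (h4.mono_left h5).congr fun r => ?_
  simp [slope_def_field]

/-- Convexity bounds the slope over each shorter step by the slope over the full step, and the
slopes converge to the derivative. -/
theorem inner_grad_le (hφ : IsC1InControl φ) (hconv : ∀ l, ConvexOn ℝ (orthant k) (φ l)) (l : E d)
    {a y : E k} (ha : a ∈ orthant k) (hy : a + y ∈ orthant k) :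
    inner ℝ (grad φ l a) y ≤ φ l (a + y) - φ l a := by
  refine le_of_tendsto (tendsto_slope_grad hφ l ha hy) ?_
  filter_upwards [Ioo_mem_nhdsGT (one_pos (α := ℝ))] with r hr
  rw [div_le_iff₀ hr.1]
  have h := (hconv l).2 ha hy (sub_nonneg.2 hr.2.le) hr.1.le (by ring)
  have heq : (1 - r) • a + r • (a + y) = a + r • y := by module
  rw [heq, smul_eq_mul, smul_eq_mul] at h
  linarith

theorem measurable_comp_toOrthant (hm : Measurable fun p : E d × orthant k => φ p.1 p.2) :
    Measurable fun p : E d × E k => φ p.1 (toOrthant p.2) := by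
  have h : Measurable fun p : E d × E k =>
      (p.1, (⟨toOrthant p.2, toOrthant_mem p.2⟩ : orthant k)) :=
    measurable_fst.prodMk ((measurable_toOrthant.comp measurable_snd).subtype_mk)
  exact hm.comp h

/-- Each coordinate of the gradient is a limit of forward difference quotients. Forward steps along
a coordinate vector stay in the orthant; composition with `toOrthant` gives functions defined and
measurable everywhere. -/
theorem measurable_grad_toOrthant (hφ : IsC1InControl φ)
    (hm : Measurable fun p : E d × orthant k => φ p.1 p.2) :
    Measurable fun p : E d × E k => grad φ p.1 (toOrthant p.2) := by
  refine measurable_euclidean_iff.2 fun i => ?_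
  have hmem : ∀ (a : E k) (r : ℝ), 0 ≤ r →
      toOrthant a + r • EuclideanSpace.single i (1 : ℝ) ∈ orthant k := by
    intro a r hr j
    refine add_nonneg (toOrthant_mem a j) ?_
    change 0 ≤ (r • EuclideanSpace.single i (1 : ℝ) : E k) j
    rw [PiLp.smul_apply, smul_eq_mul, PiLp.single_apply]
    split_ifs
    · simpa using hr
    · simp
  have hmφ := measurable_comp_toOrthant hm
  refine measurable_of_tendsto_metrizable (f := fun (n : ℕ) (p : E d × E k) =>
    (φ p.1 (toOrthant (toOrthant p.2 + (1 / ((n : ℝ) + 1)) • EuclideanSpace.single i (1 : ℝ))) -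
      φ p.1 (toOrthant p.2)) / (1 / ((n : ℝ) + 1))) (fun n => ?_) (tendsto_pi_nhds.2 fun p => ?_)
  · refine Measurable.div_const (Measurable.sub ?_ hmφ) _
    exact hmφ.comp (measurable_fst.prodMk
      ((measurable_toOrthant.comp measurable_snd).add_const _))
  · have h1 := tendsto_slope_grad hφ p.1 (toOrthant_mem p.2)
      (y := EuclideanSpace.single i (1 : ℝ)) (by simpa using hmem p.2 1 zero_le_one)
    have h2 : Tendsto (fun n : ℕ => 1 / ((n : ℝ) + 1)) atTop (𝓝[>] 0) :=
      tendsto_nhdsWithin_iff.2 ⟨tendsto_one_div_add_atTop_nhds_zero_nat,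
        Eventually.of_forall fun n => by simp only [mem_Ioi]; positivity⟩
    have h3 := h1.comp h2
    rw [EuclideanSpace.inner_single_right] at h3
    simp only [one_mul, conj_trivial] at h3
    refine h3.congr fun n => ?_
    simp only [Function.comp]
    rw [toOrthant_eq (hmem p.2 _ (by positivity))]

theorem measurable_comp_of_mem {X : Type*} [MeasurableSpace X]
    (hm : Measurable fun p : E d × orthant k => φ p.1 p.2) {l : X → E d} {x : X → E k}
    (hl : Measurable l) (hx : Measurable x) (hmem : ∀ ω, x ω ∈ orthant k) :
    Measurable fun ω => φ (l ω) (x ω) := by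
  have := (measurable_comp_toOrthant hm).comp (hl.prodMk hx)
  simpa [Function.comp_def, toOrthant_eq (hmem _)] using this

theorem measurable_grad_comp_of_mem {X : Type*} [MeasurableSpace X] (hφ : IsC1InControl φ)
    (hm : Measurable fun p : E d × orthant k => φ p.1 p.2) {l : X → E d} {x : X → E k}
    (hl : Measurable l) (hx : Measurable x) (hmem : ∀ ω, x ω ∈ orthant k) :
    Measurable fun ω => grad φ (l ω) (x ω) := by
  have := (measurable_grad_toOrthant hφ hm).comp (hl.prodMk hx)
  simpa [Function.comp_def, toOrthant_eq (hmem _)] using this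

theorem eventually_small_mul (R : ℝ) (M : ℝ≥0) :
    ∀ᶠ ε : ℝ in 𝓝[>] 0, 0 < ε ∧ ε ≤ 1 ∧ ε * (R * M) ≤ 1 / 2 := by
  have h1 : ∀ᶠ ε : ℝ in 𝓝[>] 0, ε * (R * M) < 1 / 2 := by
    refine nhdsWithin_le_nhds ?_
    have : Tendsto (fun ε : ℝ => ε * (R * M)) (𝓝 0) (𝓝 (0 * (R * M))) :=
      tendsto_id.mul_const _
    exact this.eventually (gt_mem_nhds (by norm_num))
  filter_upwards [h1, Ioo_mem_nhdsGT (one_pos (α := ℝ))] with ε h2 h3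
  exact ⟨h3.1, h3.2.le, h2.le⟩

section Growth

variable (hφ : IsC1InControl φ) (hconv : ∀ l, ConvexOn ℝ (orthant k) (φ l))
  (hnonneg : ∀ l, ∀ a ∈ orthant k, 0 ≤ φ l a) {Φ : E d → ℝ≥0} {M : ℝ≥0}
  (hgrowth : ∀ l, ∀ a ∈ orthant k, ‖grad φ l a‖ ≤ Φ l + M * φ l a)

include hφ hconv hnonneg hgrowth

/-- Convexity squeezes the slope between the derivatives at the two ends of the step, and gradient
growth bounds these by values of φ. The value at the far end is controlled by the value at `a` in a
Gronwall-like manner, giving a majorant independent of ε. -/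
theorem abs_slope_le {R ε : ℝ} (hR : 0 ≤ R) (hε : 0 < ε) (hεM : ε * (R * M) ≤ 1 / 2) (hε1 : ε ≤ 1)
    {l : E d} {a y : E k} (ha : a ∈ orthant k) (hy : a + ε • y ∈ orthant k) (hyR : ‖y‖ ≤ R) :
    φ l (a + ε • y) ≤ 2 * φ l a + 2 * R * Φ l ∧
      |(φ l (a + ε • y) - φ l a) / ε| ≤ R * (Φ l + M * (2 * φ l a + 2 * R * Φ l)) := by
  have hM : (0 : ℝ) ≤ M := M.2
  have hΦ : (0 : ℝ) ≤ Φ l := (Φ l).2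
  have hu := hnonneg l _ hy
  have hv := hnonneg l _ ha
  have hinner : ∀ b ∈ orthant k, |inner ℝ (grad φ l b) y| ≤ (Φ l + M * φ l b) * R := fun b hb =>
    (abs_real_inner_le_norm _ _).trans
      (mul_le_mul (hgrowth l b hb) hyR (norm_nonneg _) (by
        have := hnonneg l b hb; positivity))
  have hup : φ l (a + ε • y) - φ l a ≤ ε * inner ℝ (grad φ l (a + ε • y)) y := by
    have h := inner_grad_le hφ hconv l hy (y := -(ε • y)) (by simpa using ha)
    rw [inner_neg_right, real_inner_smul_right, add_neg_cancel_right] at h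
    linarith
  have hlow : ε * inner ℝ (grad φ l a) y ≤ φ l (a + ε • y) - φ l a := by
    have h := inner_grad_le hφ hconv l ha hy
    rwa [real_inner_smul_right] at h
  -- The growth bound at the far end reproduces `φ l (a + ε • y)` with factor `ε * (R * M) ≤ 1 / 2`,
  -- which is absorbed on the left; this produces the factors 2.
  have hb : φ l (a + ε • y) ≤ 2 * φ l a + 2 * R * Φ l := by
    have h1 : φ l (a + ε • y) - φ l a ≤ ε * ((Φ l + M * φ l (a + ε • y)) * R) :=
      hup.trans (mul_le_mul_of_nonneg_left ((le_abs_self _).trans (hinner _ hy)) hε.le)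
    have h2 : ε * (R * M) * φ l (a + ε • y) ≤ 1 / 2 * φ l (a + ε • y) :=
      mul_le_mul_of_nonneg_right hεM hu
    have h3 : ε * (R * Φ l) ≤ 1 * (R * Φ l) :=
      mul_le_mul_of_nonneg_right hε1 (mul_nonneg hR hΦ)
    nlinarith
  refine ⟨hb, abs_le.2 ⟨?_, ?_⟩⟩
  · rw [le_div_iff₀ hε]
    have h1 : -((Φ l + M * φ l a) * R) ≤ inner ℝ (grad φ l a) y := (abs_le.1 (hinner a ha)).1
    have h2 : (Φ l + M * φ l a) * R ≤ R * (Φ l + M * (2 * φ l a + 2 * R * Φ l)) := by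
      have h4 : φ l a ≤ 2 * φ l a + 2 * R * Φ l := by nlinarith [mul_nonneg hR hΦ]
      rw [mul_comm]
      gcongr
    nlinarith
  · rw [div_le_iff₀ hε]
    have h1 : inner ℝ (grad φ l (a + ε • y)) y ≤ (Φ l + M * φ l (a + ε • y)) * R :=
      (le_abs_self _).trans (hinner _ hy)
    have h2 : (Φ l + M * φ l (a + ε • y)) * R ≤ R * (Φ l + M * (2 * φ l a + 2 * R * Φ l)) := by
      rw [mul_comm]
      gcongr
    nlinarith

/-- Directional differentiation of integral functionals with gradient growth. -/
theorem tendsto_slope_integral {X : Type*} [MeasurableSpace X] {ν : Measure X}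
    (hm : Measurable fun p : E d × orthant k => φ p.1 p.2) {l : X → E d} {x y : X → E k} {R : ℝ}
    (hR : 0 ≤ R) (hl : Measurable l) (hx : Measurable x) (hy : Measurable y)
    (hmem : ∀ ω, x ω ∈ orthant k) (hmem' : ∀ ε : ℝ, 0 ≤ ε → ε ≤ 1 → ∀ ω, x ω + ε • y ω ∈ orthant k)
    (hyR : ∀ ω, ‖y ω‖ ≤ R) (hΦ : Integrable (fun ω => (Φ (l ω) : ℝ)) ν)
    (hint : Integrable (fun ω => φ (l ω) (x ω)) ν) :
    (∀ᶠ ε : ℝ in 𝓝[>] 0, Integrable (fun ω => φ (l ω) (x ω + ε • y ω)) ν) ∧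
    Tendsto (fun ε : ℝ => ((∫ ω, φ (l ω) (x ω + ε • y ω) ∂ν) - ∫ ω, φ (l ω) (x ω) ∂ν) / ε) (𝓝[>] 0)
      (𝓝 (∫ ω, inner ℝ (grad φ (l ω) (x ω)) (y ω) ∂ν)) := by
  have hsm := eventually_small_mul R M
  have hmeas : ∀ ε : ℝ, 0 ≤ ε → ε ≤ 1 → Measurable fun ω => φ (l ω) (x ω + ε • y ω) :=
    fun ε h0 h1 => measurable_comp_of_mem hm hl (hx.add (hy.const_smul ε)) (hmem' ε h0 h1)
  have hI : ∀ᶠ ε : ℝ in 𝓝[>] 0, Integrable (fun ω => φ (l ω) (x ω + ε • y ω)) ν := by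
    filter_upwards [hsm] with ε hε
    refine Integrable.mono' ((hint.const_mul 2).add (hΦ.const_mul (2 * R)))
      (hmeas ε hε.1.le hε.2.1).aestronglyMeasurable (Eventually.of_forall fun ω => ?_)
    have h1 := hmem' ε hε.1.le hε.2.1 ω
    rw [Real.norm_of_nonneg (hnonneg _ _ h1)]
    exact (abs_slope_le hφ hconv hnonneg hgrowth hR hε.1 hε.2.2 hε.2.1 (hmem ω) h1 (hyR ω)).1
  refine ⟨hI, ?_⟩
  have key : Tendsto (fun ε : ℝ => ∫ ω, (φ (l ω) (x ω + ε • y ω) - φ (l ω) (x ω)) / ε ∂ν) (𝓝[>] 0)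
      (𝓝 (∫ ω, inner ℝ (grad φ (l ω) (x ω)) (y ω) ∂ν)) := by
    refine tendsto_integral_filter_of_dominated_convergence
      (fun ω => R * (Φ (l ω) + M * (2 * φ (l ω) (x ω) + 2 * R * Φ (l ω)))) ?_ ?_ ?_ ?_
    · filter_upwards [hsm] with ε hε
      exact (((hmeas ε hε.1.le hε.2.1).sub
        (measurable_comp_of_mem hm hl hx hmem)).div_const ε).aestronglyMeasurable
    · filter_upwards [hsm] with ε hε
      exact Eventually.of_forall fun ω => (abs_slope_le hφ hconv hnonneg hgrowth hR hε.1 hε.2.2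
        hε.2.1 (hmem ω) (hmem' ε hε.1.le hε.2.1 ω) (hyR ω)).2
    · exact (hΦ.add (((hint.const_mul 2).add (hΦ.const_mul (2 * R))).const_mul _)).const_mul _
    · exact Eventually.of_forall fun ω => tendsto_slope_grad hφ (l ω) (hmem ω)
        (by simpa using hmem' 1 zero_le_one le_rfl ω)
  refine key.congr' ?_
  filter_upwards [hI] with ε hε
  rw [integral_div, integral_sub hε hint]

end Growth

theorem integrable_grad (hφ : IsC1InControl φ) {Φ : E d → ℝ≥0} {M : ℝ≥0}
    (hgrowth : ∀ l, ∀ a ∈ orthant k, ‖grad φ l a‖ ≤ Φ l + M * φ l a)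
    {X : Type*} [MeasurableSpace X] {ν : Measure X}
    (hm : Measurable fun p : E d × orthant k => φ p.1 p.2) {l : X → E d} {x : X → E k}
    (hl : Measurable l) (hx : Measurable x) (hmem : ∀ ω, x ω ∈ orthant k)
    (hΦ : Integrable (fun ω => (Φ (l ω) : ℝ)) ν)
    (hint : Integrable (fun ω => φ (l ω) (x ω)) ν) :
    Integrable (fun ω => grad φ (l ω) (x ω)) ν :=
  Integrable.mono' (hΦ.add (hint.const_mul M))
    (measurable_grad_comp_of_mem hφ hm hl hx hmem).aestronglyMeasurable
    (Eventually.of_forall fun ω => hgrowth _ _ (hmem ω))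

end Convex


/-! ### Conditional independence in terms of conditional probabilities. -/

section CondProb

variable {Ω : Type*} {m m₁ mΩ : MeasurableSpace Ω} {P : Measure Ω} [IsProbabilityMeasure P]

theorem integrable_indicator_one' {S : Set Ω} (hS : MeasurableSet[mΩ] S) :
    Integrable (S.indicator fun _ => (1 : ℝ)) P :=
  (integrable_const _).indicator hS

theorem indicator_one_mul_eq (S : Set Ω) (f : Ω → ℝ) :
    (S.indicator fun _ => (1 : ℝ)) * f = S.indicator f := by
  ext ω
  by_cases h : ω ∈ S <;> simp [h]

theorem condExp_indicator_mul_condExp {S : Set Ω} (hS : MeasurableSet[mΩ] S)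
    (f : Ω → ℝ) :
    P[S.indicator P[f | m] | m] =ᵐ[P] P⟦S | m⟧ * P[f | m] := by
  rw [← indicator_one_mul_eq]
  refine condExp_mul_of_stronglyMeasurable_right stronglyMeasurable_condExp ?_
    (integrable_indicator_one' hS)
  rw [indicator_one_mul_eq]
  exact integrable_condExp.indicator hS

theorem setIntegral_condExp_eq_integral_mul (hm : m ≤ mΩ) {S : Set Ω} (hS : MeasurableSet[mΩ] S)
    (f : Ω → ℝ) : ∫ ω in S, P[f | m] ω ∂P = ∫ ω, (P⟦S | m⟧) ω * P[f | m] ω ∂P := by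
  rw [← integral_indicator hS, ← integral_condExp hm]
  exact integral_congr_ae (condExp_indicator_mul_condExp hS f)

theorem setIntegral_eq_of_isPiSystem {C : Set (Set Ω)} (hC : IsPiSystem C) (huniv : univ ∈ C)
    (hm : MeasurableSpace.generateFrom C ≤ mΩ) {f g : Ω → ℝ} (hf : Integrable f P)
    (hg : Integrable g P) (h : ∀ S ∈ C, ∫ ω in S, f ω ∂P = ∫ ω in S, g ω ∂P) {S : Set Ω}
    (hS : MeasurableSet[MeasurableSpace.generateFrom C] S) :
    ∫ ω in S, f ω ∂P = ∫ ω in S, g ω ∂P := by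
  have hall : ∫ ω, f ω ∂P = ∫ ω, g ω ∂P := by simpa using h univ huniv
  induction S, hS using MeasurableSpace.induction_on_inter (s := C) rfl hC with
  | empty => simp
  | basic S hS => exact h S hS
  | compl S hS ih =>
    rw [setIntegral_compl (hm S hS) hf, setIntegral_compl (hm S hS) hg, hall, ih]
  | iUnion F hd hF ih =>
    rw [integral_iUnion (fun n => hm _ (hF n)) hd hf.integrableOn,
      integral_iUnion (fun n => hm _ (hF n)) hd hg.integrableOn]
    exact tsum_congr ih

/-- If `m₁` and `m₂` are conditionally independent given `m`, so are `m₁` and `m ⊔ m₂`. -/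
theorem setIntegral_indicator_eq_of_condIndependent {m₀ m₂ : MeasurableSpace Ω}
    (hm : m ≤ mΩ) (hm₀ : m₀ ≤ m) (hm₂ : m₂ ≤ mΩ) {U : Set Ω} (hU : MeasurableSet[mΩ] U)
    (h : ∀ W, MeasurableSet[m₂] W → P⟦W ∩ U | m⟧ =ᵐ[P] P⟦W | m⟧ * P⟦U | m⟧)
    {S : Set Ω} (hS : MeasurableSet[m₀ ⊔ m₂] S) :
    ∫ ω in S, U.indicator (fun _ => (1 : ℝ)) ω ∂P = ∫ ω in S, (P⟦U | m⟧) ω ∂P := by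
  -- Intersections `V ∩ W` form a π-system generating `m₀ ⊔ m₂`. On them, `V` is handled by
  -- conditioning on `m ⊇ m₀`, and `W` by the product formula.
  let C : Set (Set Ω) := {S | ∃ V W, MeasurableSet[m₀] V ∧ MeasurableSet[m₂] W ∧ S = V ∩ W}
  have hgen : MeasurableSpace.generateFrom C = m₀ ⊔ m₂ := by
    apply le_antisymm
    · refine MeasurableSpace.generateFrom_le ?_
      rintro _ ⟨V, W, hV, hW, rfl⟩
      exact MeasurableSet.inter ((le_sup_left : m₀ ≤ m₀ ⊔ m₂) V hV)
        ((le_sup_right : m₂ ≤ m₀ ⊔ m₂) W hW)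
    · refine sup_le (fun V hV => ?_) fun W hW => ?_
      · exact MeasurableSpace.measurableSet_generateFrom
          ⟨V, univ, hV, MeasurableSet.univ, (inter_univ V).symm⟩
      · exact MeasurableSpace.measurableSet_generateFrom
          ⟨univ, W, MeasurableSet.univ, hW, (univ_inter W).symm⟩
  have hpi : IsPiSystem C := by
    rintro _ ⟨V, W, hV, hW, rfl⟩ _ ⟨V', W', hV', hW', rfl⟩ -
    exact ⟨V ∩ V', W ∩ W', hV.inter hV', hW.inter hW', inter_inter_inter_comm _ _ _ _⟩
  refine setIntegral_eq_of_isPiSystem (C := C) hpi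
    ⟨univ, univ, MeasurableSet.univ, MeasurableSet.univ, (inter_univ _).symm⟩
    (hgen.trans_le (sup_le (hm₀.trans hm) hm₂)) (integrable_indicator_one' hU)
    integrable_condExp ?_ (hgen ▸ hS)
  rintro _ ⟨V, W, hV, hW, rfl⟩
  have hV' := hm _ (hm₀ _ hV)
  have hW' := hm₂ _ hW
  calc ∫ ω in V ∩ W, U.indicator (fun _ => (1 : ℝ)) ω ∂P
      = ∫ ω in V, (W ∩ U).indicator (fun _ => (1 : ℝ)) ω ∂P := by
        rw [← setIntegral_indicator hW', indicator_indicator]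
    _ = ∫ ω in V, (P⟦W ∩ U | m⟧) ω ∂P :=
        (setIntegral_condExp hm (integrable_indicator_one' (hW'.inter hU)) (hm₀ _ hV)).symm
    _ = ∫ ω in V, P[W.indicator (P⟦U | m⟧) | m] ω ∂P := by
        refine setIntegral_congr_ae hV' ?_
        filter_upwards [h W hW, condExp_indicator_mul_condExp hW'
          (P := P) (U.indicator fun _ => (1 : ℝ))] with ω h1 h2 _
        rw [h1, h2]
    _ = ∫ ω in V, W.indicator (P⟦U | m⟧) ω ∂P :=
        setIntegral_condExp hm (integrable_condExp.indicator hW') (hm₀ _ hV)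
    _ = ∫ ω in V ∩ W, (P⟦U | m⟧) ω ∂P := by rw [setIntegral_indicator hW']

/-- Conditional expectation is self-adjoint: the integral of P(U|m) over `S` equals that of P(S|m)
over `U`. So a statement about predicting every `U` of `m₁` from `m` turns into one about `S`: the
larger `m₁` predicts it no better than `m`. -/
theorem condExp_indicator_eq_of_setIntegral (hm : m ≤ m₁) (hm₁ : m₁ ≤ mΩ) {S : Set Ω}
    (hS : MeasurableSet[mΩ] S)
    (h : ∀ U, MeasurableSet[m₁] U →
      ∫ ω in S, U.indicator (fun _ => (1 : ℝ)) ω ∂P = ∫ ω in S, (P⟦U | m⟧) ω ∂P) :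
    P⟦S | m⟧ =ᵐ[P] P⟦S | m₁⟧ := by
  refine ae_eq_condExp_of_forall_setIntegral_eq hm₁ (integrable_indicator_one' hS)
    (fun _ _ _ => integrable_condExp.integrableOn) (fun U hU _ => ?_)
    (stronglyMeasurable_condExp.mono hm).aestronglyMeasurable
  have hU' := hm₁ _ hU
  rw [setIntegral_condExp_eq_integral_mul (hm.trans hm₁) hU']
  calc ∫ ω, (P⟦U | m⟧) ω * (P⟦S | m⟧) ω ∂P = ∫ ω in S, (P⟦U | m⟧) ω ∂P := by
        rw [setIntegral_condExp_eq_integral_mul (hm.trans hm₁) hS]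
        simp_rw [mul_comm]
    _ = ∫ ω in S, U.indicator (fun _ => (1 : ℝ)) ω ∂P := (h U hU).symm
    _ = ∫ ω in U, S.indicator (fun _ => (1 : ℝ)) ω ∂P := by
        rw [setIntegral_indicator hU', setIntegral_indicator hS, inter_comm]

end CondProb

/-! ### Controls adapted to the augmented filtration, and their admissibility. -/

section Admissible

variable {T : ℝ} [hT : Fact (0 < T)] {d k : ℕ}

/-- The completion of a filtration by the null sets of the ambient σ-algebra. -/
def completeFiltration {Ω ι : Type*} [Preorder ι] {mΩ : MeasurableSpace Ω} (P : Measure Ω)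
    (f : Filtration ι mΩ) : Filtration ι mΩ where
  -- The ambient σ-algebra need not be complete, so only its own null sets may be added.
  seq t := eventuallyMeasurableSpace (f t) (ae P) ⊓ mΩ
  mono' _ _ hst := inf_le_inf_right _ fun _ ⟨S', h, h'⟩ => ⟨S', f.mono hst S' h, h'⟩
  le' _ := inf_le_right

theorem measurableSet_completeFiltration {Ω ι : Type*} [Preorder ι] {mΩ : MeasurableSpace Ω}
    {P : Measure Ω} {f : Filtration ι mΩ} {t : ι} {S : Set Ω} :
    MeasurableSet[completeFiltration P f t] S ↔
      (∃ S', MeasurableSet[f t] S' ∧ S =ᵐ[P] S') ∧ MeasurableSet[mΩ] S :=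
  MeasurableSpace.measurableSet_inf

/-- The usual augmentation of the filtration generated by `(L,A)`. -/
def augFiltration (P : Measure (Skorokhod T d × IncSkorokhod T k)) :
    Filtration (Time T) (inferInstance : MeasurableSpace (Skorokhod T d × IncSkorokhod T k)) :=
  (completeFiltration P (filtL T d k ⊔ filtA T d k)).rightCont

instance (P : Measure (Skorokhod T d × IncSkorokhod T k)) :
    (augFiltration P).IsRightContinuous := by
  unfold augFiltration; infer_instance

theorem le_augFiltration (P : Measure (Skorokhod T d × IncSkorokhod T k)) (t : Time T) :
    filtL T d k t ⊔ filtA T d k t ≤ augFiltration P t := fun S hS =>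
  Filtration.le_rightCont _ t S (measurableSet_completeFiltration.2
    ⟨⟨S, hS, ae_eq_refl _⟩, (filtL T d k ⊔ filtA T d k).le t S hS⟩)

theorem measurableSet_augFiltration_of_null {P : Measure (Skorokhod T d × IncSkorokhod T k)}
    (t : Time T) {S : Set (Skorokhod T d × IncSkorokhod T k)} (hS : MeasurableSet S)
    (h0 : P S = 0) : MeasurableSet[augFiltration P t] S :=
  Filtration.le_rightCont _ t S (measurableSet_completeFiltration.2
    ⟨⟨∅, ((filtL T d k ⊔ filtA T d k) t).measurableSet_empty, ae_eq_empty.2 h0⟩, hS⟩)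

theorem rightCont_top {Ω : Type*} {mΩ : MeasurableSpace Ω} (f : Filtration (Time T) mΩ) :
    f.rightCont ⊤ = f ⊤ := f.rightCont_eq_of_isMax isMax_top

/-- Right-continuity is undone by giving up the time from `t` to `s`, and completion by changing the
event on a null set. -/
theorem exists_measurableSet_of_augFiltration {P : Measure (Skorokhod T d × IncSkorokhod T k)}
    {t s : Time T} (hts : t < s) {S : Set (Skorokhod T d × IncSkorokhod T k)}
    (hS : MeasurableSet[augFiltration P t] S) :
    ∃ S', MeasurableSet[filtL T d k s ⊔ filtA T d k s] S' ∧ S =ᵐ[P] S' := by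
  have := nhdsGT_neBot_of_lt_top (hts.trans_le le_top)
  rw [augFiltration, Filtration.rightCont_eq_of_neBot_nhdsGT] at hS
  simp only [MeasurableSpace.measurableSet_iInf] at hS
  exact (measurableSet_completeFiltration.1 (hS s hts)).1

theorem measurable_eval_filtL {s t : Time T} (hst : s ≤ t) :
    Measurable[filtL T d k t] fun ω : Skorokhod T d × IncSkorokhod T k => ω.1 s :=
  Measurable.of_comap_le (le_iSup₂_of_le s hst le_rfl)

theorem measurable_eval_filtA {s t : Time T} (hst : s ≤ t) :
    Measurable[filtA T d k t] fun ω : Skorokhod T d × IncSkorokhod T k => ω.2 s :=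
  Measurable.of_comap_le (le_iSup₂_of_le s hst le_rfl)

theorem filtL_le_comap (t : Time T) :
    filtL T d k t ≤ MeasurableSpace.comap Prod.fst inferInstance := by
  refine iSup₂_le fun s _ => ?_
  refine le_trans ?_ (MeasurableSpace.comap_mono (Skorokhod.measurable_eval s).comap_le)
  rw [MeasurableSpace.comap_comp]
  exact le_rfl

theorem rightCont_filtL_le (t : Time T) : (filtL T d k).rightCont t ≤ filtL T d k ⊤ :=
  ((filtL T d k).rightCont.mono le_top).trans_eq (rightCont_top _)

theorem eq_of_measurable_comap {Ω β γ : Type*} [MeasurableSpace β] {mγ : MeasurableSpace γ}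
    [MeasurableSingletonClass β] {p : Ω → γ} {w : Ω → β} (hw : Measurable[mγ.comap p] w) {x y : Ω}
    (h : p x = p y) : w x = w y := by
  obtain ⟨B, -, hB⟩ := hw (measurableSet_singleton (w y))
  have hy : y ∈ p ⁻¹' B := by rw [hB]; rfl
  have hx : x ∈ p ⁻¹' B := by rw [mem_preimage, h]; exact hy
  rw [hB] at hx
  exact hx

variable {P₀ : Measure (Skorokhod T d)} {P : Measure (Skorokhod T d × IncSkorokhod T k)}

/-- The useful form of admissibility: given the whole path of L, the probability of an augmented
event at `t` depends only on information about L at `t+`. For each later time `s n` the event is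
almost surely a raw event of (L,A) at `s n`, to which conditional independence applies. Letting `s
n` decrease to `t` works precisely because the filtration of L in the conditioning is
right-continuous. -/
theorem Admissible.exists_condExp_eq (hP : Admissible P₀ P) {t : Time T}
    {S : Set (Skorokhod T d × IncSkorokhod T k)} (hS : MeasurableSet[augFiltration P t] S) :
    ∃ w : Skorokhod T d × IncSkorokhod T k → ℝ, Measurable[(filtL T d k).rightCont t] w ∧
      P⟦S | filtL T d k ⊤⟧ =ᵐ[P] w := by
  have := hP.isProbabilityMeasure
  rcases eq_or_lt_of_le (le_top (a := t)) with rfl | ht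
  · refine ⟨_, ?_, ae_eq_refl _⟩
    rw [rightCont_top]
    exact stronglyMeasurable_condExp.measurable
  · obtain ⟨s, hs, hst, hlim⟩ := exists_seq_strictAnti_tendsto' ht
    have h1 : ∀ n, ∃ f : Skorokhod T d × IncSkorokhod T k → ℝ,
        Measurable[(filtL T d k).rightCont (s n)] f ∧ P⟦S | filtL T d k ⊤⟧ =ᵐ[P] f := by
      intro n
      obtain ⟨S', hS', hSS'⟩ := exists_measurableSet_of_augFiltration (hst n).1 hS
      have hS'm := (filtL T d k ⊔ filtA T d k).le (s n) S' hS'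
      refine ⟨P⟦S' | (filtL T d k).rightCont (s n)⟧, stronglyMeasurable_condExp.measurable, ?_⟩
      refine (condExp_congr_ae (indicator_ae_eq_of_ae_eq_set hSS')).trans
        (condExp_indicator_eq_of_setIntegral (rightCont_filtL_le _) ((filtL T d k).le ⊤) hS'm
          fun U hU => ?_).symm
      exact setIntegral_indicator_eq_of_condIndependent ((filtL T d k).rightCont.le _)
        ((filtL T d k).le_rightCont _) ((filtA T d k).le (s n)) ((filtL T d k).le ⊤ U hU)
        (fun W hW => hP.condIndep (s n) W U hW hU) hS'
    choose f hf hfS using h1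
    -- All `f n` agree almost surely. The limsup ignores finitely many of them, so it is measurable
    -- at every time after `t`, hence at `t`.
    refine ⟨fun ω => limsup (fun n => f n ω) atTop, ?_, ?_⟩
    · refine measurable_of_forall_gt ht fun r hr => ?_
      obtain ⟨n₀, hn₀⟩ := eventually_atTop.1 (hlim.eventually (gt_mem_nhds hr))
      simp_rw [← fun ω => limsup_nat_add (fun n => f n ω) n₀]
      exact Measurable.limsup fun n => (hf _).mono
        ((filtL T d k).rightCont.mono (hn₀ _ (Nat.le_add_left _ _)).le) le_rfl
    · filter_upwards [ae_all_iff.2 hfS] with ω hω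
      simp [← hω]

/-- A control, on the space of pairs `(L,A)`. -/
def IsControl (P : Measure (Skorokhod T d × IncSkorokhod T k))
    (a : Skorokhod T d × IncSkorokhod T k → IncSkorokhod T k) : Prop :=
  ∀ t, Measurable[augFiltration P t] fun ω => a ω t

theorem IsControl.measurable_eval {a : Skorokhod T d × IncSkorokhod T k → IncSkorokhod T k}
    (ha : IsControl P a) (t : Time T) : Measurable fun ω => a ω t :=
  (ha t).mono ((augFiltration P).le t) le_rfl

theorem IsControl.measurable {a : Skorokhod T d × IncSkorokhod T k → IncSkorokhod T k}
    (ha : IsControl P a) : Measurable a :=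
  IncSkorokhod.measurable_iff.2 ha.measurable_eval

theorem isControl_snd : IsControl P fun ω => ω.2 := fun t =>
  (measurable_eval_filtA le_rfl).mono (le_sup_right.trans (le_augFiltration P t)) le_rfl

theorem measurable_fst_eval_augFiltration (t : Time T) :
    Measurable[augFiltration P t] fun ω => ω.1 t :=
  (measurable_eval_filtL le_rfl).mono (le_sup_left.trans (le_augFiltration P t)) le_rfl

theorem IsControl.measurable_prodMk {a : Skorokhod T d × IncSkorokhod T k → IncSkorokhod T k}
    (ha : IsControl P a) : Measurable fun ω => (ω.1, a ω) :=
  measurable_fst.prodMk ha.measurable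

/-- The law of `(L,a)` is admissible, for every control `a`. -/
theorem IsControl.admissible_map {a : Skorokhod T d × IncSkorokhod T k → IncSkorokhod T k}
    (hP : Admissible P₀ P) (ha : IsControl P a) :
    Admissible P₀ (P.map fun ω => (ω.1, a ω)) := by
  have := hP.isProbabilityMeasure
  have hj := ha.measurable_prodMk
  set j : Skorokhod T d × IncSkorokhod T k → Skorokhod T d × IncSkorokhod T k :=
    fun ω => (ω.1, a ω) with hjdef
  have hμ : IsProbabilityMeasure (P.map j) := Measure.isProbabilityMeasure_map hj.aemeasurable
  refine ⟨hμ, ?_, fun t S U hS hU => ?_⟩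
  · rw [Measure.map_map measurable_fst hj]
    exact hP.marginal
  · set μ := P.map j
    have hjS : MeasurableSet[augFiltration P t] (j ⁻¹' S) := by
      have : filtA T d k t ≤ (augFiltration P t).map j := by
        refine iSup₂_le fun s hs => ?_
        rw [MeasurableSpace.comap_le_iff_le_map]
        exact ((ha s).mono ((augFiltration P).mono hs) le_rfl).le_map
      exact this S hS
    have hSm := (filtA T d k).le t S hS
    have hUm := (filtL T d k).le ⊤ U hU
    have hjSm := (augFiltration P).le t _ hjS
    -- The map `j` leaves L unchanged, so it fixes every event of L and, below, every function
    -- measurable with respect to L.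
    have hpre : ∀ V, MeasurableSet[filtL T d k ⊤] V → j ⁻¹' V = V := by
      intro V hV
      obtain ⟨B, -, rfl⟩ := filtL_le_comap ⊤ V hV
      rfl
    obtain ⟨w, hw, hwS⟩ := hP.exists_condExp_eq hjS
    have hwF := hw.mono (rightCont_filtL_le t) le_rfl
    have hwm := hw.mono ((filtL T d k).rightCont.le t) le_rfl
    have hwj : w ∘ j = w := by
      ext ω
      exact eq_of_measurable_comap (hwF.mono (filtL_le_comap ⊤) le_rfl) rfl
    have hwi : Integrable w P := integrable_condExp.congr hwS
    have hwμ : Integrable w μ := by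
      rw [integrable_map_measure hwm.aestronglyMeasurable hj.aemeasurable, hwj]
      exact hwi
    -- The same `w` serves as the conditional probability under the new law. Since it is already
    -- measurable at `t+` for L, it equals the conditional probability given that smaller σ-algebra
    -- too, and the product formula follows by pulling it out.
    have hw1 : w =ᵐ[μ] μ⟦S | filtL T d k ⊤⟧ := by
      refine ae_eq_condExp_of_forall_setIntegral_eq ((filtL T d k).le ⊤)
        (integrable_indicator_one' hSm) (fun _ _ _ => hwμ.integrableOn) (fun V hV _ => ?_)
        hwF.stronglyMeasurable.aestronglyMeasurable
      have hVm := (filtL T d k).le ⊤ V hV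
      rw [setIntegral_map hVm hwm.aestronglyMeasurable hj.aemeasurable,
        setIntegral_map hVm (integrable_indicator_one' hSm).1 hj.aemeasurable, hpre V hV]
      calc ∫ ω in V, w (j ω) ∂P = ∫ ω in V, (P⟦j ⁻¹' S | filtL T d k ⊤⟧) ω ∂P := by
            refine setIntegral_congr_ae hVm ?_
            filter_upwards [hwS] with ω hω _
            rw [hω]
            exact congrFun hwj ω
        _ = ∫ ω in V, (j ⁻¹' S).indicator (fun _ => (1 : ℝ)) ω ∂P :=
            setIntegral_condExp ((filtL T d k).le ⊤) (integrable_indicator_one' hjSm) hV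
        _ = _ := rfl
    have hle := rightCont_filtL_le (d := d) (k := k) t
    have hbdd : ∀ {f : Skorokhod T d × IncSkorokhod T k → ℝ}, Integrable f μ →
        Integrable (f * U.indicator fun _ => (1 : ℝ)) μ := by
      intro f hf
      rw [mul_comm, indicator_one_mul_eq]
      exact hf.indicator hUm
    have h1 : μ⟦S | (filtL T d k).rightCont t⟧ =ᵐ[μ] w := by
      refine (condExp_condExp_of_le hle ((filtL T d k).le ⊤)).symm.trans ?_
      refine (condExp_congr_ae hw1.symm).trans ?_
      rw [condExp_of_stronglyMeasurable ((filtL T d k).rightCont.le t) hw.stronglyMeasurable hwμ]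
    have h2 : μ⟦S ∩ U | filtL T d k ⊤⟧ =ᵐ[μ] w * U.indicator fun _ => (1 : ℝ) := by
      have heq : (S ∩ U).indicator (fun _ => (1 : ℝ)) =
          (S.indicator fun _ => (1 : ℝ)) * U.indicator fun _ => (1 : ℝ) := by
        rw [indicator_one_mul_eq, indicator_indicator]
      rw [heq]
      refine (condExp_mul_of_stronglyMeasurable_right
        (stronglyMeasurable_const.indicator hU) (hbdd (integrable_indicator_one' hSm))
        (integrable_indicator_one' hSm)).trans ?_
      filter_upwards [hw1] with ω hω
      simp only [Pi.mul_apply, hω]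
    have h3 : μ⟦S ∩ U | (filtL T d k).rightCont t⟧ =ᵐ[μ]
        w * μ⟦U | (filtL T d k).rightCont t⟧ := by
      refine (condExp_condExp_of_le hle ((filtL T d k).le ⊤)).symm.trans ?_
      refine (condExp_congr_ae h2).trans ?_
      exact condExp_mul_of_stronglyMeasurable_left hw.stronglyMeasurable (hbdd hwμ)
        (integrable_indicator_one' hUm)
    filter_upwards [h1, h3] with ω h4 h5
    rw [h5, Pi.mul_apply, Pi.mul_apply, h4]

end Admissible


/-! ### Measurability, convexity and weak continuity of the cost. -/

section Cost

variable {T : ℝ} [hT : Fact (0 < T)] {d k : ℕ}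

theorem IsCadlag.map₂ {N M K : ℕ} {x : Time T → E N} {y : Time T → E M} (hx : IsCadlag x)
    (hy : IsCadlag y) {F : E N × E M → E K} (hF : Continuous F) :
    IsCadlag fun t => F (x t, y t) := by
  intro t
  refine ⟨hF.continuousAt.comp_continuousWithinAt ((hx t).1.prodMk (hy t).1), ?_⟩
  obtain ⟨l, hl⟩ := (hx t).2
  obtain ⟨l', hl'⟩ := (hy t).2
  exact ⟨F (l, l'), (hF.tendsto _).comp (hl.prodMk_nhds hl')⟩

theorem IsCadlag.map {N K : ℕ} {x : Time T → E N} (hx : IsCadlag x) {F : E N → E K}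
    (hF : Continuous F) : IsCadlag fun t => F (x t) :=
  hx.map₂ hx (F := fun p => F p.1) (hF.comp continuous_fst)

theorem Continuous.isCadlag {N : ℕ} {x : Time T → E N} (hx : Continuous x) : IsCadlag x :=
  fun t => ⟨hx.continuousWithinAt, x t, hx.continuousWithinAt⟩

/-- The midpoint of two nondecreasing paths. -/
def IncSkorokhod.mid (A B : IncSkorokhod T k) : IncSkorokhod T k :=
  ⟨fun t => (1 / 2 : ℝ) • A t + (1 / 2 : ℝ) • B t,
    A.2.1.map₂ B.2.1 (F := fun p => (1 / 2 : ℝ) • p.1 + (1 / 2 : ℝ) • p.2) (by fun_prop),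
    fun i s t hst => add_le_add (mul_le_mul_of_nonneg_left (A.2.2.1 i hst) (by norm_num))
      (mul_le_mul_of_nonneg_left (B.2.2.1 i hst) (by norm_num)),
    fun i => add_nonneg (mul_nonneg (by norm_num) (A.nonneg ⊥ i))
      (mul_nonneg (by norm_num) (B.nonneg ⊥ i))⟩

theorem IncSkorokhod.mid_apply (A B : IncSkorokhod T k) (t : Time T) (i : Fin k) :
    A.mid B t i = 1 / 2 * A t i + 1 / 2 * B t i := rfl

variable (c : CostData T d k)

/-- The part `∫_{[0,T]} f dA` of the cost. -/
def CostData.fInt (A : IncSkorokhod T k) : ℝ := ∑ i, ∫ t, c.f t i ∂(A.dMeasure i)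

theorem CostData.continuous_f_apply (i : Fin k) : Continuous fun t => c.f t i :=
  (by fun_prop : Continuous fun a : E k => a i).comp c.f_continuous

theorem CostData.integrable_f_apply (A : IncSkorokhod T k) (i : Fin k) :
    Integrable (fun t => c.f t i) (A.dMeasure i) :=
  (Continuous.isCadlag c.f_continuous).integrable_coord i _

theorem CostData.fInt_nonneg (A : IncSkorokhod T k) : 0 ≤ c.fInt A :=
  Finset.sum_nonneg fun i _ => integral_nonneg fun t => c.f_mem t i

theorem CostData.fInt_linear {A B C : IncSkorokhod T k} {α β : ℝ} (hα : 0 ≤ α) (hβ : 0 ≤ β)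
    (h : ∀ t i, C t i = α * A t i + β * B t i) : c.fInt C = α * c.fInt A + β * c.fInt B := by
  rw [fInt, fInt, fInt, Finset.mul_sum, Finset.mul_sum, ← Finset.sum_add_distrib]
  refine Finset.sum_congr rfl fun i _ => ?_
  rw [IncSkorokhod.dMeasure_eq_of_linear hα hβ fun t => h t i,
    integral_add_measure ((c.integrable_f_apply A i).smul_measure ENNReal.ofReal_ne_top)
      ((c.integrable_f_apply B i).smul_measure ENNReal.ofReal_ne_top),
    integral_smul_measure, integral_smul_measure, ENNReal.toReal_ofReal hα,
    ENNReal.toReal_ofReal hβ, smul_eq_mul, smul_eq_mul]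

theorem CostData.cost_eq (L : Skorokhod T d) (A : IncSkorokhod T k) :
    c.cost L A = ENNReal.ofReal (c.fInt A) + (∫⁻ t, ENNReal.ofReal (c.h (L t) (A t)) ∂leb T)
      + ENNReal.ofReal (c.g (L ⊤) (A ⊤)) := by
  rw [cost, fInt, ENNReal.ofReal_sum_of_nonneg fun i _ => integral_nonneg fun t => c.f_mem t i]
  congr 2
  refine Finset.sum_congr rfl fun i _ => ?_
  exact (ofReal_integral_eq_lintegral_ofReal (c.integrable_f_apply A i)
    (Eventually.of_forall fun t => c.f_mem t i)).symm

theorem measurable_riemannSum {Ω : Type*} [MeasurableSpace Ω] (n : ℕ) {y b : Ω → Time T → ℝ}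
    (hy : ∀ t, Measurable fun ω => y ω t) (hb : ∀ t, Measurable fun ω => b ω t) :
    Measurable fun ω => riemannSum n (y ω) (b ω) := by
  refine Finset.measurable_fun_sum _ fun j _ => Measurable.mul ?_ (hy _)
  cases j with
  | zero => exact hb _
  | succ j => exact (hb _).sub (hb _)

/-- The integral is a pointwise limit of Riemann sums, which involve finitely many evaluations; no
measurability of the kernel `dA` has to be set up. -/
theorem measurable_integral_dMeasure {Ω : Type*} [MeasurableSpace Ω] {N : ℕ}
    {a : Ω → IncSkorokhod T k} {y : Ω → Time T → E N} (ha : Measurable a)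
    (hy : ∀ ω, IsCadlag (y ω)) (hym : ∀ t, Measurable fun ω => y ω t) (i : Fin k) (l : Fin N) :
    Measurable fun ω => ∫ t, y ω t l ∂((a ω).dMeasure i) := by
  refine measurable_of_tendsto_metrizable (f := fun n ω =>
    riemannSum n (fun t => y ω t l) fun t => a ω t i) (fun n => ?_)
    (tendsto_pi_nhds.2 fun ω => (a ω).tendsto_riemannSum i (hy ω) l)
  exact measurable_riemannSum n (fun t => measurable_euclidean_iff.1 (hym t) l)
    fun t => measurable_euclidean_iff.1 (IncSkorokhod.measurable_iff.1 ha t) i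

variable {Ω : Type*} [MeasurableSpace Ω] {L : Ω → Skorokhod T d} {a : Ω → IncSkorokhod T k}

theorem CostData.measurable_fInt (ha : Measurable a) : Measurable fun ω => c.fInt (a ω) :=
  Finset.measurable_fun_sum _ fun i _ => measurable_integral_dMeasure ha
    (fun _ => Continuous.isCadlag c.f_continuous) (fun _ => measurable_const) i i

theorem measurable_uncurry_skorokhod (hL : Measurable L) :
    Measurable fun p : Ω × Time T => L p.1 p.2 :=
  measurable_uncurry_of_isCadlag (X := fun ω => L ω) (fun ω => (L ω).2) (Skorokhod.measurable_iff.1 hL)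

theorem measurable_uncurry_incSkorokhod (ha : Measurable a) :
    Measurable fun p : Ω × Time T => a p.1 p.2 :=
  measurable_uncurry_of_isCadlag (X := fun ω => a ω) (fun ω => (a ω).2.1)
    (IncSkorokhod.measurable_iff.1 ha)

theorem CostData.measurable_h_uncurry (hL : Measurable L) (ha : Measurable a) :
    Measurable fun p : Ω × Time T => c.h (L p.1 p.2) (a p.1 p.2) :=
  measurable_comp_of_mem c.h_measurable (measurable_uncurry_skorokhod hL)
    (measurable_uncurry_incSkorokhod ha) fun p => (a p.1).mem_orthant p.2

theorem CostData.measurable_g_top (hL : Measurable L) (ha : Measurable a) :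
    Measurable fun ω => c.g (L ω ⊤) (a ω ⊤) :=
  measurable_comp_of_mem c.g_measurable (Skorokhod.measurable_iff.1 hL ⊤)
    (IncSkorokhod.measurable_iff.1 ha ⊤) fun ω => (a ω).mem_orthant ⊤

theorem CostData.measurable_cost (hL : Measurable L) (ha : Measurable a) :
    Measurable fun ω => c.cost (L ω) (a ω) := by
  simp_rw [c.cost_eq]
  exact ((c.measurable_fInt ha).ennreal_ofReal.add
    (c.measurable_h_uncurry hL ha).ennreal_ofReal.lintegral_prod_right').add
      (c.measurable_g_top hL ha).ennreal_ofReal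

theorem ofReal_convex_mid {φ : E k → ℝ} (hφ : ConvexOn ℝ (orthant k) φ)
    (h0 : ∀ a ∈ orthant k, 0 ≤ φ a) {a b : E k} (ha : a ∈ orthant k) (hb : b ∈ orthant k) :
    ENNReal.ofReal (φ ((1 / 2 : ℝ) • a + (1 / 2 : ℝ) • b)) ≤
      2⁻¹ * ENNReal.ofReal (φ a) + 2⁻¹ * ENNReal.ofReal (φ b) := by
  have h := hφ.2 ha hb (by norm_num : (0 : ℝ) ≤ 1 / 2) (by norm_num : (0 : ℝ) ≤ 1 / 2) (by norm_num)
  have h2 : (2⁻¹ : ℝ≥0∞) = ENNReal.ofReal (1 / 2) := by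
    rw [one_div, ENNReal.ofReal_inv_of_pos two_pos, ENNReal.ofReal_ofNat]
  rw [h2, ← ENNReal.ofReal_mul (by norm_num), ← ENNReal.ofReal_mul (by norm_num),
    ← ENNReal.ofReal_add (mul_nonneg (by norm_num) (h0 a ha)) (mul_nonneg (by norm_num) (h0 b hb))]
  exact ENNReal.ofReal_le_ofReal h

theorem CostData.cost_mid_le (L : Skorokhod T d) (A B : IncSkorokhod T k) :
    c.cost L (A.mid B) ≤ 2⁻¹ * c.cost L A + 2⁻¹ * c.cost L B := by
  have hm : ∀ A : IncSkorokhod T k, Measurable fun t => ENNReal.ofReal (c.h (L t) (A t)) := by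
    intro A
    exact (measurable_comp_of_mem c.h_measurable L.2.measurable A.2.1.measurable
      fun t => A.mem_orthant t).ennreal_ofReal
  have h2 : (2⁻¹ : ℝ≥0∞) = ENNReal.ofReal (1 / 2) := by
    rw [one_div, ENNReal.ofReal_inv_of_pos two_pos, ENNReal.ofReal_ofNat]
  have hf : ENNReal.ofReal (c.fInt (A.mid B)) =
      2⁻¹ * ENNReal.ofReal (c.fInt A) + 2⁻¹ * ENNReal.ofReal (c.fInt B) := by
    rw [c.fInt_linear (by norm_num) (by norm_num) (A.mid_apply B), h2,
      ENNReal.ofReal_add (mul_nonneg (by norm_num) (c.fInt_nonneg A))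
        (mul_nonneg (by norm_num) (c.fInt_nonneg B)),
      ENNReal.ofReal_mul (by norm_num), ENNReal.ofReal_mul (by norm_num)]
  have hh : ∫⁻ t, ENNReal.ofReal (c.h (L t) (A.mid B t)) ∂leb T ≤
      2⁻¹ * (∫⁻ t, ENNReal.ofReal (c.h (L t) (A t)) ∂leb T) +
        2⁻¹ * ∫⁻ t, ENNReal.ofReal (c.h (L t) (B t)) ∂leb T := by
    rw [← lintegral_const_mul _ (hm A), ← lintegral_const_mul _ (hm B),
      ← lintegral_add_left ((hm A).const_mul _)]
    exact lintegral_mono fun t => ofReal_convex_mid (c.h_convex _) (c.h_nonneg _)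
      (A.mem_orthant t) (B.mem_orthant t)
  have hg := ofReal_convex_mid (c.g_convex (L ⊤)) (c.g_nonneg _) (A.mem_orthant ⊤)
    (B.mem_orthant ⊤)
  rw [c.cost_eq, c.cost_eq, c.cost_eq, hf]
  refine (add_le_add (add_le_add le_rfl hh) hg).trans_eq ?_
  ring

/-- Convergence of nondecreasing paths on a dense set implies weak convergence of the associated
measures. -/
theorem IncSkorokhod.tendsto_integral_of_tendsto {a : ℕ → IncSkorokhod T k} {A : IncSkorokhod T k}
    {i : Fin k} {D : Set (Time T)} (hD : Dense D) (htop : ⊤ ∈ D)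
    (h : ∀ t ∈ D, Tendsto (fun n => a n t i) atTop (𝓝 (A t i))) {f : Time T → ℝ}
    (hf : Continuous f) :
    Tendsto (fun n => ∫ t, f t ∂((a n).dMeasure i)) atTop (𝓝 (∫ t, f t ∂(A.dMeasure i))) := by
  -- The extra unit mass at T makes the total mass positive, so that normalising to a probability
  -- measure is possible even for the zero path. It is subtracted at the end.
  let ν : IncSkorokhod T k → Measure (Time T) := fun B => B.dMeasure i + Measure.dirac ⊤
  have hνu : ∀ B : IncSkorokhod T k, ν B univ = ENNReal.ofReal (B ⊤ i + 1) := by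
    intro B
    rw [Measure.add_apply, B.dMeasure_univ, Measure.dirac_apply_of_mem (mem_univ _),
      ENNReal.ofReal_add (B.nonneg ⊤ i) zero_le_one, ENNReal.ofReal_one]
  have hpos : ∀ B : IncSkorokhod T k, 0 < B ⊤ i + 1 := fun B => by linarith [B.nonneg ⊤ i]
  let p : IncSkorokhod T k → ProbabilityMeasure (Time T) := fun B =>
    ⟨(ENNReal.ofReal (B ⊤ i + 1))⁻¹ • ν B, ⟨by
      rw [Measure.smul_apply, hνu, smul_eq_mul, ENNReal.inv_mul_cancel
        (ENNReal.ofReal_pos.2 (hpos B)).ne' ENNReal.ofReal_ne_top]⟩⟩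
  have hpr : ∀ (B : IncSkorokhod T k) (s : Set (Time T)), ((p B s : ℝ≥0) : ℝ) =
      (B ⊤ i + 1)⁻¹ * ((B.dMeasure i).real s + (Measure.dirac (⊤ : Time T)).real s) := by
    intro B s
    have : ((p B s : ℝ≥0) : ℝ) = ((ENNReal.ofReal (B ⊤ i + 1))⁻¹ • ν B).real s := rfl
    rw [this, measureReal_ennreal_smul_apply, measureReal_add_apply, ENNReal.toReal_inv,
      ENNReal.toReal_ofReal (hpos B).le]
  have hpi : ∀ B : IncSkorokhod T k, ∫ t, f t ∂(p B : Measure (Time T)) =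
      (B ⊤ i + 1)⁻¹ * (∫ t, f t ∂(B.dMeasure i) + f ⊤) := by
    intro B
    have hint : ∀ (μ : Measure (Time T)) [IsFiniteMeasure μ], Integrable f μ := fun μ _ =>
      hf.integrable_of_hasCompactSupport (HasCompactSupport.of_compactSpace f)
    have : (p B : Measure (Time T)) = (ENNReal.ofReal (B ⊤ i + 1))⁻¹ • ν B := rfl
    rw [this, integral_smul_measure, integral_add_measure (hint _) (hint _), integral_dirac,
      ENNReal.toReal_inv, ENNReal.toReal_ofReal (hpos B).le, smul_eq_mul]
  have hinv : Tendsto (fun n => (a n ⊤ i + 1)⁻¹) atTop (𝓝 (A ⊤ i + 1)⁻¹) :=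
    ((h ⊤ htop).add_const 1).inv₀ (hpos A).ne'
  -- A π-system of intervals with endpoints in `D`, containing arbitrarily small neighbourhoods of
  -- every point; convergence of the masses on it implies weak convergence. The sets `Iic y` are
  -- needed at time 0, and `⊤ ∈ D` is needed at time T.
  let S : Set (Set (Time T)) := {s | ∃ y ∈ D, s = Iic y ∨ ∃ x ∈ D, s = Iic y \ Iic x}
  have hS : IsPiSystem S := by
    have hmin : ∀ y ∈ D, ∀ y' ∈ D, min y y' ∈ D := fun y hy y' hy' => by
      rcases min_choice y y' with h | h <;> rw [h] <;> assumption
    have hmax : ∀ y ∈ D, ∀ y' ∈ D, max y y' ∈ D := fun y hy y' hy' => by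
      rcases max_choice y y' with h | h <;> rw [h] <;> assumption
    rintro s ⟨y, hy, hs⟩ s' ⟨y', hy', hs'⟩ -
    refine ⟨min y y', hmin y hy y' hy', ?_⟩
    rcases hs with rfl | ⟨x, hx, rfl⟩ <;> rcases hs' with rfl | ⟨x', hx', rfl⟩
    · left; exact Iic_inter_Iic
    · right
      refine ⟨x', hx', ?_⟩
      ext t; simp only [mem_inter_iff, mem_Iic, Set.mem_sdiff, le_min_iff]; tauto
    · right
      refine ⟨x, hx, ?_⟩
      ext t; simp only [mem_inter_iff, mem_Iic, Set.mem_sdiff, le_min_iff]; tauto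
    · right
      refine ⟨max x x', hmax x hx x' hx', ?_⟩
      ext t; simp only [mem_inter_iff, mem_Iic, Set.mem_sdiff, le_min_iff, le_max_iff]; tauto
  have hreal : ∀ s ∈ S, Tendsto (fun n => ((a n).dMeasure i).real s) atTop
      (𝓝 ((A.dMeasure i).real s)) := by
    have hsd : ∀ (B : IncSkorokhod T k) (y x : Time T), (B.dMeasure i).real (Iic y \ Iic x) =
        B y i - B (min y x) i := by
      intro B y x
      have : Iic y \ Iic x = Iic y \ Iic (min y x) := by
        ext t; simp only [mem_Iic, Set.mem_sdiff, le_min_iff]; tauto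
      rw [this, measureReal_sdiff (Iic_subset_Iic.2 (min_le_left _ _)) measurableSet_Iic,
        B.dMeasure_real_Iic, B.dMeasure_real_Iic]
    rintro s ⟨y, hy, rfl | ⟨x, hx, rfl⟩⟩
    · simp_rw [IncSkorokhod.dMeasure_real_Iic]
      exact h y hy
    · simp_rw [hsd]
      refine (h y hy).sub ?_
      rcases min_choice y x with h' | h' <;> rw [h']
      · exact h y hy
      · exact h x hx
  have hconv : Tendsto (fun n => p (a n)) atTop (𝓝 (p A)) := by
    refine hS.tendsto_probabilityMeasure_of_tendsto_of_mem ?_ ?_ ?_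
    · rintro s ⟨y, -, rfl | ⟨x, -, rfl⟩⟩
      · exact measurableSet_Iic
      · exact measurableSet_Iic.diff measurableSet_Iic
    · intro u hu t ht
      have hun : u ∈ 𝓝 t := hu.mem_nhds ht
      have hright : ∃ y ∈ D, Iic y ∈ 𝓝 t ∧ ∀ s, t ≤ s → s ≤ y → s ∈ u := by
        rcases eq_or_lt_of_le (_root_.le_top (a := t)) with rfl | htt
        · exact ⟨⊤, htop, by simp, fun s hs _ => (_root_.top_le_iff.1 hs) ▸ ht⟩
        · obtain ⟨r, hr, hru⟩ := exists_Ico_subset_of_mem_nhds hun ⟨⊤, htt⟩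
          obtain ⟨y, hy, h1, h2⟩ := hD.exists_between hr
          exact ⟨y, hy, Iic_mem_nhds h1, fun s hs hsy => hru ⟨hs, hsy.trans_lt h2⟩⟩
      obtain ⟨y, hy, hyn, hyu⟩ := hright
      rcases eq_or_lt_of_le (bot_le (a := t)) with rfl | htb
      · exact ⟨Iic y, ⟨y, hy, Or.inl rfl⟩, hyn, fun s hs => hyu s bot_le hs⟩
      · obtain ⟨r, hr, hru⟩ := exists_Ioc_subset_of_mem_nhds hun ⟨⊥, htb⟩
        obtain ⟨x, hx, h1, h2⟩ := hD.exists_between hr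
        refine ⟨Iic y \ Iic x, ⟨y, hy, Or.inr ⟨x, hx, rfl⟩⟩, ?_, ?_⟩
        · filter_upwards [hyn, Ioi_mem_nhds h2] with s hs hs'
          exact ⟨hs, fun h' => (not_le.2 (mem_Ioi.1 hs')) h'⟩
        · rintro s ⟨hs, hs'⟩
          rcases le_total t s with h3 | h3
          · exact hyu s h3 hs
          · exact hru ⟨h1.trans (not_le.1 hs'), h3⟩
    · intro s hs
      rw [← NNReal.tendsto_coe]
      simp_rw [hpr]
      exact hinv.mul ((hreal s hs).add_const _)
  have h1 := ProbabilityMeasure.tendsto_iff_forall_integral_tendsto.1 hconv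
    (BoundedContinuousFunction.mkOfCompact ⟨f, hf⟩)
  simp only [BoundedContinuousFunction.mkOfCompact_apply, ContinuousMap.coe_mk, hpi] at h1
  have h2 := ((h1.mul ((h ⊤ htop).add_const 1)).sub_const (f ⊤))
  refine (h2.congr fun n => ?_).trans (le_of_eq ?_)
  · rw [mul_right_comm, inv_mul_cancel₀ (hpos _).ne']; ring
  · rw [mul_right_comm, inv_mul_cancel₀ (hpos _).ne']; congr 1; ring

end Cost


/-! ### A Komlós-type selection theorem. -/

theorem lintegral_prod_snd_snd {α β γ : Type*} [MeasurableSpace α] [MeasurableSpace β]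
    [MeasurableSpace γ] (κ : Measure α) (ν : Measure β) (P : Measure γ) [SFinite κ] [SFinite ν]
    [SFinite P] {g : γ → ℝ≥0∞} (hg : Measurable g) :
    ∫⁻ s, g s.2.2 ∂κ.prod (ν.prod P) = κ univ * (ν univ * ∫⁻ ω, g ω ∂P) := by
  rw [lintegral_prod (fun s : α × β × γ => g s.2.2)
    (hg.comp (measurable_snd.comp measurable_snd)).aemeasurable]
  simp only [lintegral_const]
  rw [lintegral_prod (fun s : β × γ => g s.2) (hg.comp measurable_snd).aemeasurable]
  simp only [lintegral_const]
  rw [mul_comm, mul_comm (ν univ)]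

theorem ENNReal_liminf_add_le (u v : ℕ → ℝ≥0∞) :
    liminf u atTop + liminf v atTop ≤ liminf (fun n => u n + v n) atTop := by
  rw [liminf_eq_iSup_iInf_of_nat', liminf_eq_iSup_iInf_of_nat', liminf_eq_iSup_iInf_of_nat',
    ENNReal.iSup_add_iSup_of_monotone]
  · exact iSup_mono fun n => le_iInf fun i => add_le_add (iInf_le _ i) (iInf_le _ i)
  all_goals
    intro m n hmn
    refine le_iInf fun i => (iInf_le _ (i + (n - m))).trans_eq ?_
    congr 1
    omega

section Komlos

variable {S : Type*} [MeasurableSpace S] {μ : Measure S} [IsFiniteMeasure μ]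

theorem integrable_exp_neg {x : S → ℝ} (hx : Measurable x) (h0 : ∀ s, 0 ≤ x s) :
    Integrable (fun s => Real.exp (-x s)) μ :=
  Integrable.of_bound (C := 1) (by fun_prop) (Eventually.of_forall fun s => by
    rw [Real.norm_of_nonneg (Real.exp_nonneg _)]
    exact Real.exp_le_one_iff.2 (neg_nonpos.2 (h0 s)))

theorem memLp_exp_neg_half {x : S → ℝ} (hx : Measurable x) (h0 : ∀ s, 0 ≤ x s) :
    MemLp (fun s => Real.exp (-x s / 2)) 2 μ :=
  MemLp.of_bound (by fun_prop) 1 (Eventually.of_forall fun s => by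
    rw [Real.norm_of_nonneg (Real.exp_nonneg _)]
    exact Real.exp_le_one_iff.2 (by linarith [h0 s]))

/-- Expanding the square of e^{-x/2} − e^{-y/2} leaves the exponential of minus the midpoint as
cross term. Thus the strict convexity of x ↦ ∫ e^{-x} is measured exactly by an L² distance. -/
theorem norm_sq_toLp_sub {x y : S → ℝ} (hx : Measurable x) (hx0 : ∀ s, 0 ≤ x s)
    (hy : Measurable y) (hy0 : ∀ s, 0 ≤ y s) :
    ‖(memLp_exp_neg_half (μ := μ) hx hx0).toLp _ - (memLp_exp_neg_half (μ := μ) hy hy0).toLp _‖ ^ 2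
      = (∫ s, Real.exp (-x s) ∂μ) + (∫ s, Real.exp (-y s) ∂μ)
        - 2 * ∫ s, Real.exp (-((x s + y s) / 2)) ∂μ := by
  have hi : Integrable (fun s => 2 * Real.exp (-((x s + y s) / 2))) μ :=
    (integrable_exp_neg (x := fun s => (x s + y s) / 2) ((hx.add hy).div_const 2)
      fun s => div_nonneg (add_nonneg (hx0 s) (hy0 s)) zero_le_two).const_mul 2
  have hi' : Integrable (fun s => Real.exp (-x s) + Real.exp (-y s)) μ :=
    (integrable_exp_neg hx hx0).add (integrable_exp_neg hy hy0)
  rw [← real_inner_self_eq_norm_sq, L2.inner_def, ← integral_const_mul, ← integral_add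
    (integrable_exp_neg hx hx0) (integrable_exp_neg hy hy0), ← integral_sub hi' hi]
  refine integral_congr_ae ?_
  filter_upwards [Lp.coeFn_sub ((memLp_exp_neg_half (μ := μ) hx hx0).toLp _)
    ((memLp_exp_neg_half (μ := μ) hy hy0).toLp _), (memLp_exp_neg_half (μ := μ) hx hx0).coeFn_toLp,
    (memLp_exp_neg_half (μ := μ) hy hy0).coeFn_toLp] with s h1 h2 h3
  rw [h1, Pi.sub_apply, h2, h3, real_inner_self_eq_norm_sq, Real.norm_eq_abs, sq_abs]
  have e1 : Real.exp (-x s) = Real.exp (-x s / 2) * Real.exp (-x s / 2) := by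
    rw [← Real.exp_add]; ring_nf
  have e2 : Real.exp (-y s) = Real.exp (-y s / 2) * Real.exp (-y s / 2) := by
    rw [← Real.exp_add]; ring_nf
  have e3 : Real.exp (-((x s + y s) / 2)) = Real.exp (-x s / 2) * Real.exp (-y s / 2) := by
    rw [← Real.exp_add]; ring_nf
  rw [e1, e2, e3]
  ring

/-- The limit `v` is nonnegative. If positive, take logarithms; if zero, `x` would tend to infinity,
against the finite liminf. -/
theorem exists_tendsto_of_tendsto_exp {x : ℕ → ℝ} {v : ℝ}
    (hv : Tendsto (fun n => Real.exp (-x n / 2)) atTop (𝓝 v))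
    (hfin : liminf (fun n => ENNReal.ofReal (x n)) atTop < ∞) : ∃ y, Tendsto x atTop (𝓝 y) := by
  rcases (ge_of_tendsto' hv fun n => (Real.exp_pos _).le).eq_or_lt with h0 | hpos
  · exfalso
    rw [← h0] at hv
    have h1 : Tendsto (fun n => -x n / 2) atTop atBot := Real.tendsto_exp_comp_nhds_zero.1 hv
    have h2 : Tendsto x atTop atTop := by
      have := (tendsto_neg_atBot_atTop.comp h1).atTop_mul_const (two_pos (α := ℝ))
      refine this.congr fun n => ?_
      simp only [Function.comp]; ring
    have h3 : Tendsto (fun n => ENNReal.ofReal (x n)) atTop (𝓝 ∞) :=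
      ENNReal.tendsto_ofReal_atTop.comp h2
    exact hfin.ne h3.liminf_eq
  · refine ⟨-2 * Real.log v, ?_⟩
    have := ((Real.continuousAt_log hpos.ne').tendsto.comp hv).const_mul (-2)
    refine this.congr fun n => ?_
    simp only [Function.comp, Real.log_exp]; ring

/-- A Komlós-type selection: decreasing midpoint-convex sets of nonnegative functions, bounded in
`L¹`, admit a selection which converges almost everywhere. -/
theorem exists_seq_ae_tendsto {K : ℕ → Set (S → ℝ)} (hanti : Antitone K)
    (hne : ∀ n, (K n).Nonempty) (hm : ∀ n, ∀ x ∈ K n, Measurable x)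
    (h0 : ∀ n, ∀ x ∈ K n, ∀ s, 0 ≤ x s)
    (hmid : ∀ n, ∀ x ∈ K n, ∀ y ∈ K n, (fun s => (x s + y s) / 2) ∈ K n) {C : ℝ≥0∞} (hC : C < ∞)
    (hbdd : ∀ n, ∀ x ∈ K n, ∫⁻ s, ENNReal.ofReal (x s) ∂μ ≤ C) :
    ∃ X : ℕ → S → ℝ, (∀ n, X n ∈ K n) ∧ ∀ᵐ s ∂μ, ∃ y, Tendsto (fun n => X n s) atTop (𝓝 y) := by
  -- Near-minimisers of `F` over `K n` are chosen. The infima `I n` increase to a finite `J`, and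
  -- midpoints of later choices stay in `K N`, so their `F` is at least `I N`. The identity for the
  -- L² distance then makes e^{-x n/2} a Cauchy sequence.
  let F : (S → ℝ) → ℝ := fun x => ∫ s, Real.exp (-x s) ∂μ
  let I : ℕ → ℝ := fun n => sInf (F '' K n)
  have hF0 : ∀ x, 0 ≤ F x := fun x => integral_nonneg fun s => (Real.exp_pos _).le
  have hbb : ∀ n, BddBelow (F '' K n) := fun n => ⟨0, by rintro _ ⟨x, -, rfl⟩; exact hF0 x⟩
  have hle : ∀ n, ∀ x ∈ K n, I n ≤ F x := fun n x hx => csInf_le (hbb n) ⟨x, hx, rfl⟩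
  have hImono : Monotone I := fun m n hmn =>
    csInf_le_csInf (hbb m) ((hne n).image F) (image_mono (hanti hmn))
  have hF1 : ∀ n, ∀ x ∈ K n, F x ≤ μ.real univ := by
    intro n x hx
    calc F x ≤ ∫ _, (1 : ℝ) ∂μ := integral_mono (integrable_exp_neg (hm n x hx) (h0 n x hx))
          (integrable_const _) fun s => Real.exp_le_one_iff.2 (neg_nonpos.2 (h0 n x hx s))
      _ = μ.real univ := by simp
  have hIb : BddAbove (range I) := by
    refine ⟨μ.real univ, ?_⟩
    rintro _ ⟨n, rfl⟩
    obtain ⟨x, hx⟩ := hne n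
    exact (hle n x hx).trans (hF1 n x hx)
  have hIlim := tendsto_atTop_ciSup hImono hIb
  set J := ⨆ n, I n
  have hchoose : ∀ n, ∃ x ∈ K n, F x < I n + 1 / ((n : ℝ) + 1) := by
    intro n
    obtain ⟨_, ⟨x, hx, rfl⟩, h⟩ := exists_lt_of_csInf_lt ((hne n).image F)
      (lt_add_of_pos_right (I n) (show (0 : ℝ) < 1 / ((n : ℝ) + 1) by positivity))
    exact ⟨x, hx, h⟩
  choose x hxK hxF using hchoose
  let u : ℕ → Lp ℝ 2 μ := fun n =>
    (memLp_exp_neg_half (μ := μ) (hm n _ (hxK n)) (h0 n _ (hxK n))).toLp _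
  have hcau : CauchySeq u := by
    refine cauchySeq_of_le_tendsto_0 (fun N => √(2 * (J + 1 / ((N : ℝ) + 1) - I N))) ?_ ?_
    · intro n m N hn hm'
      rw [dist_eq_norm]
      refine Real.le_sqrt_of_sq_le ?_
      rw [norm_sq_toLp_sub (hm n _ (hxK n)) (h0 n _ (hxK n)) (hm m _ (hxK m)) (h0 m _ (hxK m))]
      have h1 : ∀ j, N ≤ j → F (x j) ≤ J + 1 / ((N : ℝ) + 1) := fun j hj =>
        (hxF j).le.trans (add_le_add (le_ciSup hIb j)
          (one_div_le_one_div_of_le (by positivity) (by exact_mod_cast Nat.succ_le_succ hj)))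
      have h2 := hle N _ (hmid N _ (hanti hn (hxK n)) _ (hanti hm' (hxK m)))
      have h3 := h1 n hn
      have h4 := h1 m hm'
      simp only [F] at h2 h3 h4
      linarith
    · have h1 : Tendsto (fun N : ℕ => 2 * (J + 1 / ((N : ℝ) + 1) - I N)) atTop
          (𝓝 (2 * (J + 0 - J))) :=
        ((tendsto_one_div_add_atTop_nhds_zero_nat.const_add J).sub hIlim).const_mul 2
      have h2 := h1.sqrt
      simpa using h2
  obtain ⟨v, hv⟩ := cauchySeq_tendsto_of_complete hcau
  obtain ⟨ns, hns, hae⟩ := (tendstoInMeasure_of_tendsto_Lp hv).exists_seq_tendsto_ae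
  refine ⟨fun n => x (ns n), fun n => hanti hns.le_apply (hxK (ns n)), ?_⟩
  -- Fatou's lemma and the L¹ bound exclude that the selection escapes to infinity on a set of
  -- positive measure.
  have hfin : ∫⁻ s, liminf (fun n => ENNReal.ofReal (x (ns n) s)) atTop ∂μ ≠ ∞ := by
    refine ((lintegral_liminf_le fun n => (hm _ _ (hxK (ns n))).ennreal_ofReal).trans
      (liminf_le_of_le (by isBoundedDefault) (a := C) fun b hb => ?_)).trans_lt hC |>.ne
    obtain ⟨n, hn⟩ := hb.exists
    exact hn.trans (hbdd _ _ (hxK (ns n)))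
  have hlm : Measurable fun s => liminf (fun n => ENNReal.ofReal (x (ns n) s)) atTop :=
    Measurable.liminf fun n => (hm _ _ (hxK (ns n))).ennreal_ofReal
  have hcoe : ∀ᵐ s ∂μ, ∀ n, u (ns n) s = Real.exp (-x (ns n) s / 2) :=
    ae_all_iff.2 fun n => (memLp_exp_neg_half (μ := μ) (hm _ _ (hxK (ns n)))
      (h0 _ _ (hxK (ns n)))).coeFn_toLp
  filter_upwards [hae, ae_lt_top hlm hfin, hcoe] with s h1 h2 h3
  simp_rw [h3] at h1
  exact exists_tendsto_of_tendsto_exp h1 h2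

end Komlos

/-! ### Existence of an optimal control on the fixed probability space. -/

section Optimal

variable {T : ℝ} [hT : Fact (0 < T)] {d k : ℕ} {P₀ : Measure (Skorokhod T d)}
  {P : Measure (Skorokhod T d × IncSkorokhod T k)}

/-- The expected cost of a control. -/
def CostData.controlCost (c : CostData T d k) (P : Measure (Skorokhod T d × IncSkorokhod T k))
    (a : Skorokhod T d × IncSkorokhod T k → IncSkorokhod T k) : ℝ≥0∞ :=
  ∫⁻ ω, c.cost ω.1 (a ω) ∂P

theorem CostData.expCost_map (c : CostData T d k)
    {a : Skorokhod T d × IncSkorokhod T k → IncSkorokhod T k} (ha : IsControl P a) :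
    c.expCost (P.map fun ω => (ω.1, a ω)) = c.controlCost P a :=
  lintegral_map (c.measurable_cost measurable_fst measurable_snd) ha.measurable_prodMk

theorem IsControl.mid {a b : Skorokhod T d × IncSkorokhod T k → IncSkorokhod T k}
    (ha : IsControl P a) (hb : IsControl P b) : IsControl P fun ω => (a ω).mid (b ω) := fun t =>
  ((ha t).const_smul (1 / 2 : ℝ)).add ((hb t).const_smul (1 / 2 : ℝ))

theorem CostData.controlCost_mid_le (c : CostData T d k)
    {a b : Skorokhod T d × IncSkorokhod T k → IncSkorokhod T k} (ha : IsControl P a)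
    (hb : IsControl P b) {v : ℝ≥0∞} (hav : c.controlCost P a ≤ v) (hbv : c.controlCost P b ≤ v) :
    c.controlCost P (fun ω => (a ω).mid (b ω)) ≤ v := by
  have hma := c.measurable_cost (L := Prod.fst) measurable_fst ha.measurable
  have hmb := c.measurable_cost (L := Prod.fst) measurable_fst hb.measurable
  calc c.controlCost P (fun ω => (a ω).mid (b ω))
      ≤ ∫⁻ ω, (2⁻¹ * c.cost ω.1 (a ω) + 2⁻¹ * c.cost ω.1 (b ω)) ∂P :=
        lintegral_mono fun ω => c.cost_mid_le _ _ _
    _ = 2⁻¹ * c.controlCost P a + 2⁻¹ * c.controlCost P b := by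
        rw [lintegral_add_left (hma.const_mul _), lintegral_const_mul _ hma,
          lintegral_const_mul _ hmb]; rfl
    _ ≤ 2⁻¹ * v + 2⁻¹ * v := by gcongr
    _ = v := by rw [← add_mul, ENNReal.inv_two_add_inv_two, one_mul]

/-- Coercivity bounds the expected terminal value of controls of bounded cost. -/
theorem CostData.LinearlyCoercive.exists_bound {c : CostData T d k}
    (hc : c.LinearlyCoercive P₀) (hP : Admissible P₀ P) {v : ℝ≥0∞} (hv : v < ∞) :
    ∃ C < ∞, ∀ a, IsControl P a → c.controlCost P a ≤ v → ∫⁻ ω, ‖a ω ⊤‖ₑ ∂P ≤ C := by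
  obtain ⟨κ, K, hκ, hK, h⟩ := hc
  have hκ0 : ENNReal.ofReal κ ≠ 0 := (ENNReal.ofReal_pos.2 hκ).ne'
  refine ⟨max (ENNReal.ofReal K) (v / ENNReal.ofReal κ),
    max_lt ENNReal.ofReal_lt_top (ENNReal.div_lt_top hv.ne hκ0), fun a ha hav => ?_⟩
  have hmap : ∫⁻ ω, ‖ω.2 ⊤‖ₑ ∂(P.map fun ω => (ω.1, a ω)) = ∫⁻ ω, ‖a ω ⊤‖ₑ ∂P :=
    lintegral_map ((IncSkorokhod.measurable_eval ⊤).comp measurable_snd).enorm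
      ha.measurable_prodMk
  have h1 := h _ (ha.admissible_map hP)
  rw [hmap, c.expCost_map ha] at h1
  rcases le_total (ENNReal.ofReal K) (∫⁻ ω, ‖a ω ⊤‖ₑ ∂P) with h2 | h2
  · refine le_max_of_le_right ((ENNReal.le_div_iff_mul_le (Or.inl hκ0)
      (Or.inl ENNReal.ofReal_ne_top)).2 ?_)
    rw [mul_comm]
    exact (h1 h2).trans hav
  · exact le_max_of_le_left h2

theorem exists_countable_dense_of_ae {p : Time T → Prop} (h : ∀ᵐ t ∂leb T, p t) (htop : p ⊤) :
    ∃ D : Set (Time T), D.Countable ∧ Dense D ∧ ⊤ ∈ D ∧ ∀ t ∈ D, p t := by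
  have hd : Dense {t | p t} := Measure.dense_of_ae h
  obtain ⟨D, hDp, hDc, hDd⟩ := hd.exists_countable_dense_subset
  refine ⟨insert ⊤ D, hDc.insert _, hDd.mono (subset_insert _ _), mem_insert _ _, ?_⟩
  rintro t (rfl | ht)
  · exact htop
  · exact hDp ht

/-- The cost is lower semicontinuous along sequences converging at almost every time, when the
convergence holds off a countable set. -/
theorem CostData.cost_le_liminf {c : CostData T d k} (hg : IsC1InControl c.g)
    (hh : IsC1InControl c.h) (L : Skorokhod T d) {a : ℕ → IncSkorokhod T k} {A : IncSkorokhod T k}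
    {N : Set (Time T)} (hN : N.Countable) (htop : ⊤ ∉ N)
    (h : ∀ t ∉ N, ∀ i, Tendsto (fun n => a n t i) atTop (𝓝 (A t i))) :
    c.cost L A ≤ liminf (fun n => c.cost L (a n)) atTop := by
  have hcont : ∀ {φ : E d → E k → ℝ}, IsC1InControl φ → ∀ t ∉ N, ∀ l,
      Tendsto (fun n => ENNReal.ofReal (φ l (a n t))) atTop (𝓝 (ENNReal.ofReal (φ l (A t)))) := by
    intro φ hφ t ht l
    have h1 : Tendsto (fun n => a n t) atTop (𝓝[orthant k] (A t)) :=
      tendsto_nhdsWithin_iff.2 ⟨tendsto_euclidean_iff.2 (h t ht),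
        Eventually.of_forall fun n => (a n).mem_orthant t⟩
    exact (ENNReal.continuous_ofReal.tendsto _).comp
      (((hφ l).continuousOn _ (A.mem_orthant t)).tendsto.comp h1)
  -- A countable set is Lebesgue-null, and sets of full measure are dense, so convergence off `N` is
  -- enough for weak convergence of the measures.
  have hND : Dense Nᶜ := Measure.dense_of_ae (μ := leb T) (hN.ae_notMem _)
  have hf : Tendsto (fun n => ENNReal.ofReal (c.fInt (a n))) atTop
      (𝓝 (ENNReal.ofReal (c.fInt A))) := by
    refine (ENNReal.continuous_ofReal.tendsto _).comp (tendsto_finsetSum _ fun i _ => ?_)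
    exact IncSkorokhod.tendsto_integral_of_tendsto hND htop (fun t ht => h t ht i)
      (c.continuous_f_apply i)
  have hhl : ∫⁻ t, ENNReal.ofReal (c.h (L t) (A t)) ∂leb T ≤
      liminf (fun n => ∫⁻ t, ENNReal.ofReal (c.h (L t) (a n t)) ∂leb T) atTop := by
    refine le_trans (lintegral_mono_ae ?_) (lintegral_liminf_le fun n => ?_)
    · filter_upwards [hN.ae_notMem (leb T)] with t ht
      exact (hcont hh t ht (L t)).liminf_eq.ge
    · exact (measurable_comp_of_mem c.h_measurable L.2.measurable (a n).2.1.measurable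
        fun t => (a n).mem_orthant t).ennreal_ofReal
  simp_rw [c.cost_eq]
  refine le_trans ?_ (ENNReal_liminf_add_le _ _)
  refine add_le_add ?_ (hcont hg ⊤ htop (L ⊤)).liminf_eq.ge
  refine le_trans ?_ (ENNReal_liminf_add_le _ _)
  exact add_le_add hf.liminf_eq.ge hhl

theorem measurable_control_uncurry {a : Skorokhod T d × IncSkorokhod T k → IncSkorokhod T k}
    (ha : IsControl P a) :
    Measurable fun s : Fin k × Time T × (Skorokhod T d × IncSkorokhod T k) =>
      a s.2.2 s.2.1 s.1 := by
  have h1 := measurable_uncurry_incSkorokhod ha.measurable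
  refine measurable_from_prod_countable_right fun i => ?_
  have h2 : Measurable fun p : Time T × (Skorokhod T d × IncSkorokhod T k) => a p.2 p.1 :=
    h1.comp (measurable_snd.prodMk measurable_fst)
  exact measurable_euclidean_iff.1 h2 i

/-- Controls of bounded cost have, after forming convex combinations, a limit. -/
theorem exists_controls_tendsto {c : CostData T d k} (hc : c.LinearlyCoercive P₀)
    (hP : Admissible P₀ P) {v : ℕ → ℝ≥0∞} (hv : Antitone v) (hv0 : v 0 < ∞)
    (hne : ∀ n, ∃ a, IsControl P a ∧ c.controlCost P a ≤ v n) :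
    ∃ a : ℕ → Skorokhod T d × IncSkorokhod T k → IncSkorokhod T k,
      (∀ n, IsControl P (a n)) ∧ (∀ n, c.controlCost P (a n) ≤ v n) ∧
      ∃ D : Set (Time T), D.Countable ∧ Dense D ∧ ⊤ ∈ D ∧
        ∀ t ∈ D, ∀ᵐ ω ∂P, ∀ i, ∃ y, Tendsto (fun n => a n ω t i) atTop (𝓝 y) := by
  have := hP.isProbabilityMeasure
  let κ : Measure (Fin k) := Measure.count
  -- The atom at T forces convergence of the terminal values too. Together with counting measure on
  -- the coordinates, a single application of the selection theorem handles all coordinates and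
  -- almost all times at once.
  let ν : Measure (Time T) := leb T + Measure.dirac ⊤
  let K : ℕ → Set (Fin k × Time T × (Skorokhod T d × IncSkorokhod T k) → ℝ) := fun n =>
    {x | ∃ a, IsControl P a ∧ c.controlCost P a ≤ v n ∧ x = fun s => a s.2.2 s.2.1 s.1}
  obtain ⟨C, hC, hbound⟩ := hc.exists_bound hP hv0
  have hmass : κ univ * (ν univ * C) < ∞ :=
    ENNReal.mul_lt_top (measure_lt_top κ _) (ENNReal.mul_lt_top (measure_lt_top ν _) hC)
  have hex : ∃ X : ℕ → Fin k × Time T × (Skorokhod T d × IncSkorokhod T k) → ℝ,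
      (∀ n, X n ∈ K n) ∧
        ∀ᵐ s ∂(κ.prod (ν.prod P)), ∃ y, Tendsto (fun n => X n s) atTop (𝓝 y) := by
    refine exists_seq_ae_tendsto (C := κ univ * (ν univ * C)) ?_ ?_ ?_ ?_ ?_ hmass ?_
    · rintro m n hmn x ⟨a, ha, hav, rfl⟩
      exact ⟨a, ha, hav.trans (hv hmn), rfl⟩
    · intro n
      obtain ⟨a, ha, hav⟩ := hne n
      exact ⟨_, a, ha, hav, rfl⟩
    · rintro n _ ⟨a, ha, -, rfl⟩
      exact measurable_control_uncurry ha
    · rintro n _ ⟨a, ha, -, rfl⟩ s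
      exact (a _).nonneg _ _
    · rintro n _ ⟨a, ha, hav, rfl⟩ _ ⟨b, hb, hbv, rfl⟩
      refine ⟨_, ha.mid hb, c.controlCost_mid_le ha hb hav hbv, ?_⟩
      ext s
      rw [IncSkorokhod.mid_apply]
      ring
    · rintro n _ ⟨a, ha, hav, rfl⟩
      have hm : Measurable fun ω => ‖a ω ⊤‖ₑ := (ha.measurable_eval ⊤).enorm
      calc ∫⁻ s, ENNReal.ofReal (a s.2.2 s.2.1 s.1) ∂(κ.prod (ν.prod P))
          ≤ ∫⁻ s, ‖a s.2.2 ⊤‖ₑ ∂(κ.prod (ν.prod P)) := by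
            refine lintegral_mono fun s => ?_
            rw [← ofReal_norm]
            exact ENNReal.ofReal_le_ofReal (((a s.2.2).le_top _ _).trans
              ((le_abs_self _).trans (PiLp.norm_apply_le (a s.2.2 ⊤) s.1)))
        _ = κ univ * (ν univ * ∫⁻ ω, ‖a ω ⊤‖ₑ ∂P) := by
            exact lintegral_prod_snd_snd κ ν P hm
        _ ≤ κ univ * (ν univ * C) := by
            gcongr
            exact hbound a ha (hav.trans (hv (Nat.zero_le n)))
  obtain ⟨X, hXK, hX⟩ := hex
  choose a ha hav hXa using hXK
  refine ⟨a, ha, hav, ?_⟩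
  have h1 : ∀ i, ∀ᵐ t ∂ν, ∀ᵐ ω ∂P, ∃ y, Tendsto (fun n => a n ω t i) atTop (𝓝 y) := by
    have h2 := Measure.ae_ae_of_ae_prod hX
    simp only [hXa] at h2
    intro i
    by_contra hcon
    have h3 : κ {i} = 0 := measure_mono_null (fun j hj => by
      rw [mem_singleton_iff.1 hj]
      intro hgood
      exact hcon (Measure.ae_ae_of_ae_prod hgood)) h2
    simp [κ] at h3
  have h4 : ∀ᵐ t ∂ν, ∀ᵐ ω ∂P, ∀ i, ∃ y, Tendsto (fun n => a n ω t i) atTop (𝓝 y) := by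
    filter_upwards [ae_all_iff.2 h1] with t ht
    exact ae_all_iff.2 ht
  rw [ae_add_measure_iff, ae_dirac_eq] at h4
  exact exists_countable_dense_of_ae h4.1 h4.2

/-- A sequence of controls which converges on a countable dense set of times has a limit control. -/
theorem exists_control_of_tendsto [IsProbabilityMeasure P]
    {a : ℕ → Skorokhod T d × IncSkorokhod T k → IncSkorokhod T k} (ha : ∀ n, IsControl P (a n))
    {D : Set (Time T)} (hDc : D.Countable) (hD : Dense D) (htop : ⊤ ∈ D)
    (hlim : ∀ t ∈ D, ∀ᵐ ω ∂P, ∀ i, ∃ y, Tendsto (fun n => a n ω t i) atTop (𝓝 y)) :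
    ∃ A, IsControl P A ∧ ∀ᵐ ω ∂P, ∃ N : Set (Time T), N.Countable ∧ ⊤ ∉ N ∧
      ∀ t ∉ N, ∀ i, Tendsto (fun n => a n ω t i) atTop (𝓝 (A ω t i)) := by
  classical
  obtain ⟨G, hGsub, hGm, hG0⟩ := exists_measurable_superset_of_null ((ae_ball_iff hDc).2 hlim)
  have hG : ∀ ω ∉ G, ∀ t ∈ D, ∀ i, ∃ y, Tendsto (fun n => a n ω t i) atTop (𝓝 y) := by
    intro ω hω
    by_contra h
    exact hω (hGsub h)
  -- The limsup is adapted at every time and equals the limit on `D` off `G`. On the null set `G`,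
  -- which the augmentation contains, the path is set to 0.
  let u : Skorokhod T d × IncSkorokhod T k → Time T → E k := fun ω t =>
    if ω ∈ G then 0 else WithLp.toLp 2 fun i => limsup (fun n => a n ω t i) atTop
  have hu : ∀ ω ∉ G, ∀ t ∈ D, ∀ i, Tendsto (fun n => a n ω t i) atTop (𝓝 (u ω t i)) := by
    intro ω hω t ht i
    obtain ⟨y, hy⟩ := hG ω hω t ht i
    have : u ω t i = y := by simp [u, hω, hy.limsup_eq]
    rwa [this]
  have hmono : ∀ ω i, MonotoneOn (fun t => u ω t i) D := by
    intro ω i s hs t ht hst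
    by_cases hω : ω ∈ G
    · simp [u, hω]
    · exact le_of_tendsto_of_tendsto' (hu ω hω s hs i) (hu ω hω t ht i)
        fun n => (a n ω).2.2.1 i hst
  have h0 : ∀ ω, ∀ t ∈ D, ∀ i, 0 ≤ u ω t i := by
    intro ω t ht i
    by_cases hω : ω ∈ G
    · simp [u, hω]
    · exact ge_of_tendsto' (hu ω hω t ht i) fun n => (a n ω).nonneg t i
  have hum : ∀ t, Measurable[augFiltration P t] fun ω => u ω t := by
    intro t
    refine Measurable.ite (measurableSet_augFiltration_of_null t hGm hG0) measurable_const ?_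
    refine (@measurable_euclidean_iff _ _ (augFiltration P t) _).2 fun i => ?_
    exact Measurable.limsup fun n =>
      (@measurable_euclidean_iff _ _ (augFiltration P t) _).1 (ha n t) i
  let A : Skorokhod T d × IncSkorokhod T k → IncSkorokhod T k := fun ω =>
    incRegularize hD htop (hmono ω) (h0 ω)
  refine ⟨A, measurable_regularize hD htop
    (fun ω => hasSideLimits_of_monotoneOn htop (hmono ω) (h0 ω)) fun q _ => hum q, ?_⟩
  filter_upwards [measure_eq_zero_iff_ae_notMem.1 hG0] with ω hω
  -- Time 0 is excluded because the regularisation takes a right limit there and no earlier time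
  -- bounds it from below. Time T is kept: there the regularisation is the limit itself.
  refine ⟨({⊥} ∪ ⋃ i, {t | ¬ ContinuousAt (fun t => A ω t i) t}) \ {⊤}, ?_, by simp, ?_⟩
  · refine ((countable_singleton _).union (countable_iUnion fun i => ?_)).mono sdiff_subset
    exact ((A ω).2.2.1 i).countable_not_continuousAt
  · intro t ht i
    rcases eq_or_lt_of_le (le_top (a := t)) with rfl | htt
    · have : A ω ⊤ = u ω ⊤ := regularize_top D (u ω)
      rw [this]
      exact hu ω hω ⊤ htop i
    · have ht' : t ∉ ({⊥} ∪ ⋃ i, {t | ¬ ContinuousAt (fun t => A ω t i) t} : Set (Time T)) :=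
        fun h => ht ⟨h, htt.ne⟩
      simp only [mem_union, mem_singleton_iff, mem_iUnion, mem_ofPred_eq, not_or, not_exists,
        not_not] at ht'
      exact tendsto_of_tendsto_dense hD (v := fun n t => a n ω t i) (u := fun t => u ω t i)
        (A := fun t => A ω t i) (fun n => (a n ω).2.2.1 i) (fun q hq => hu ω hω q hq i)
        (fun t q hq hqt => le_regularize_of_le hD htop (hmono ω) (h0 ω) hq hqt i)
        (fun t q hq htq => regularize_le_of_lt hD htop (hmono ω) (h0 ω) hq htq i)
        (bot_lt_iff_ne_bot.2 ht'.1) htt (ht'.2 i)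

/-- An optimal control exists. -/
theorem exists_optimal_control {c : CostData T d k} (hg : IsC1InControl c.g)
    (hh : IsC1InControl c.h) (hc : c.LinearlyCoercive P₀) (hP : Admissible P₀ P)
    (hfin : c.expCost P < ∞) :
    ∃ A, IsControl P A ∧ c.controlCost P A < ∞ ∧
      ∀ b, IsControl P b → c.controlCost P A ≤ c.controlCost P b := by
  have := hP.isProbabilityMeasure
  -- The infimum is over controls on this space only. It is finite because the coordinate process A
  -- is itself a control, with the cost of P.
  let V : ℝ≥0∞ := ⨅ a : {a // IsControl P a}, c.controlCost P a
  have hVle : ∀ b, IsControl P b → V ≤ c.controlCost P b := fun b hb =>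
    iInf_le (fun a : {a // IsControl P a} => c.controlCost P a) ⟨b, hb⟩
  have hV : V < ∞ := (hVle (fun ω => ω.2) isControl_snd).trans_lt hfin
  let v : ℕ → ℝ≥0∞ := fun n => V + ((n + 1 : ℕ) : ℝ≥0∞)⁻¹
  have hv : Antitone v := fun m n hmn => by
    refine add_le_add le_rfl (ENNReal.inv_le_inv.2 ?_)
    exact_mod_cast Nat.succ_le_succ hmn
  have hvlim : Tendsto v atTop (𝓝 V) := by
    have h1 : Tendsto (fun n : ℕ => ((n + 1 : ℕ) : ℝ≥0∞)⁻¹) atTop (𝓝 0) :=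
      ENNReal.tendsto_inv_nat_nhds_zero.comp (tendsto_add_atTop_nat 1)
    have h2 := h1.const_add V
    rw [add_zero] at h2
    exact h2
  have hne : ∀ n, ∃ a, IsControl P a ∧ c.controlCost P a ≤ v n := by
    intro n
    have hlt : V < v n := ENNReal.lt_add_right hV.ne (ENNReal.inv_ne_zero.2 (ENNReal.natCast_ne_top _))
    obtain ⟨a, ha⟩ := iInf_lt_iff.1 hlt
    exact ⟨a.1, a.2, ha.le⟩
  obtain ⟨a, ha, hav, D, hDc, hD, htop, hlim⟩ :=
    exists_controls_tendsto hc hP hv (by simpa [v] using hV) hne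
  obtain ⟨A, hA, hlimA⟩ := exists_control_of_tendsto ha hDc hD htop hlim
  have hAV : c.controlCost P A ≤ V := by
    calc c.controlCost P A ≤ ∫⁻ ω, liminf (fun n => c.cost ω.1 (a n ω)) atTop ∂P := by
          refine lintegral_mono_ae ?_
          filter_upwards [hlimA] with ω ⟨N, hN, hN', hNlim⟩
          exact CostData.cost_le_liminf hg hh ω.1 hN hN' hNlim
      _ ≤ liminf (fun n => c.controlCost P (a n)) atTop :=
          lintegral_liminf_le fun n => c.measurable_cost measurable_fst (ha n).measurable
      _ ≤ liminf v atTop := liminf_le_liminf (Eventually.of_forall hav)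
      _ = V := hvlim.liminf_eq
  exact ⟨A, hA, hAV.trans_lt hV, fun b hb => hAV.trans (hVle b hb)⟩

end Optimal


/-! ### The marginal cost and integration by parts. -/

section Potential

variable {T : ℝ} [hT : Fact (0 < T)] {d k : ℕ}

/-- Dominated convergence: the indicator of `s ≤ t` is continuous in `t` except at `t = s`, and
single times are Lebesgue-null. -/
theorem continuous_integral_Iic {F : Type*} [NormedAddCommGroup F] [NormedSpace ℝ F]
    {ψ : Time T → F} (hψ : Integrable ψ (leb T)) :
    Continuous fun t => ∫ s in Iic t, ψ s ∂leb T := by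
  simp_rw [← integral_indicator measurableSet_Iic]
  refine continuous_iff_continuousAt.2 fun t => ?_
  refine continuousAt_of_dominated (bound := fun s => ‖ψ s‖)
    (Eventually.of_forall fun r => (hψ.1.indicator measurableSet_Iic))
    (Eventually.of_forall fun r => Eventually.of_forall fun s => norm_indicator_le_norm_self _ _)
    hψ.norm ?_
  have hne : ∀ᵐ s ∂leb T, s ≠ t := by
    have : leb T {t} = 0 := measure_singleton t
    exact measure_eq_zero_iff_ae_notMem.1 this
  filter_upwards [hne] with s hs
  rcases hs.lt_or_gt with h | h
  · refine (continuousAt_const (y := ψ s)).congr ?_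
    filter_upwards [lt_mem_nhds h] with r hr
    rw [indicator_of_mem (mem_Iic.2 hr.le)]
  · refine (continuousAt_const (y := (0 : F))).congr ?_
    filter_upwards [gt_mem_nhds h] with r hr
    rw [indicator_of_notMem (notMem_Iic.2 hr)]

theorem integral_Ici_eq_sub {F : Type*} [NormedAddCommGroup F] [NormedSpace ℝ F]
    {ψ : Time T → F} (hψ : Integrable ψ (leb T)) (t : Time T) :
    ∫ s in Ici t, ψ s ∂leb T = ∫ s, ψ s ∂leb T - ∫ s in Iic t, ψ s ∂leb T := by
  rw [eq_sub_iff_add_eq', ← integral_add_compl (measurableSet_Iic (a := t)) hψ, compl_Iic,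
    setIntegral_congr_set Ioi_ae_eq_Ici]

theorem continuous_integral_Ici {F : Type*} [NormedAddCommGroup F] [NormedSpace ℝ F]
    {ψ : Time T → F} (hψ : Integrable ψ (leb T)) :
    Continuous fun t => ∫ s in Ici t, ψ s ∂leb T := by
  simp_rw [integral_Ici_eq_sub hψ]
  exact continuous_const.sub (continuous_integral_Iic hψ)

theorem integral_add_add {X : Type*} [MeasurableSpace X] {ν : Measure X} {u v w : X → ℝ}
    (hu : Integrable u ν) (hv : Integrable v ν) (hw : Integrable w ν) :
    ∫ x, (u x + v x + w x) ∂ν = ∫ x, u x ∂ν + ∫ x, v x ∂ν + ∫ x, w x ∂ν := by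
  rw [integral_add (f := fun x => u x + v x) (hu.add hv) hw, integral_add hu hv]

theorem integral_euclidean_apply {X : Type*} [MeasurableSpace X] {ν : Measure X} {N : ℕ}
    {ψ : X → E N} (hψ : Integrable ψ ν) (i : Fin N) : (∫ x, ψ x ∂ν) i = ∫ x, ψ x i ∂ν :=
  ((EuclideanSpace.proj (𝕜 := ℝ) i).integral_comp_comm hψ).symm

variable (c : CostData T d k)

/-- The gradient of the cost with respect to an additional push at the time `t`. -/
def CostData.marginalCost (L : Skorokhod T d) (A : IncSkorokhod T k) (t : Time T) : E k :=
  c.f t + grad c.g (L ⊤) (A ⊤) + ∫ s in Ici t, grad c.h (L s) (A s) ∂leb T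

variable {c} {L : Skorokhod T d} {A : IncSkorokhod T k}

theorem CostData.continuous_marginalCost
    (hψ : Integrable (fun s => grad c.h (L s) (A s)) (leb T)) :
    Continuous (c.marginalCost L A) :=
  (c.f_continuous.add_const _).add (continuous_integral_Ici hψ)

/-- Pairing the marginal cost with db yields the directional derivative of the cost along b: the
running term by exchanging the order of integration, the terminal term because db has total mass
b_T. -/
theorem CostData.integral_marginalCost
    (hψ : Integrable (fun s => grad c.h (L s) (A s)) (leb T)) (b : IncSkorokhod T k) :
    ∑ i, ∫ t, c.marginalCost L A t i ∂(b.dMeasure i) =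
      c.fInt b + ∫ s, inner ℝ (grad c.h (L s) (A s)) (b s) ∂leb T
        + inner ℝ (grad c.g (L ⊤) (A ⊤)) (b ⊤) := by
  have hψi := fun i => integrable_euclidean_iff.1 hψ i
  have hinner : ∫ s, inner ℝ (grad c.h (L s) (A s)) (b s) ∂leb T =
      ∑ i, ∫ s, grad c.h (L s) (A s) i * b s i ∂leb T := by
    rw [← integral_finsetSum]
    · refine integral_congr_ae (Eventually.of_forall fun s => ?_)
      simp only [PiLp.inner_apply]
      exact Finset.sum_congr rfl fun i _ => by simp [mul_comm]
    · intro i _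
      refine (hψi i).mul_bdd (c := b ⊤ i)
        (measurable_euclidean_iff.1 b.2.1.measurable i).aestronglyMeasurable
        (Eventually.of_forall fun s => ?_)
      rw [Real.norm_of_nonneg (b.nonneg s i)]
      exact b.le_top s i
  have hg : inner ℝ (grad c.g (L ⊤) (A ⊤)) (b ⊤) = ∑ i, grad c.g (L ⊤) (A ⊤) i * b ⊤ i := by
    simp only [PiLp.inner_apply]
    exact Finset.sum_congr rfl fun i _ => by simp [mul_comm]
  rw [hinner, hg, CostData.fInt, ← Finset.sum_add_distrib, ← Finset.sum_add_distrib]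
  refine Finset.sum_congr rfl fun i _ => ?_
  have hcoord : ∀ t, c.marginalCost L A t i =
      c.f t i + grad c.g (L ⊤) (A ⊤) i + ∫ s in Ici t, grad c.h (L s) (A s) i ∂leb T := by
    intro t
    rw [← integral_euclidean_apply hψ.integrableOn]
    rfl
  have hcont : Integrable (fun t => ∫ s in Ici t, grad c.h (L s) (A s) i ∂leb T)
      (b.dMeasure i) :=
    (continuous_integral_Ici (hψi i)).integrable_of_hasCompactSupport
      (HasCompactSupport.of_compactSpace _)
  simp_rw [hcoord]
  refine (integral_add_add (c.integrable_f_apply b i) (integrable_const _) hcont).trans ?_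
  rw [integral_const, b.integral_integral_Ici i (hψi i), b.dMeasure_real_univ, smul_eq_mul]
  ring

end Potential

/-! ### Differentiating the expected cost in bounded directions. -/

section FirstOrder

variable {T : ℝ} [hT : Fact (0 < T)] {d k : ℕ} {Ω : Type*} [MeasurableSpace Ω] {P : Measure Ω}
  [IsProbabilityMeasure P] {c : CostData T d k} {L : Ω → Skorokhod T d} {a : Ω → IncSkorokhod T k}

/-- The cost of a pair `(L,a)` is integrable. -/
structure CostData.FiniteCost (c : CostData T d k) (P : Measure Ω) (L : Ω → Skorokhod T d)
    (a : Ω → IncSkorokhod T k) : Prop where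
  fInt : Integrable (fun ω => c.fInt (a ω)) P
  h : Integrable (fun p : Ω × Time T => c.h (L p.1 p.2) (a p.1 p.2)) (P.prod (leb T))
  g : Integrable (fun ω => c.g (L ω ⊤) (a ω ⊤)) P

theorem integrable_of_lintegral_ofReal_ne_top {X : Type*} [MeasurableSpace X] {ν : Measure X}
    {u : X → ℝ} (hu : Measurable u) (h0 : ∀ x, 0 ≤ u x)
    (h : ∫⁻ x, ENNReal.ofReal (u x) ∂ν ≠ ∞) : Integrable u ν :=
  (lintegral_ofReal_ne_top_iff_integrable hu.aestronglyMeasurable (Eventually.of_forall h0)).1 h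

theorem CostData.lintegral_cost (hL : Measurable L) (ha : Measurable a) :
    ∫⁻ ω, c.cost (L ω) (a ω) ∂P = ∫⁻ ω, ENNReal.ofReal (c.fInt (a ω)) ∂P
      + ∫⁻ p : Ω × Time T, ENNReal.ofReal (c.h (L p.1 p.2) (a p.1 p.2)) ∂P.prod (leb T)
      + ∫⁻ ω, ENNReal.ofReal (c.g (L ω ⊤) (a ω ⊤)) ∂P := by
  simp_rw [c.cost_eq]
  have hh := (c.measurable_h_uncurry hL ha).ennreal_ofReal
  rw [lintegral_add_right _ (c.measurable_g_top hL ha).ennreal_ofReal,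
    lintegral_add_left (c.measurable_fInt ha).ennreal_ofReal, lintegral_prod _ hh.aemeasurable]

theorem CostData.finiteCost (hL : Measurable L) (ha : Measurable a)
    (hfin : ∫⁻ ω, c.cost (L ω) (a ω) ∂P < ∞) : c.FiniteCost P L a := by
  rw [c.lintegral_cost hL ha, ENNReal.add_lt_top, ENNReal.add_lt_top] at hfin
  exact ⟨integrable_of_lintegral_ofReal_ne_top (c.measurable_fInt ha)
      (fun ω => c.fInt_nonneg _) hfin.1.1.ne,
    integrable_of_lintegral_ofReal_ne_top (c.measurable_h_uncurry hL ha)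
      (fun p => c.h_nonneg _ _ ((a p.1).mem_orthant _)) hfin.1.2.ne,
    integrable_of_lintegral_ofReal_ne_top (c.measurable_g_top hL ha)
      (fun ω => c.g_nonneg _ _ ((a ω).mem_orthant _)) hfin.2.ne⟩

theorem CostData.FiniteCost.lintegral_cost (hL : Measurable L) (ha : Measurable a)
    (h : c.FiniteCost P L a) :
    ∫⁻ ω, c.cost (L ω) (a ω) ∂P = ENNReal.ofReal (∫ ω, c.fInt (a ω) ∂P
      + ∫ p : Ω × Time T, c.h (L p.1 p.2) (a p.1 p.2) ∂P.prod (leb T)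
      + ∫ ω, c.g (L ω ⊤) (a ω ⊤) ∂P) := by
  have h1 : 0 ≤ᵐ[P] fun ω => c.fInt (a ω) := Eventually.of_forall fun ω => c.fInt_nonneg _
  have h2 : 0 ≤ᵐ[P.prod (leb T)] fun p : Ω × Time T => c.h (L p.1 p.2) (a p.1 p.2) :=
    Eventually.of_forall fun p => c.h_nonneg _ _ ((a p.1).mem_orthant _)
  have h3 : 0 ≤ᵐ[P] fun ω => c.g (L ω ⊤) (a ω ⊤) :=
    Eventually.of_forall fun ω => c.g_nonneg _ _ ((a ω).mem_orthant _)
  rw [c.lintegral_cost hL ha,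
    ENNReal.ofReal_add (add_nonneg (integral_nonneg_of_ae h1) (integral_nonneg_of_ae h2))
      (integral_nonneg_of_ae h3),
    ENNReal.ofReal_add (integral_nonneg_of_ae h1) (integral_nonneg_of_ae h2),
    ofReal_integral_eq_lintegral_ofReal h.fInt h1, ofReal_integral_eq_lintegral_ofReal h.h h2,
    ofReal_integral_eq_lintegral_ofReal h.g h3]

/-- The integrated form of the gradient growth condition. -/
structure CostData.IntegrableGrowth (c : CostData T d k) (P : Measure Ω)
    (L : Ω → Skorokhod T d) (Φg Φh : E d → ℝ≥0) (M : ℝ≥0) : Prop where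
  integrable_g : Integrable (fun ω => (Φg (L ω ⊤) : ℝ)) P
  integrable_h : Integrable (fun p : Ω × Time T => (Φh (L p.1 p.2) : ℝ)) (P.prod (leb T))
  g_le : ∀ l, ∀ a ∈ orthant k, ‖grad c.g l a‖ ≤ Φg l + M * c.g l a
  h_le : ∀ l, ∀ a ∈ orthant k, ‖grad c.h l a‖ ≤ Φh l + M * c.h l a

variable {Φg Φh : E d → ℝ≥0} {M : ℝ≥0} {A b : Ω → IncSkorokhod T k}

/-- The function f is bounded, and the mass of each component of db is its terminal value, at most
R. -/
theorem CostData.exists_abs_fInt_le (c : CostData T d k) (R : ℝ) :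
    ∃ C, ∀ b : IncSkorokhod T k, (∀ t, ‖b t‖ ≤ R) → ‖c.fInt b‖ ≤ C := by
  obtain ⟨K, hK⟩ := (Continuous.isCadlag c.f_continuous).exists_norm_le
  refine ⟨∑ _i : Fin k, K * R, fun b hb => ?_⟩
  have hK0 : 0 ≤ K := (norm_nonneg _).trans (hK ⊥)
  refine (norm_sum_le _ _).trans (Finset.sum_le_sum fun i _ => ?_)
  refine (norm_integral_le_of_norm_le_const (Eventually.of_forall fun t =>
    (PiLp.norm_apply_le (c.f t) i).trans (hK t))).trans ?_
  rw [b.dMeasure_real_univ]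
  exact mul_le_mul_of_nonneg_left ((le_abs_self _).trans
    ((PiLp.norm_apply_le (b ⊤) i).trans (hb ⊤))) hK0

theorem CostData.FiniteCost.integrable_grad_h (hfin : c.FiniteCost P L A)
    (hh : IsC1InControl c.h) (hΦ : c.IntegrableGrowth P L Φg Φh M) (hL : Measurable L)
    (hA : Measurable A) :
    Integrable (fun p : Ω × Time T => grad c.h (L p.1 p.2) (A p.1 p.2)) (P.prod (leb T)) :=
  integrable_grad hh hΦ.h_le c.h_measurable (measurable_uncurry_skorokhod hL)
    (measurable_uncurry_incSkorokhod hA) (fun p => (A p.1).mem_orthant _) hΦ.integrable_h hfin.h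

theorem CostData.FiniteCost.integrable_grad_g (hfin : c.FiniteCost P L A)
    (hg : IsC1InControl c.g) (hΦ : c.IntegrableGrowth P L Φg Φh M) (hL : Measurable L)
    (hA : Measurable A) : Integrable (fun ω => grad c.g (L ω ⊤) (A ω ⊤)) P :=
  integrable_grad hg hΦ.g_le c.g_measurable (Skorokhod.measurable_iff.1 hL ⊤)
    (IncSkorokhod.measurable_iff.1 hA ⊤) (fun ω => (A ω).mem_orthant _) hΦ.integrable_g hfin.g

theorem integrable_inner_of_norm_le {X : Type*} [MeasurableSpace X] {ν : Measure X} {N : ℕ}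
    {u v : X → E N} {R : ℝ} (hu : Integrable u ν) (hv : Measurable v) (hR : ∀ x, ‖v x‖ ≤ R) :
    Integrable (fun x => inner ℝ (u x) (v x)) ν := by
  refine Integrable.mono' (hu.norm.mul_const R) (hu.1.inner hv.aestronglyMeasurable)
    (Eventually.of_forall fun x => ?_)
  exact (norm_inner_le_norm _ _).trans (mul_le_mul_of_nonneg_left (hR x) (norm_nonneg _))

/-- The derivative of the cost in a bounded direction, in terms of the marginal cost. -/
theorem CostData.FiniteCost.integral_marginalCost (hfin : c.FiniteCost P L A)
    (hg : IsC1InControl c.g) (hh : IsC1InControl c.h) (hΦ : c.IntegrableGrowth P L Φg Φh M)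
    (hL : Measurable L) (hA : Measurable A) (hb : Measurable b) {R : ℝ}
    (hbR : ∀ ω t, ‖b ω t‖ ≤ R) :
    Integrable (fun ω => ∑ i, ∫ t, c.marginalCost (L ω) (A ω) t i ∂((b ω).dMeasure i)) P ∧
    ∫ ω, ∑ i, ∫ t, c.marginalCost (L ω) (A ω) t i ∂((b ω).dMeasure i) ∂P =
      ∫ ω, c.fInt (b ω) ∂P
        + ∫ p : Ω × Time T, inner ℝ (grad c.h (L p.1 p.2) (A p.1 p.2)) (b p.1 p.2) ∂P.prod (leb T)
        + ∫ ω, inner ℝ (grad c.g (L ω ⊤) (A ω ⊤)) (b ω ⊤) ∂P := by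
  have hgh := hfin.integrable_grad_h hh hΦ hL hA
  have hI1 : Integrable (fun ω => c.fInt (b ω)) P := by
    obtain ⟨C, hC⟩ := c.exists_abs_fInt_le R
    exact Integrable.of_bound (c.measurable_fInt hb).aestronglyMeasurable C
      (Eventually.of_forall fun ω => hC _ (hbR ω))
  have hI2 := integrable_inner_of_norm_le hgh (measurable_uncurry_incSkorokhod hb)
    fun p => hbR p.1 p.2
  have hI3 := integrable_inner_of_norm_le (hfin.integrable_grad_g hg hΦ hL hA)
    (IncSkorokhod.measurable_iff.1 hb ⊤) fun ω => hbR ω ⊤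
  have heq : (fun ω => ∑ i, ∫ t, c.marginalCost (L ω) (A ω) t i ∂((b ω).dMeasure i)) =ᵐ[P]
      fun ω => c.fInt (b ω) + ∫ s, inner ℝ (grad c.h (L ω s) (A ω s)) (b ω s) ∂leb T
        + inner ℝ (grad c.g (L ω ⊤) (A ω ⊤)) (b ω ⊤) := by
    filter_upwards [hgh.prod_right_ae] with ω hω
    exact CostData.integral_marginalCost hω (b ω)
  refine ⟨((hI1.add hI2.integral_prod_left).add hI3).congr heq.symm, ?_⟩
  rw [integral_congr_ae heq, integral_prod _ hI2]
  exact integral_add_add hI1 hI2.integral_prod_left hI3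

/-- The first-order condition at a minimum, in a direction `± b`. -/
theorem CostData.FiniteCost.first_order (hfin : c.FiniteCost P L A)
    (hg : IsC1InControl c.g) (hh : IsC1InControl c.h) (hΦ : c.IntegrableGrowth P L Φg Φh M)
    (hL : Measurable L) (hA : Measurable A) (hb : Measurable b) {R : ℝ} (hR : 0 ≤ R)
    (hbR : ∀ ω t, ‖b ω t‖ ≤ R) {σ : ℝ} (a : ℝ → Ω → IncSkorokhod T k)
    (ha : ∀ ε, 0 ≤ ε → ε ≤ 1 → Measurable (a ε))
    (hab : ∀ ε, 0 ≤ ε → ε ≤ 1 → ∀ ω t, a ε ω t = A ω t + ε • (σ • b ω t))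
    (haf : ∀ ε, 0 ≤ ε → ε ≤ 1 → ∀ ω, c.fInt (a ε ω) = c.fInt (A ω) + ε * (σ * c.fInt (b ω)))
    (hopt : ∀ ε, 0 ≤ ε → ε ≤ 1 →
      ∫⁻ ω, c.cost (L ω) (A ω) ∂P ≤ ∫⁻ ω, c.cost (L ω) (a ε ω) ∂P) :
    0 ≤ σ * ∫ ω, ∑ i, ∫ t, c.marginalCost (L ω) (A ω) t i ∂((b ω).dMeasure i) ∂P := by
  rw [(hfin.integral_marginalCost hg hh hΦ hL hA hb hbR).2]
  have hI1 : Integrable (fun ω => c.fInt (b ω)) P := by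
    obtain ⟨C, hC⟩ := c.exists_abs_fInt_le R
    exact Integrable.of_bound (c.measurable_fInt hb).aestronglyMeasurable C
      (Eventually.of_forall fun ω => hC _ (hbR ω))
  have hbRσ : ∀ ω t, ‖σ • b ω t‖ ≤ |σ| * R := fun ω t => by
    rw [norm_smul, Real.norm_eq_abs]
    exact mul_le_mul_of_nonneg_left (hbR ω t) (abs_nonneg _)
  have hR' : 0 ≤ |σ| * R := mul_nonneg (abs_nonneg _) hR
  have hmem : ∀ ε : ℝ, 0 ≤ ε → ε ≤ 1 → ∀ ω t, A ω t + ε • (σ • b ω t) ∈ orthant k :=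
    fun ε h0 h1 ω t => hab ε h0 h1 ω t ▸ (a ε ω).mem_orthant t
  obtain ⟨hh1, hh2⟩ := tendsto_slope_integral hh c.h_convex c.h_nonneg hΦ.h_le c.h_measurable
    (l := fun p : Ω × Time T => L p.1 p.2) (x := fun p => A p.1 p.2)
    (y := fun p => σ • b p.1 p.2) hR' (measurable_uncurry_skorokhod hL)
    (measurable_uncurry_incSkorokhod hA) ((measurable_uncurry_incSkorokhod hb).const_smul σ)
    (fun p => (A p.1).mem_orthant _) (fun ε h0 h1 p => hmem ε h0 h1 _ _) (fun p => hbRσ _ _)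
    hΦ.integrable_h hfin.h
  obtain ⟨hg1, hg2⟩ := tendsto_slope_integral hg c.g_convex c.g_nonneg hΦ.g_le c.g_measurable
    (l := fun ω => L ω ⊤) (x := fun ω => A ω ⊤) (y := fun ω => σ • b ω ⊤) hR'
    (Skorokhod.measurable_iff.1 hL ⊤) (IncSkorokhod.measurable_iff.1 hA ⊤)
    ((IncSkorokhod.measurable_iff.1 hb ⊤).const_smul σ)
    (fun ω => (A ω).mem_orthant _) (fun ε h0 h1 ω => hmem ε h0 h1 _ _) (fun ω => hbRσ _ _)
    hΦ.integrable_g hfin.g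
  simp only [inner_smul_right, integral_const_mul] at hh2 hg2
  rw [mul_add, mul_add]
  -- The f-part is exactly linear in ε, so its slope is constant; the other two slopes converge. By
  -- optimality their sum is nonnegative for small ε.
  refine ge_of_tendsto ((hh2.const_add (σ * ∫ ω, c.fInt (b ω) ∂P)).add hg2) ?_
  filter_upwards [hh1, hg1, Ioo_mem_nhdsGT (one_pos (α := ℝ))] with ε h1 h2 hε
  have hab' := hab ε hε.1.le hε.2.le
  have haf' := haf ε hε.1.le hε.2.le
  have hfina : c.FiniteCost P L (a ε) :=
    ⟨by
      simp only [haf']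
      exact hfin.fInt.add ((hI1.const_mul σ).const_mul ε),
      by simpa only [hab'] using h1, by simpa only [hab'] using h2⟩
  have hle := hopt ε hε.1.le hε.2.le
  rw [hfin.lintegral_cost hL hA, hfina.lintegral_cost hL (ha ε hε.1.le hε.2.le)] at hle
  have hnn : 0 ≤ ∫ ω, c.fInt (a ε ω) ∂P
      + ∫ p : Ω × Time T, c.h (L p.1 p.2) (a ε p.1 p.2) ∂P.prod (leb T)
      + ∫ ω, c.g (L ω ⊤) (a ε ω ⊤) ∂P :=
    add_nonneg (add_nonneg (integral_nonneg fun ω => c.fInt_nonneg _)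
      (integral_nonneg fun p => c.h_nonneg _ _ ((a ε p.1).mem_orthant _)))
      (integral_nonneg fun ω => c.g_nonneg _ _ ((a ε ω).mem_orthant _))
  have hle' := (ENNReal.ofReal_le_ofReal_iff hnn).1 hle
  simp only [hab', haf'] at hle'
  rw [integral_add hfin.fInt ((hI1.const_mul σ).const_mul ε), integral_const_mul,
    integral_const_mul] at hle'
  rw [add_assoc, ← add_div, ← sub_le_iff_le_add', zero_sub, le_div_iff₀ hε.1]
  linarith

end FirstOrder


/-! ### Admissible perturbations of the optimal control. -/

section Directions

variable {T : ℝ} [hT : Fact (0 < T)] {d k : ℕ}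

theorem norm_le_of_apply_le {N : ℕ} {x : E N} {r : ℝ} (h : ∀ i, |x i| ≤ r) :
    ‖x‖ ≤ N * r := by
  have h1 : ‖x‖ ≤ ∑ i, |x i| := by
    rw [EuclideanSpace.norm_eq]
    refine Real.sqrt_le_iff.2 ⟨Finset.sum_nonneg fun i _ => abs_nonneg _, ?_⟩
    exact Finset.sum_sq_le_sq_sum_of_nonneg fun i _ => abs_nonneg _
  refine h1.trans ((Finset.sum_le_sum fun i _ => h i).trans ?_)
  simp

/-- The path `A + r b`, where `r` is replaced by `0` if it is negative. -/
def IncSkorokhod.addSmul (A b : IncSkorokhod T k) (r : ℝ) : IncSkorokhod T k :=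
  ⟨fun t => A t + max r 0 • b t,
    A.2.1.map₂ b.2.1 (F := fun p => p.1 + max r 0 • p.2) (by fun_prop),
    fun i s t hst => add_le_add (A.2.2.1 i hst)
      (mul_le_mul_of_nonneg_left (b.2.2.1 i hst) (le_max_right _ _)),
    fun i => add_nonneg (A.nonneg ⊥ i) (mul_nonneg (le_max_right _ _) (b.nonneg ⊥ i))⟩

theorem IncSkorokhod.addSmul_apply (A b : IncSkorokhod T k) {r : ℝ} (hr : 0 ≤ r) (t : Time T) :
    A.addSmul b r t = A t + r • b t := by
  change A t + max r 0 • b t = _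
  rw [max_eq_left hr]

/-- The componentwise minimum of a nondecreasing path and a constant. -/
def IncSkorokhod.trunc (A : IncSkorokhod T k) (n : ℕ) : IncSkorokhod T k :=
  ⟨fun t => WithLp.toLp 2 fun i => min (A t i) n,
    A.2.1.map (F := fun a => WithLp.toLp 2 fun i => min (a i) (n : ℝ)) (by fun_prop),
    fun i _ _ hst => min_le_min_right _ (A.2.2.1 i hst),
    fun i => le_min (A.nonneg ⊥ i) n.cast_nonneg⟩

theorem IncSkorokhod.trunc_apply (A : IncSkorokhod T k) (n : ℕ) (t : Time T) (i : Fin k) :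
    A.trunc n t i = min (A t i) n := rfl

theorem IncSkorokhod.norm_trunc_le (A : IncSkorokhod T k) (n : ℕ) (t : Time T) :
    ‖A.trunc n t‖ ≤ k * n :=
  norm_le_of_apply_le fun i => by
    rw [abs_of_nonneg ((A.trunc n).nonneg t i)]
    exact min_le_right _ _

/-- The path `A - r min(A,n)`, where `r` is projected onto `[0,1]`. -/
def IncSkorokhod.subTrunc (A : IncSkorokhod T k) (n : ℕ) (r : ℝ) : IncSkorokhod T k :=
  ⟨fun t => A t - max 0 (min 1 r) • A.trunc n t,
    A.2.1.map₂ (A.trunc n).2.1 (F := fun p => p.1 - max 0 (min 1 r) • p.2) (by fun_prop),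
    -- Truncation is nondecreasing and its increments do not exceed those of A, so subtracting a
    -- fraction in `[0,1]` of it leaves a nondecreasing path.
    fun i s t hst => by
      have h1 := A.2.2.1 i hst
      have h2 : min (A t i) n - min (A s i) n ≤ A t i - A s i := by
        rcases min_cases (A t i) n with h | h <;> rcases min_cases (A s i) n with h' | h' <;>
          simp only [] at h1 <;> linarith
      have h3 : min (A s i) n ≤ min (A t i) n := min_le_min_right _ h1
      have h4 : max 0 (min 1 r) ≤ 1 := max_le zero_le_one (min_le_left _ _)
      have h5 : 0 ≤ max 0 (min 1 r) := le_max_left _ _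
      change A s i - max 0 (min 1 r) * min (A s i) n ≤ A t i - max 0 (min 1 r) * min (A t i) n
      nlinarith,
    fun i => by
      have h4 : max 0 (min 1 r) ≤ 1 := max_le zero_le_one (min_le_left _ _)
      have h5 : 0 ≤ max 0 (min 1 r) := le_max_left _ _
      have h6 : min (A ⊥ i) n ≤ A ⊥ i := min_le_left _ _
      have h7 := (A.trunc n).nonneg ⊥ i
      rw [IncSkorokhod.trunc_apply] at h7
      change 0 ≤ A ⊥ i - max 0 (min 1 r) * min (A ⊥ i) n
      nlinarith⟩

theorem IncSkorokhod.subTrunc_apply (A : IncSkorokhod T k) (n : ℕ) {r : ℝ} (h0 : 0 ≤ r)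
    (h1 : r ≤ 1) (t : Time T) : A.subTrunc n r t = A t - r • A.trunc n t := by
  change A t - max 0 (min 1 r) • A.trunc n t = _
  rw [min_eq_right h1, max_eq_right h0]

/-- The path which jumps from `0` to `r eᵢ` at the time `t`. -/
def IncSkorokhod.jump (t : Time T) (r : ℝ≥0) (i : Fin k) : IncSkorokhod T k :=
  ⟨fun s => if t ≤ s then EuclideanSpace.single i (r : ℝ) else 0, by
    intro s
    rcases lt_or_ge s t with hst | hst
    · have hev : ∀ᶠ u in 𝓝 s, (0 : E k) =
          if t ≤ u then EuclideanSpace.single i (r : ℝ) else 0 := by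
        filter_upwards [gt_mem_nhds hst] with u hu
        rw [if_neg hu.not_ge]
      refine ⟨((continuousAt_const).congr hev).continuousWithinAt, 0, ?_⟩
      exact (tendsto_const_nhds.congr' hev).mono_left nhdsWithin_le_nhds
    · refine ⟨?_, ?_⟩
      · refine (continuousWithinAt_const (b := EuclideanSpace.single i (r : ℝ))).congr
          (fun u hu => if_pos (hst.trans hu)) (if_pos hst)
      · rcases hst.eq_or_lt with rfl | hlt
        · refine ⟨0, tendsto_const_nhds.congr' ?_⟩
          filter_upwards [self_mem_nhdsWithin] with u hu
          rw [if_neg (not_le.2 hu)]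
        · refine ⟨EuclideanSpace.single i (r : ℝ),
            (tendsto_const_nhds.congr' ?_).mono_left nhdsWithin_le_nhds⟩
          filter_upwards [lt_mem_nhds hlt] with u hu
          rw [if_pos (le_of_lt hu)],
    fun j s u hsu => by
      have h0 : (0 : ℝ) ≤ EuclideanSpace.single i (r : ℝ) j := by
        rw [PiLp.single_apply]
        split_ifs <;> simp
      change (if t ≤ s then EuclideanSpace.single i (r : ℝ) else 0 : E k) j ≤
        (if t ≤ u then EuclideanSpace.single i (r : ℝ) else 0 : E k) j
      split_ifs with h1 h2
      · rfl
      · exact absurd (h1.trans hsu) h2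
      · exact h0
      · rfl,
    fun j => by
      change 0 ≤ (if t ≤ ⊥ then EuclideanSpace.single i (r : ℝ) else 0 : E k) j
      split_ifs
      · rw [PiLp.single_apply]
        split_ifs <;> simp
      · simp⟩

theorem IncSkorokhod.jump_apply (t : Time T) (r : ℝ≥0) (i : Fin k) (s : Time T) :
    jump t r i s = if t ≤ s then EuclideanSpace.single i (r : ℝ) else 0 := rfl

theorem IncSkorokhod.norm_jump_le (t : Time T) (r : ℝ≥0) (i : Fin k) (s : Time T) :
    ‖jump t r i s‖ ≤ r := by
  rw [jump_apply]
  split_ifs <;> simp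

theorem IncSkorokhod.dMeasure_jump (t : Time T) (r : ℝ≥0) (i j : Fin k) :
    (jump t r i).dMeasure j = (if j = i then (r : ℝ≥0∞) else 0) • Measure.dirac t := by
  refine Measure.ext_of_Iic _ _ fun s => ?_
  rw [dMeasure_Iic, jump_apply, Measure.smul_apply, Measure.dirac_apply' _ measurableSet_Iic]
  by_cases h : t ≤ s <;> by_cases hj : j = i <;> simp [h, hj, PiLp.single_apply]

theorem IncSkorokhod.sum_integral_jump (t : Time T) (r : ℝ≥0) (i : Fin k) (y : Time T → E k) :
    ∑ j, ∫ s, y s j ∂((jump t r i).dMeasure j) = r * y t i := by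
  simp_rw [dMeasure_jump]
  rw [Finset.sum_eq_single i (fun j _ hj => by simp [hj]) (fun h => absurd (Finset.mem_univ i) h)]
  rw [if_pos rfl, integral_smul_measure, integral_dirac]
  simp

variable {P : Measure (Skorokhod T d × IncSkorokhod T k)}
  {A b : Skorokhod T d × IncSkorokhod T k → IncSkorokhod T k}

theorem IsControl.addSmul (hA : IsControl P A) (hb : IsControl P b) (r : ℝ) :
    IsControl P fun ω => (A ω).addSmul (b ω) r := fun t =>
  (hA t).add ((hb t).const_smul (max r 0))

theorem IsControl.trunc (hA : IsControl P A) (n : ℕ) : IsControl P fun ω => (A ω).trunc n :=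
  fun t => (@measurable_euclidean_iff _ _ (augFiltration P t) _).2 fun i =>
    ((@measurable_euclidean_iff _ _ (augFiltration P t) _).1 (hA t) i).min measurable_const

theorem IsControl.subTrunc (hA : IsControl P A) (n : ℕ) (r : ℝ) :
    IsControl P fun ω => (A ω).subTrunc n r := fun t =>
  (hA t).sub ((hA.trunc n t).const_smul (max 0 (min 1 r)))

/-- Before `t` the path is 0 on every scenario; from `t` on, the event `G` is known. -/
theorem isControl_jump {t : Time T} {G : Set (Skorokhod T d × IncSkorokhod T k)}
    (hG : MeasurableSet[augFiltration P t] G) (i : Fin k) :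
    IsControl P fun ω => IncSkorokhod.jump t (G.indicator (fun _ => 1) ω) i := by
  intro s
  simp_rw [IncSkorokhod.jump_apply]
  by_cases hts : t ≤ s
  · simp only [hts, if_true]
    have hGs := (augFiltration P).mono hts G hG
    refine (@measurable_euclidean_iff _ _ (augFiltration P s) _).2 fun j => ?_
    by_cases hj : j = i
    · simp only [PiLp.single_apply, hj, if_true]
      exact (measurable_const.indicator hGs).coe_nnreal_real
    · simp only [PiLp.single_apply, hj, if_false]
      exact measurable_const
  · simp only [hts, if_false]
    exact measurable_const

variable [IsProbabilityMeasure P] {c : CostData T d k} {Φg Φh : E d → ℝ≥0} {M : ℝ≥0}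

/-- The marginal cost of an additional push is nonnegative at an optimum. -/
theorem setIntegral_marginalCost_nonneg (hg : IsC1InControl c.g) (hh : IsC1InControl c.h)
    (hΦ : c.IntegrableGrowth P Prod.fst Φg Φh M) (hA : IsControl P A)
    (hfin : c.controlCost P A < ∞)
    (hopt : ∀ b, IsControl P b → c.controlCost P A ≤ c.controlCost P b) {t : Time T}
    {G : Set (Skorokhod T d × IncSkorokhod T k)} (hG : MeasurableSet[augFiltration P t] G)
    (i : Fin k) : 0 ≤ ∫ ω in G, c.marginalCost ω.1 (A ω) t i ∂P := by
  have hb := isControl_jump (P := P) hG i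
  have hf := c.finiteCost measurable_fst hA.measurable hfin
  have h := hf.first_order hg hh hΦ measurable_fst hA.measurable hb.measurable
    (R := 1) zero_le_one (fun ω s => (IncSkorokhod.norm_jump_le _ _ _ _).trans (by
      by_cases h : ω ∈ G <;> simp [h])) (σ := 1)
    (fun ε ω => (A ω).addSmul (IncSkorokhod.jump t (G.indicator (fun _ => 1) ω) i) ε)
    (fun ε _ _ => (hA.addSmul hb ε).measurable)
    (fun ε h0 _ ω s => by rw [IncSkorokhod.addSmul_apply _ _ h0, one_smul])
    (fun ε h0 _ ω => by
      rw [c.fInt_linear (A := A ω) zero_le_one h0 fun s j => ?_, one_mul, one_mul]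
      rw [IncSkorokhod.addSmul_apply _ _ h0, one_mul]
      rfl)
    (fun ε _ _ => hopt _ (hA.addSmul hb ε))
  simp_rw [IncSkorokhod.sum_integral_jump] at h
  rw [one_mul] at h
  rw [← integral_indicator ((augFiltration P).le t G hG)]
  refine h.trans_eq (integral_congr_ae (Eventually.of_forall fun ω => ?_))
  by_cases hω : ω ∈ G <;> simp [hω]

/-- At an optimum, the marginal cost integrates to at most zero along the optimal path. -/
theorem integral_marginalCost_trunc_nonpos (hg : IsC1InControl c.g) (hh : IsC1InControl c.h)
    (hΦ : c.IntegrableGrowth P Prod.fst Φg Φh M) (hA : IsControl P A)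
    (hfin : c.controlCost P A < ∞)
    (hopt : ∀ b, IsControl P b → c.controlCost P A ≤ c.controlCost P b) (n : ℕ) :
    ∫ ω, ∑ i, ∫ t, c.marginalCost ω.1 (A ω) t i ∂(((A ω).trunc n).dMeasure i) ∂P ≤ 0 := by
  have hb := hA.trunc n
  have hf := c.finiteCost measurable_fst hA.measurable hfin
  have h := hf.first_order hg hh hΦ measurable_fst hA.measurable hb.measurable
    -- Reducing the control is possible only in proportion to A, and the truncation makes the
    -- direction bounded. This one-sided inequality suffices, as the reverse one comes from Y ≥ 0.
    (R := k * n) (by positivity) (fun ω s => IncSkorokhod.norm_trunc_le _ _ _) (σ := -1)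
    (fun ε ω => (A ω).subTrunc n ε) (fun ε _ _ => (hA.subTrunc n ε).measurable)
    (fun ε h0 h1 ω s => by rw [IncSkorokhod.subTrunc_apply _ _ h0 h1]; module)
    (fun ε h0 h1 ω => by
      -- Linearity holds for nonnegative coefficients only, so A is written as the reduced path plus
      -- ε times the truncation.
      have h2 := c.fInt_linear (C := A ω) (A := (A ω).subTrunc n ε) (B := (A ω).trunc n)
        zero_le_one h0 fun s j => by
          rw [IncSkorokhod.subTrunc_apply _ _ h0 h1, PiLp.sub_apply, PiLp.smul_apply, smul_eq_mul]
          ring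
      rw [h2]
      ring)
    (fun ε _ _ => hopt _ (hA.subTrunc n ε))
  linarith

end Directions


/-! ### The dual process: construction, positivity and complementary slackness. -/

section Dual

variable {T : ℝ} [hT : Fact (0 < T)] {d k : ℕ}

/-- Freezing the paths at time `t` does not change an integral over `[0,t]`, and the frozen paths
are jointly measurable for the information at `t`. -/
theorem measurable_setIntegral_Iic_grad {Ω : Type*} [MeasurableSpace Ω] {φ : E d → E k → ℝ}
    (hφ : IsC1InControl φ) (hm : Measurable fun p : E d × orthant k => φ p.1 p.2)
    {x : Ω → Time T → E d} {a : Ω → Time T → E k} (hx : ∀ ω, IsCadlag (x ω))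
    (ha : ∀ ω, IsCadlag (a ω)) (hmem : ∀ ω t, a ω t ∈ orthant k) {t : Time T}
    (hxm : ∀ s ≤ t, Measurable fun ω => x ω s) (ham : ∀ s ≤ t, Measurable fun ω => a ω s) :
    Measurable fun ω => ∫ s in Iic t, grad φ (x ω s) (a ω s) ∂leb T := by
  have h1 : ∀ ω, ∫ s in Iic t, grad φ (x ω s) (a ω s) ∂leb T =
      ∫ s in Iic t, grad φ (x ω (min s t)) (a ω (min s t)) ∂leb T := fun ω =>
    setIntegral_congr_fun measurableSet_Iic fun s hs => by
      simp only [min_eq_left (mem_Iic.1 hs)]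
  simp_rw [h1]
  exact ((measurable_grad_comp_of_mem hφ hm (measurable_uncurry_min_of_isCadlag hx hxm)
    (measurable_uncurry_min_of_isCadlag ha ham)
    fun p => hmem _ _).stronglyMeasurable.integral_prod_right').measurable

variable {P : Measure (Skorokhod T d × IncSkorokhod T k)} [IsProbabilityMeasure P]
  {A : Skorokhod T d × IncSkorokhod T k → IncSkorokhod T k} {c : CostData T d k}

theorem IsControl.measurable_setIntegral_Iic_grad (hA : IsControl P A) (hh : IsC1InControl c.h)
    (t : Time T) :
    Measurable[augFiltration P t] fun ω => ∫ s in Iic t, grad c.h (ω.1 s) (A ω s) ∂leb T :=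
  @MonotoneFollower.measurable_setIntegral_Iic_grad T hT d k _ (augFiltration P t) _ hh
    c.h_measurable (fun ω => ω.1) (fun ω => A ω) (fun ω => ω.1.2) (fun ω => (A ω).2.1)
    (fun ω => (A ω).mem_orthant) t
    (fun s hs => (measurable_fst_eval_augFiltration s).mono ((augFiltration P).mono hs) le_rfl)
    (fun s hs => (hA s).mono ((augFiltration P).mono hs) le_rfl)

theorem IsControl.measurable_terminal_grad (hA : IsControl P A) (hg : IsC1InControl c.g) :
    Measurable[augFiltration P ⊤] fun ω => grad c.g (ω.1 ⊤) (A ω ⊤) :=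
  @measurable_grad_comp_of_mem d k c.g _ (augFiltration P ⊤) hg
    c.g_measurable (fun ω => ω.1 ⊤) (fun ω => A ω ⊤) (measurable_fst_eval_augFiltration ⊤) (hA ⊤)
    fun ω => (A ω).mem_orthant ⊤

theorem integrable_setIntegral_prod {Ω F : Type*} [MeasurableSpace Ω] [NormedAddCommGroup F]
    [NormedSpace ℝ F] {P : Measure Ω} [SFinite P] {ψ : Ω × Time T → F}
    (hψ : Integrable ψ (P.prod (leb T))) {S : Set (Time T)} (hS : MeasurableSet S) :
    Integrable (fun ω => ∫ s in S, ψ (ω, s) ∂leb T) P := by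
  have h := (hψ.indicator (measurable_snd hS)).integral_prod_left
  refine h.congr (Eventually.of_forall fun ω => ?_)
  simp only
  rw [← integral_indicator hS]
  rfl

variable {Φg Φh : E d → ℝ≥0} {M : ℝ≥0}

theorem CostData.marginalCost_eq {L : Skorokhod T d} {A : IncSkorokhod T k}
    (hψ : Integrable (fun s => grad c.h (L s) (A s)) (leb T)) (t : Time T) :
    c.marginalCost L A t = (grad c.g (L ⊤) (A ⊤) + ∫ s, grad c.h (L s) (A s) ∂leb T)
      + (c.f t - ∫ s in Iic t, grad c.h (L s) (A s) ∂leb T) := by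
  rw [marginalCost, integral_Ici_eq_sub hψ]
  abel

/-- The dual process: the càdlàg optional projection of the marginal cost. -/
theorem exists_dual_process (hg : IsC1InControl c.g) (hh : IsC1InControl c.h)
    (hΦ : c.IntegrableGrowth P Prod.fst Φg Φh M) (hA : IsControl P A)
    (hfin : c.FiniteCost P Prod.fst A) :
    ∃ Y : Skorokhod T d × IncSkorokhod T k → Skorokhod T k,
      (∀ t, Measurable[augFiltration P t] fun ω => Y ω t) ∧
      (∀ t i, (fun ω => Y ω t i) =ᵐ[P]
        P[fun ω => c.marginalCost ω.1 (A ω) t i | augFiltration P t]) ∧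
      ∀ t i, (fun ω => (Y ω t + (∫ s in Iic t, grad c.h (ω.1 s) (A ω s) ∂leb T) - c.f t) i) =ᵐ[P]
        P[fun ω => (grad c.g (ω.1 ⊤) (A ω ⊤) + ∫ s, grad c.h (ω.1 s) (A ω s) ∂leb T) i
          | augFiltration P t] := by
  have hψ := hfin.integrable_grad_h hh hΦ measurable_fst hA.measurable
  have hψω : ∀ᵐ ω ∂P, Integrable (fun s => grad c.h (ω.1 s) (A ω s)) (leb T) := hψ.prod_right_ae
  let Z : Skorokhod T d × IncSkorokhod T k → E k := fun ω =>
    grad c.g (ω.1 ⊤) (A ω ⊤) + ∫ s, grad c.h (ω.1 s) (A ω s) ∂leb T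
  let I : Time T → Skorokhod T d × IncSkorokhod T k → E k := fun t ω =>
    ∫ s in Iic t, grad c.h (ω.1 s) (A ω s) ∂leb T
  have hZ : Integrable Z P :=
    (hfin.integrable_grad_g hg hΦ measurable_fst hA.measurable).add hψ.integral_prod_left
  have hI : ∀ t, Integrable (I t) P := fun t => integrable_setIntegral_prod hψ measurableSet_Iic
  have hIm : ∀ t, Measurable[augFiltration P t] (I t) :=
    fun t => hA.measurable_setIntegral_Iic_grad hh t
  -- The marginal cost is `Z` plus an adapted continuous term, so its projection is the martingale
  -- closed by `Z` plus that same term.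
  obtain ⟨N, hN, hNm, hNZ⟩ := exists_cadlag_condExp (augFiltration P)
    (fun t S hS h0 => measurableSet_augFiltration_of_null t hS h0) hZ
  let G : Set (Skorokhod T d × IncSkorokhod T k) :=
    {ω | Integrable (fun s => grad c.h (ω.1 s) (A ω s)) (leb T)}
  have hGm : MeasurableSet G := measurableSet_integrable
    (f := fun ω s => grad c.h (ω.1 s) (A ω s)) (measurable_grad_comp_of_mem hh c.h_measurable
      (measurable_uncurry_skorokhod measurable_fst) (measurable_uncurry_incSkorokhod hA.measurable)
      fun p => (A p.1).mem_orthant _).stronglyMeasurable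
  have hGt : ∀ t, MeasurableSet[augFiltration P t] G := fun t =>
    MeasurableSet.of_compl (measurableSet_augFiltration_of_null t hGm.compl hψω)
  classical
  -- Off `G` the integral of the gradient may fail to be continuous in time. That set is null and
  -- known at every time, so 0 is an adapted, càdlàg replacement.
  let Y : Skorokhod T d × IncSkorokhod T k → Time T → E k := fun ω t =>
    if ω ∈ G then N ω t + (c.f t - I t ω) else 0
  have hYc : ∀ ω, IsCadlag (Y ω) := by
    intro ω
    by_cases hω : ω ∈ G
    · have hcont : Continuous fun t => c.f t - I t ω :=
        c.f_continuous.sub (continuous_integral_Iic hω)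
      have := (hN ω).map₂ (Continuous.isCadlag hcont) (F := fun p => p.1 + p.2) (by fun_prop)
      simpa only [Y, hω, if_true] using this
    · simp only [Y, hω, if_false]
      exact Continuous.isCadlag continuous_const
  have hYN : ∀ t, (fun ω => Y ω t) =ᵐ[P] fun ω => N ω t + (c.f t - I t ω) := by
    intro t
    filter_upwards [hψω] with ω hω
    exact if_pos hω
  refine ⟨fun ω => ⟨Y ω, hYc ω⟩, fun t => ?_, fun t i => ?_, fun t i => ?_⟩
  · exact Measurable.ite (hGt t) ((hNm t).add (measurable_const.sub (hIm t))) measurable_const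
  · have h1 : (fun ω => c.marginalCost ω.1 (A ω) t i) =ᵐ[P]
        (fun ω => Z ω i) + fun ω => (c.f t - I t ω) i := by
      filter_upwards [hψω] with ω hω
      rw [CostData.marginalCost_eq hω]
      rfl
    have h2 : Integrable (fun ω => (c.f t - I t ω) i) P :=
      integrable_euclidean_iff.1 ((integrable_const _).sub (hI t)) i
    have h3 : StronglyMeasurable[augFiltration P t] fun ω => (c.f t - I t ω) i :=
      Measurable.stronglyMeasurable ((@measurable_euclidean_iff _ _ (augFiltration P t) _).1
        (measurable_const.sub (hIm t)) i)
    refine EventuallyEq.trans ?_ (condExp_congr_ae h1).symm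
    refine EventuallyEq.trans ?_ (condExp_add (integrable_euclidean_iff.1 hZ i) h2 _).symm
    rw [condExp_of_stronglyMeasurable ((augFiltration P).le t) h3 h2]
    filter_upwards [hYN t, hNZ t i] with ω h4 h5
    rw [Pi.add_apply, ← h5]
    exact congrArg (fun x : E k => x i) h4
  · refine EventuallyEq.trans ?_ (hNZ t i)
    filter_upwards [hYN t] with ω h4
    change (Y ω t + I t ω - c.f t) i = N ω t i
    have h5 : N ω t + (c.f t - I t ω) + I t ω - c.f t = N ω t := by abel
    rw [h4, h5]

theorem integrable_marginalCost (hg : IsC1InControl c.g) (hh : IsC1InControl c.h)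
    (hΦ : c.IntegrableGrowth P Prod.fst Φg Φh M) (hA : IsControl P A)
    (hfin : c.FiniteCost P Prod.fst A) (t : Time T) :
    Integrable (fun ω => c.marginalCost ω.1 (A ω) t) P :=
  ((integrable_const _).add (hfin.integrable_grad_g hg hΦ measurable_fst hA.measurable)).add
    (integrable_setIntegral_prod (hfin.integrable_grad_h hh hΦ measurable_fst hA.measurable)
      measurableSet_Ici)

theorem exists_bound_marginalCost (hg : IsC1InControl c.g) (hh : IsC1InControl c.h)
    (hΦ : c.IntegrableGrowth P Prod.fst Φg Φh M) (hA : IsControl P A)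
    (hfin : c.FiniteCost P Prod.fst A) :
    ∃ B : Skorokhod T d × IncSkorokhod T k → ℝ, Integrable B P ∧
      ∀ᵐ ω ∂P, ∀ t, ‖c.marginalCost ω.1 (A ω) t‖ ≤ B ω := by
  have hψ := hfin.integrable_grad_h hh hΦ measurable_fst hA.measurable
  obtain ⟨K, hK⟩ := (Continuous.isCadlag c.f_continuous).exists_norm_le
  refine ⟨fun ω => K + ‖grad c.g (ω.1 ⊤) (A ω ⊤)‖ + ∫ s, ‖grad c.h (ω.1 s) (A ω s)‖ ∂leb T,
    ((integrable_const _).add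
      (hfin.integrable_grad_g hg hΦ measurable_fst hA.measurable).norm).add
      hψ.norm.integral_prod_left, ?_⟩
  filter_upwards [hψ.prod_right_ae] with ω hω t
  refine (norm_add_le _ _).trans (add_le_add ((norm_add_le _ _).trans
    (add_le_add (hK t) le_rfl)) ?_)
  exact (norm_integral_le_integral_norm _).trans
    (setIntegral_le_integral hω.norm (Eventually.of_forall fun s => norm_nonneg _))

section Slackness

variable {Y : Skorokhod T d × IncSkorokhod T k → Skorokhod T k}
  {Γ : Skorokhod T d × IncSkorokhod T k → Time T → E k}

/-- At a fixed time, test against the events known then. Countably many dyadic times share one null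
set, and right-continuity extends the inequality to all times. -/
theorem ae_nonneg_of_condExp (hYm : ∀ t, Measurable[augFiltration P t] fun ω => Y ω t)
    (hΓi : ∀ t, Integrable (fun ω => Γ ω t) P)
    (hY : ∀ t i, (fun ω => Y ω t i) =ᵐ[P] P[fun ω => Γ ω t i | augFiltration P t])
    (hΓ : ∀ t G, MeasurableSet[augFiltration P t] G → ∀ i, 0 ≤ ∫ ω in G, Γ ω t i ∂P) :
    ∀ᵐ ω ∂P, ∀ t i, 0 ≤ Y ω t i := by
  have h1 : ∀ t i, ∀ᵐ ω ∂P, 0 ≤ Y ω t i := by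
    intro t i
    have hm := (augFiltration P).le t
    have hsm : StronglyMeasurable[augFiltration P t] fun ω => Y ω t i :=
      ((@measurable_euclidean_iff _ _ (augFiltration P t) _).1 (hYm t) i).stronglyMeasurable
    have hint : Integrable (fun ω => Y ω t i) P := integrable_condExp.congr (hY t i).symm
    refine ae_le_of_ae_le_trim (hm := hm) (ae_nonneg_of_forall_setIntegral_nonneg
      (hint.trim hm hsm) fun S hS _ => ?_)
    rw [← setIntegral_trim hm hsm hS, setIntegral_congr_ae (hm S hS) ((hY t i).mono fun ω h _ => h),
      setIntegral_condExp hm (integrable_euclidean_iff.1 (hΓi t) i) hS]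
    exact hΓ t S hS i
  have h2 : ∀ᵐ ω ∂P, ∀ t ∈ dyadics T, ∀ i, 0 ≤ Y ω t i :=
    (ae_ball_iff countable_dyadics).2 fun t _ => ae_all_iff.2 (h1 t)
  filter_upwards [h2] with ω hω t i
  exact ge_of_tendsto (((by fun_prop : Continuous fun a : E k => a i).tendsto _).comp
    ((Y ω).2.tendsto_gridUp t)) (Eventually.of_forall fun n => hω _ (gridUp_mem_dyadics n t) i)

theorem measurable_gridIncr_trunc (hA : IsControl P A) (n : ℕ) (i : Fin k) (m j : ℕ) :
    Measurable[augFiltration P (gridPt T m j)] fun ω =>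
      gridIncr m (fun t => (A ω).trunc n t i) j := by
  have h : ∀ s ≤ gridPt T m j, Measurable[augFiltration P (gridPt T m j)] fun ω =>
      (A ω).trunc n s i := fun s hs =>
    ((@measurable_euclidean_iff _ _ (augFiltration P s) _).1 (hA.trunc n s) i).mono
      ((augFiltration P).mono hs) le_rfl
  cases j with
  | zero => exact h _ le_rfl
  | succ j => exact (h _ le_rfl).sub (h _ (gridPt_mono m j.le_succ))

theorem abs_gridIncr_trunc_le (A : IncSkorokhod T k) (n : ℕ) (i : Fin k) (m j : ℕ) :
    |gridIncr m (fun t => A.trunc n t i) j| ≤ n := by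
  have h0 : ∀ t, 0 ≤ A.trunc n t i := fun t => (A.trunc n).nonneg t i
  have h1 : ∀ t, A.trunc n t i ≤ n := fun t => min_le_right _ _
  rw [abs_of_nonneg (gridIncr_nonneg m ((A.trunc n).2.2.1 i) (h0 ⊥) j)]
  cases j with
  | zero => exact h1 _
  | succ j => exact (sub_le_self _ (h0 _)).trans (h1 _)

/-- In each summand the increment is bounded by `n` and known at the right endpoint where Γ is
evaluated, so it passes through the conditional expectation. -/
theorem integral_riemannSum_eq (hA : IsControl P A) (hΓi : ∀ t, Integrable (fun ω => Γ ω t) P)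
    (hY : ∀ t i, (fun ω => Y ω t i) =ᵐ[P] P[fun ω => Γ ω t i | augFiltration P t])
    (n m : ℕ) (i : Fin k) :
    Integrable (fun ω => riemannSum m (fun t => Y ω t i) fun t => (A ω).trunc n t i) P ∧
    Integrable (fun ω => riemannSum m (fun t => Γ ω t i) fun t => (A ω).trunc n t i) P ∧
    ∫ ω, riemannSum m (fun t => Y ω t i) (fun t => (A ω).trunc n t i) ∂P =
      ∫ ω, riemannSum m (fun t => Γ ω t i) (fun t => (A ω).trunc n t i) ∂P := by
  have hI : ∀ (X : Skorokhod T d × IncSkorokhod T k → ℝ), Integrable X P → ∀ j,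
      Integrable (fun ω => gridIncr m (fun t => (A ω).trunc n t i) j * X ω) P := fun X hX j =>
    hX.bdd_mul (c := n) ((measurable_gridIncr_trunc hA n i m j).mono
      ((augFiltration P).le _) le_rfl).aestronglyMeasurable
      (Eventually.of_forall fun ω => abs_gridIncr_trunc_le _ _ _ _ _)
  have hYi : ∀ t, Integrable (fun ω => Y ω t i) P := fun t =>
    integrable_condExp.congr (hY t i).symm
  have hΓi' : ∀ t, Integrable (fun ω => Γ ω t i) P := fun t => integrable_euclidean_iff.1 (hΓi t) i
  refine ⟨integrable_finsetSum _ fun j _ => hI _ (hYi _) j,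
    integrable_finsetSum _ fun j _ => hI _ (hΓi' _) j, ?_⟩
  unfold riemannSum
  rw [integral_finsetSum _ fun j _ => hI _ (hYi _) j,
    integral_finsetSum _ fun j _ => hI _ (hΓi' _) j]
  refine Finset.sum_congr rfl fun j _ => ?_
  rw [← integral_condExp ((augFiltration P).le (gridPt T m j)) (f := fun ω =>
    gridIncr m (fun t => (A ω).trunc n t i) j * Γ ω (gridPt T m j) i)]
  refine integral_congr_ae ?_
  have h1 := condExp_mul_of_stronglyMeasurable_left (μ := P)
    (measurable_gridIncr_trunc hA n i m j).stronglyMeasurable (hI _ (hΓi' (gridPt T m j)) j)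
    (hΓi' (gridPt T m j))
  refine EventuallyEq.trans ?_ h1.symm
  filter_upwards [hY (gridPt T m j) i] with ω hω
  rw [Pi.mul_apply, ← hω]

/-- Complementary slackness for the dual process, along a truncation of the optimal path. -/
theorem ae_integral_trunc_eq_zero (hA : IsControl P A)
    (hΓi : ∀ t, Integrable (fun ω => Γ ω t) P)
    (hY : ∀ t i, (fun ω => Y ω t i) =ᵐ[P] P[fun ω => Γ ω t i | augFiltration P t])
    (hYm : Measurable Y)
    (hY0 : ∀ᵐ ω ∂P, ∀ t i, 0 ≤ Y ω t i) (hΓc : ∀ᵐ ω ∂P, IsCadlag (Γ ω))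
    {B : Skorokhod T d × IncSkorokhod T k → ℝ} (hB : Integrable B P)
    (hΓB : ∀ᵐ ω ∂P, ∀ t, ‖Γ ω t‖ ≤ B ω) {n : ℕ}
    (hle : ∫ ω, ∑ i, ∫ t, Γ ω t i ∂(((A ω).trunc n).dMeasure i) ∂P ≤ 0) :
    ∀ᵐ ω ∂P, ∑ i, ∫ t, Y ω t i ∂(((A ω).trunc n).dMeasure i) = 0 := by
  have hR := fun m i => integral_riemannSum_eq hA hΓi hY n m i
  let RY : ℕ → Skorokhod T d × IncSkorokhod T k → ℝ := fun m ω =>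
    ∑ i, riemannSum m (fun t => Y ω t i) fun t => (A ω).trunc n t i
  let RΓ : ℕ → Skorokhod T d × IncSkorokhod T k → ℝ := fun m ω =>
    ∑ i, riemannSum m (fun t => Γ ω t i) fun t => (A ω).trunc n t i
  have hRYi : ∀ m, Integrable (RY m) P := fun m => integrable_finsetSum _ fun i _ => (hR m i).1
  have hRΓi : ∀ m, Integrable (RΓ m) P := fun m => integrable_finsetSum _ fun i _ => (hR m i).2.1
  have hReq : ∀ m, ∫ ω, RY m ω ∂P = ∫ ω, RΓ m ω ∂P := fun m => by
    rw [integral_finsetSum _ fun i _ => (hR m i).1, integral_finsetSum _ fun i _ => (hR m i).2.1]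
    exact Finset.sum_congr rfl fun i _ => (hR m i).2.2
  have hRY0 : ∀ m, 0 ≤ᵐ[P] RY m := fun m => by
    filter_upwards [hY0] with ω hω
    exact Finset.sum_nonneg fun i _ => riemannSum_nonneg m (fun t => hω t i)
      (((A ω).trunc n).2.2.1 i) (((A ω).trunc n).nonneg ⊥ i)
  have hlimΓ : Tendsto (fun m => ∫ ω, RΓ m ω ∂P) atTop
      (𝓝 (∫ ω, ∑ i, ∫ t, Γ ω t i ∂(((A ω).trunc n).dMeasure i) ∂P)) := by
    refine tendsto_integral_of_dominated_convergence (fun ω => ∑ _i : Fin k, B ω * n)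
      (fun m => (hRΓi m).1) (integrable_finsetSum _ fun i _ => hB.mul_const _) (fun m => ?_) ?_
    · filter_upwards [hΓB] with ω hω
      refine (norm_sum_le _ _).trans (Finset.sum_le_sum fun i _ => ?_)
      refine (abs_riemannSum_le m (fun t => (PiLp.norm_apply_le (Γ ω t) i).trans (hω t))
        (((A ω).trunc n).2.2.1 i) (((A ω).trunc n).nonneg ⊥ i)).trans ?_
      exact mul_le_mul_of_nonneg_left (min_le_right _ _) ((norm_nonneg _).trans (hω ⊤))
    · filter_upwards [hΓc] with ω hω
      exact tendsto_finsetSum _ fun i _ => ((A ω).trunc n).tendsto_riemannSum i hω i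
  have hYint : ∀ ω, Tendsto (fun m => RY m ω) atTop
      (𝓝 (∑ i, ∫ t, Y ω t i ∂(((A ω).trunc n).dMeasure i))) := fun ω =>
    tendsto_finsetSum _ fun i _ => ((A ω).trunc n).tendsto_riemannSum i (Y ω).2 i
  have hYmeas : Measurable fun ω => ∑ i, ∫ t, Y ω t i ∂(((A ω).trunc n).dMeasure i) :=
    Finset.measurable_fun_sum _ fun i _ => measurable_integral_dMeasure (y := fun ω => Y ω)
      (hA.trunc n).measurable (fun ω => (Y ω).2) (fun t => Skorokhod.measurable_iff.1 hYm t) i i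
  -- No integrable bound on the paths of Y is available, so on its side Fatou's lemma is used,
  -- thanks to Y ≥ 0. The Riemann sums of Γ converge dominatedly, since Γ is bounded in time by `B`.
  have hzero : ∫⁻ ω, ENNReal.ofReal (∑ i, ∫ t, Y ω t i ∂(((A ω).trunc n).dMeasure i)) ∂P = 0 := by
    refine le_antisymm ?_ zero_le
    calc ∫⁻ ω, ENNReal.ofReal (∑ i, ∫ t, Y ω t i ∂(((A ω).trunc n).dMeasure i)) ∂P
        = ∫⁻ ω, liminf (fun m => ENNReal.ofReal (RY m ω)) atTop ∂P :=
          lintegral_congr fun ω =>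
            ((ENNReal.continuous_ofReal.tendsto _).comp (hYint ω)).liminf_eq.symm
      _ ≤ liminf (fun m => ∫⁻ ω, ENNReal.ofReal (RY m ω) ∂P) atTop :=
          lintegral_liminf_le' fun m => (hRYi m).1.aemeasurable.ennreal_ofReal
      _ = liminf (fun m => ENNReal.ofReal (∫ ω, RΓ m ω ∂P)) atTop := by
          refine congrArg (fun u => liminf u atTop) (funext fun m => ?_)
          rw [← hReq, ofReal_integral_eq_lintegral_ofReal (hRYi m) (hRY0 m)]
      _ = ENNReal.ofReal (∫ ω, ∑ i, ∫ t, Γ ω t i ∂(((A ω).trunc n).dMeasure i) ∂P) :=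
          ((ENNReal.continuous_ofReal.tendsto _).comp hlimΓ).liminf_eq
      _ = 0 := ENNReal.ofReal_eq_zero.2 hle
  rw [lintegral_eq_zero_iff hYmeas.ennreal_ofReal] at hzero
  filter_upwards [hzero, hY0] with ω h1 h2
  exact le_antisymm (ENNReal.ofReal_eq_zero.1 h1)
    (Finset.sum_nonneg fun i _ => integral_nonneg fun t => h2 t i)

theorem IncSkorokhod.exists_trunc_eq (A : IncSkorokhod T k) : ∃ n : ℕ, A.trunc n = A := by
  obtain ⟨n, hn⟩ := exists_nat_ge ‖A ⊤‖
  refine ⟨n, Subtype.ext (funext fun t => ?_)⟩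
  ext i
  exact min_eq_left ((A.le_top t i).trans ((le_abs_self _).trans
    ((PiLp.norm_apply_le (A ⊤) i).trans hn)))

end Slackness

end Dual


/-! ### Assembling the law of (L,A,Y). -/

section Solution

variable {T : ℝ} [hT : Fact (0 < T)] {d k : ℕ} {P₀ : Measure (Skorokhod T d)}
  {P : Measure (Skorokhod T d × IncSkorokhod T k)} {c : CostData T d k} {Φg Φh : E d → ℝ≥0}
  {M : ℝ≥0} {A : Skorokhod T d × IncSkorokhod T k → IncSkorokhod T k}
  {Y : Skorokhod T d × IncSkorokhod T k → Skorokhod T k}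

theorem CostData.GradientGrowth.exists_integrableGrowth (hgrowth : c.GradientGrowth P₀)
    (hP : Admissible P₀ P) : ∃ Φg Φh M, c.IntegrableGrowth P Prod.fst Φg Φh M := by
  have := hP.isProbabilityMeasure
  obtain ⟨Φg, Φh, M, hΦg, hΦh, hfin, hgle, hhle⟩ := hgrowth
  have hLm : Measurable fun p : Skorokhod T d × Time T => Φh (p.1 p.2) :=
    hΦh.comp (measurable_uncurry_skorokhod measurable_id)
  have hgm : Measurable fun L : Skorokhod T d => (Φg (L ⊤) : ℝ≥0∞) :=
    (hΦg.comp (Skorokhod.measurable_eval ⊤)).coe_nnreal_ennreal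
  have hhm : Measurable fun L : Skorokhod T d => ∫⁻ t, (Φh (L t) : ℝ≥0∞) ∂leb T :=
    hLm.coe_nnreal_ennreal.lintegral_prod_right'
  have hsum : ∫⁻ L, ((∫⁻ t, Φh (L t) ∂leb T) + Φg (L ⊤)) ∂P₀ =
      ∫⁻ ω, ∫⁻ t, Φh (ω.1 t) ∂leb T ∂P + ∫⁻ ω, Φg (ω.1 ⊤) ∂P := by
    rw [← hP.marginal, lintegral_map (f := fun L : Skorokhod T d =>
      (∫⁻ t, (Φh (L t) : ℝ≥0∞) ∂leb T) + Φg (L ⊤)) (hhm.add hgm) measurable_fst]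
    exact lintegral_add_right _ (hgm.comp measurable_fst)
  rw [hsum, ENNReal.add_lt_top] at hfin
  have hmh : Measurable fun p : (Skorokhod T d × IncSkorokhod T k) × Time T => Φh (p.1.1 p.2) :=
    hLm.comp ((measurable_fst.comp measurable_fst).prodMk measurable_snd)
  have hmg : Measurable fun ω : Skorokhod T d × IncSkorokhod T k => Φg (ω.1 ⊤) :=
    hΦg.comp ((Skorokhod.measurable_eval ⊤).comp measurable_fst)
  refine ⟨Φg, Φh, M, ?_, ?_, hgle, hhle⟩
  · refine integrable_of_lintegral_ofReal_ne_top hmg.coe_nnreal_real (fun _ => NNReal.coe_nonneg _) ?_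
    simp only [ENNReal.ofReal_coe_nnreal]
    exact hfin.2.ne
  · refine integrable_of_lintegral_ofReal_ne_top hmh.coe_nnreal_real (fun _ => NNReal.coe_nonneg _) ?_
    simp only [ENNReal.ofReal_coe_nnreal]
    rw [lintegral_prod _ hmh.coe_nnreal_ennreal.aemeasurable]
    exact hfin.1.ne

/-- The martingale part of the Pontryagin system, on the space of triples. -/
def CostData.dualMartingale (c : CostData T d k) (t : Time T) (τ : Triple T d k) : E k :=
  τ.2.2 t + (∫ s in Iic t, grad c.h (τ.1 s) (τ.2.1 s) ∂leb T) - c.f t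

theorem measurable_eval_filtLAY {s t : Time T} (hst : s ≤ t) :
    Measurable[filtLAY T d k t] fun τ : Triple T d k => (τ.1 s, τ.2.1 s, τ.2.2 s) :=
  Measurable.of_comap_le (le_iSup₂_of_le s hst le_rfl)

theorem CostData.measurable_dualMartingale (hh : IsC1InControl c.h) (t : Time T) :
    Measurable[filtLAY T d k t] (c.dualMartingale t) := by
  have h := fun s (hs : s ≤ t) => measurable_eval_filtLAY (T := T) (d := d) (k := k) hs
  have h1 := @measurable_setIntegral_Iic_grad T hT d k _ (filtLAY T d k t) _ hh
    c.h_measurable (fun τ : Triple T d k => τ.1) (fun τ => τ.2.1) (fun τ => τ.1.2)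
    (fun τ => τ.2.1.2.1) (fun τ => τ.2.1.mem_orthant) t
    (fun s hs => measurable_fst.comp (h s hs))
    (fun s hs => (measurable_fst.comp measurable_snd).comp (h s hs))
  exact (((measurable_snd.comp measurable_snd).comp (h t le_rfl)).add h1).sub measurable_const

theorem measurable_triple (hA : IsControl P A)
    (hYm : ∀ t, Measurable[augFiltration P t] fun ω => Y ω t) :
    Measurable fun ω => ((ω.1, A ω, Y ω) : Triple T d k) :=
  measurable_fst.prodMk (hA.measurable.prodMk
    (Skorokhod.measurable_iff.2 fun t => (hYm t).mono ((augFiltration P).le t) le_rfl))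

theorem measurableSet_preimage_filtLAY (hA : IsControl P A)
    (hYm : ∀ t, Measurable[augFiltration P t] fun ω => Y ω t) {t : Time T}
    {S : Set (Triple T d k)} (hS : MeasurableSet[filtLAY T d k t] S) :
    MeasurableSet[augFiltration P t] ((fun ω => ((ω.1, A ω, Y ω) : Triple T d k)) ⁻¹' S) := by
  have hle : filtLAY T d k t ≤ (augFiltration P t).map fun ω => ((ω.1, A ω, Y ω) : Triple T d k) := by
    refine iSup₂_le fun s hs => ?_
    rw [MeasurableSpace.comap_le_iff_le_map]
    exact (((measurable_fst_eval_augFiltration s).prodMk ((hA s).prodMk (hYm s))).mono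
      ((augFiltration P).mono hs) le_rfl).le_map
  exact hle S hS

/-- A process which is, in law, the càdlàg version of a closed martingale is a martingale in its
own filtration. -/
theorem martingale_dualMartingale [IsProbabilityMeasure P] (hh : IsC1InControl c.h)
    (hA : IsControl P A) (hYm : ∀ t, Measurable[augFiltration P t] fun ω => Y ω t)
    {Z : Skorokhod T d × IncSkorokhod T k → E k} (hZ : Integrable Z P)
    (hYZ : ∀ t i, (fun ω => c.dualMartingale t (ω.1, A ω, Y ω) i) =ᵐ[P]
      P[fun ω => Z ω i | augFiltration P t]) :
    Martingale c.dualMartingale (filtLAY T d k)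
      (P.map fun ω => ((ω.1, A ω, Y ω) : Triple T d k)) := by
  have hj := measurable_triple hA hYm
  have := Measure.isProbabilityMeasure_map (μ := P) hj.aemeasurable
  have hNm := fun t => CostData.measurable_dualMartingale (c := c) hh t
  have hNm' := fun t => (hNm t).mono ((filtLAY T d k).le t) le_rfl
  have hNi : ∀ t, Integrable (fun ω => c.dualMartingale t (ω.1, A ω, Y ω)) P := fun t =>
    integrable_euclidean_iff.2 fun i => integrable_condExp.congr (hYZ t i).symm
  have hNQ : ∀ t, Integrable (c.dualMartingale t)
      (P.map fun ω => ((ω.1, A ω, Y ω) : Triple T d k)) := fun t =>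
    (integrable_map_measure (hNm' t).aestronglyMeasurable hj.aemeasurable).2 (hNi t)
  -- The right-hand side does not depend on `t`, which is the martingale property. The event pulls
  -- back to one known at `s` in the augmented filtration, hence at `t`, and there the process
  -- integrates like `Z`.
  have hint : ∀ s t, s ≤ t → ∀ S, MeasurableSet[filtLAY T d k s] S → ∀ i,
      (∫ τ in S, c.dualMartingale t τ ∂(P.map fun ω => ((ω.1, A ω, Y ω) : Triple T d k))) i =
        ∫ ω in (fun ω => ((ω.1, A ω, Y ω) : Triple T d k)) ⁻¹' S, Z ω i ∂P := by
    intro s t hst S hS i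
    have hS' := (augFiltration P).mono hst _ (measurableSet_preimage_filtLAY hA hYm hS)
    rw [setIntegral_map ((filtLAY T d k).le s S hS) (hNm' t).aestronglyMeasurable hj.aemeasurable,
      integral_euclidean_apply (hNi t).integrableOn,
      setIntegral_congr_ae ((augFiltration P).le t _ hS') ((hYZ t i).mono fun ω h _ => h),
      setIntegral_condExp ((augFiltration P).le t) (integrable_euclidean_iff.1 hZ i) hS']
  refine ⟨fun t => (hNm t).stronglyMeasurable, fun s t hst => ?_⟩
  refine (ae_eq_condExp_of_forall_setIntegral_eq ((filtLAY T d k).le s) (hNQ t)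
    (fun _ _ _ => (hNQ s).integrableOn) (fun S hS _ => ?_)
    (hNm s).stronglyMeasurable.aestronglyMeasurable).symm
  ext i
  rw [hint s s le_rfl S hS i, hint s t hst S hS i]

/-- By right-continuity the condition need only be imposed at the countably many dyadic times. -/
theorem measurableSet_nonneg_path :
    MeasurableSet {τ : Triple T d k | ∀ t i, 0 ≤ τ.2.2 t i} := by
  have h : {τ : Triple T d k | ∀ t i, 0 ≤ τ.2.2 t i} =
      ⋂ t ∈ dyadics T, ⋂ i, {τ : Triple T d k | 0 ≤ τ.2.2 t i} := by
    ext τ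
    simp only [mem_iInter, mem_ofPred_eq]
    refine ⟨fun h t _ i => h t i, fun h t i => ?_⟩
    exact ge_of_tendsto (((by fun_prop : Continuous fun a : E k => a i).tendsto _).comp
      (τ.2.2.2.tendsto_gridUp t)) (Eventually.of_forall fun n => h _ (gridUp_mem_dyadics n t) i)
  rw [h]
  refine MeasurableSet.biInter countable_dyadics fun t _ => MeasurableSet.iInter fun i => ?_
  exact measurableSet_le measurable_const (measurable_euclidean_iff.1
    ((Skorokhod.measurable_eval t).comp (measurable_snd.comp measurable_snd)) i)

/-- An optimal control carries a solution of the Pontryagin system. -/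
theorem exists_solution_of_optimal (hg : IsC1InControl c.g) (hh : IsC1InControl c.h)
    (hP : Admissible P₀ P) (hΦ : c.IntegrableGrowth P Prod.fst Φg Φh M) (hA : IsControl P A)
    (hcost : c.controlCost P A < ∞)
    (hopt : ∀ b, IsControl P b → c.controlCost P A ≤ c.controlCost P b) :
    ∃ Q : Measure (Triple T d k), IsPontryaginSolution c P₀ Q := by
  have := hP.isProbabilityMeasure
  have hfin := c.finiteCost measurable_fst hA.measurable hcost
  have hψ := hfin.integrable_grad_h hh hΦ measurable_fst hA.measurable
  obtain ⟨Y, hYm, hYΓ, hYZ⟩ := exists_dual_process hg hh hΦ hA hfin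
  have hΓi := integrable_marginalCost hg hh hΦ hA hfin
  obtain ⟨B, hB, hΓB⟩ := exists_bound_marginalCost hg hh hΦ hA hfin
  have hj := measurable_triple hA hYm
  have hYmeas : Measurable Y := (measurable_snd.comp measurable_snd).comp hj
  have hY0 := ae_nonneg_of_condExp hYm hΓi hYΓ fun t G hG i =>
    setIntegral_marginalCost_nonneg hg hh hΦ hA hcost hopt hG i
  have hΓc : ∀ᵐ ω ∂P, IsCadlag (c.marginalCost ω.1 (A ω)) := by
    filter_upwards [hψ.prod_right_ae] with ω hω
    exact Continuous.isCadlag (CostData.continuous_marginalCost hω)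
  have hslack : ∀ᵐ ω ∂P, ∀ n : ℕ, ∑ i, ∫ t, Y ω t i ∂(((A ω).trunc n).dMeasure i) = 0 :=
    ae_all_iff.2 fun n => ae_integral_trunc_eq_zero hA hΓi hYΓ hYmeas hY0 hΓc hB hΓB
      (integral_marginalCost_trunc_nonpos hg hh hΦ hA hcost hopt n)
  have hAm : Measurable fun τ : Triple T d k => τ.2.1 := measurable_fst.comp measurable_snd
  have hLm : Measurable fun τ : Triple T d k => τ.1 := measurable_fst
  have hYm' : Measurable fun τ : Triple T d k => τ.2.2 := measurable_snd.comp measurable_snd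
  refine ⟨P.map fun ω => (ω.1, A ω, Y ω),
    Measure.isProbabilityMeasure_map hj.aemeasurable, ?_, ?_, ?_, ?_, ?_, ?_⟩
  · rw [Measure.map_map (hLm.prodMk hAm) hj]
    exact hA.admissible_map hP
  · exact (ae_map_iff hj.aemeasurable measurableSet_nonneg_path).2 hY0
  · have hm : Measurable fun τ : Triple T d k => ∑ i, ∫ t, τ.2.2 t i ∂(τ.2.1.dMeasure i) :=
      Finset.measurable_fun_sum _ fun i _ => measurable_integral_dMeasure
        (y := fun τ : Triple T d k => τ.2.2) hAm (fun τ => τ.2.2.2)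
        (Skorokhod.measurable_iff.1 hYm') i i
    refine (ae_map_iff hj.aemeasurable (hm (measurableSet_singleton 0))).2 ?_
    -- The null set is common to all truncation levels, so the level may depend on the scenario; one
    -- that exceeds |A_T| leaves the path unchanged.
    filter_upwards [hslack] with ω hω
    obtain ⟨n, hn⟩ := (A ω).exists_trunc_eq
    have h := hω n
    rw [hn] at h
    exact h
  · refine (ae_map_iff hj.aemeasurable (measurableSet_integrable
      (f := fun (τ : Triple T d k) s => grad c.h (τ.1 s) (τ.2.1 s))
      (measurable_grad_comp_of_mem hh c.h_measurable (measurable_uncurry_skorokhod hLm)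
        (measurable_uncurry_incSkorokhod hAm)
        fun p => p.1.2.1.mem_orthant _).stronglyMeasurable)).2 hψ.prod_right_ae
  · exact martingale_dualMartingale hh hA hYm
      ((hfin.integrable_grad_g hg hΦ measurable_fst hA.measurable).add hψ.integral_prod_left) hYZ
  · have hm1 : Measurable fun τ : Triple T d k => τ.2.2 ⊤ := Skorokhod.measurable_iff.1 hYm' ⊤
    have hm2 : Measurable fun τ : Triple T d k => c.f ⊤ + grad c.g (τ.1 ⊤) (τ.2.1 ⊤) :=
      (measurable_grad_comp_of_mem hg c.g_measurable (Skorokhod.measurable_iff.1 hLm ⊤)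
        (IncSkorokhod.measurable_iff.1 hAm ⊤) fun τ => τ.2.1.mem_orthant ⊤).const_add _
    refine (ae_map_iff hj.aemeasurable (measurableSet_eq_fun hm1 hm2)).2 ?_
    -- At T the remaining integral is over a null set. What is left is known at T, so the
    -- conditional expectation defining Y_T acts trivially.
    have hΓ : ∀ ω : Skorokhod T d × IncSkorokhod T k,
        c.marginalCost ω.1 (A ω) ⊤ = c.f ⊤ + grad c.g (ω.1 ⊤) (A ω ⊤) := by
      intro ω
      have h0 : leb T (Ici ⊤) = 0 := by rw [Ici_top]; exact measure_singleton _
      rw [CostData.marginalCost, Measure.restrict_eq_zero.2 h0, integral_zero_measure, add_zero]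
    have hcoord : ∀ i, ∀ᵐ ω ∂P, Y ω ⊤ i = c.marginalCost ω.1 (A ω) ⊤ i := by
      intro i
      have hsm : StronglyMeasurable[augFiltration P ⊤] fun ω => c.marginalCost ω.1 (A ω) ⊤ i := by
        simp_rw [hΓ]
        exact Measurable.stronglyMeasurable ((@measurable_euclidean_iff _ _ (augFiltration P ⊤)
          _).1 ((hA.measurable_terminal_grad hg).const_add _) i)
      have h := hYΓ ⊤ i
      rw [condExp_of_stronglyMeasurable ((augFiltration P).le ⊤) hsm
        (integrable_euclidean_iff.1 (hΓi ⊤) i)] at h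
      exact h
    filter_upwards [ae_all_iff.2 hcoord] with ω hω
    rw [← hΓ]
    ext i
    exact hω i

end Solution

end

end MonotoneFollower

open MonotoneFollower in
theorem corollary2p11 (T : ℝ) [Fact (0 < T)] (d k : ℕ)
    (P₀ : MeasureTheory.Measure (Skorokhod T d)) [MeasureTheory.IsProbabilityMeasure P₀]
    (c : CostData T d k)
    (hg : IsC1InControl c.g) (hh : IsC1InControl c.h)
    (hcoercive : c.LinearlyCoercive P₀)
    (hgrowth : c.GradientGrowth P₀)
    (hvalue : c.value P₀ < ⊤) :
    ∃ Q : MeasureTheory.Measure (Triple T d k), IsPontryaginSolution c P₀ Q := by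
  -- Any admissible law of finite cost will do; it only provides the space on which the optimisation
  -- takes place.
  obtain ⟨P, hP⟩ := iInf_lt_iff.1 hvalue
  obtain ⟨hadm, hfin⟩ := iInf_lt_iff.1 hP
  obtain ⟨Φg, Φh, M, hΦ⟩ := hgrowth.exists_integrableGrowth hadm
  obtain ⟨A, hA, hcost, hopt⟩ := exists_optimal_control hg hh hcoercive hadm hfin
  exact exists_solution_of_optimal hg hh hadm hΦ hA hcost hopt
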